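/- Let $\mathbb T$ be a Galton--Watson tree with root $\varnothing$ and offspring distribution $(p_k)_{k\ge 0}$, $p_0=0$, let $\nu$ be a random variable with this distribution, and suppose $m=\mathbb E[\nu]\in(1,\infty)$. Write $|x|$ for the depth of a vertex $x$. Independently of $\mathbb T$, let the edges carry i.i.d. positive marks distributed as $\xi$, and let $\xi_x$ be the mark of the edge from $x\ne\varnothing$ to its parent; give this edge the resistance $m^{|x|}\xi_x$. Let $R_n$ be the effective resistance between $\varnothing$ and the set of vertices at depth $n$ (the minimal energy $\sum_e r(e)\theta(e)^2$ of a unit flow $\theta$ between them), $C_n=1/R_n$ and $\{C_n\}=C_n/\mathbb E[C_n]$. For a vertex $x$ let $W^{(x)}=\lim_{n\to\infty} m^{|x|-n}\,\#\{y:|y|=n,\ y \text{ is a descendant of } x\}$ and $W=W^{(\varnothing)}$. Put $$a_1=\frac{\mathbb E[\nu(\nu-1)]}{m^{2}},\quad a_2=\frac{\mathbb E[\nu(\nu-1)(\nu-2)]}{m^{3}},\quad b_1=\mathbb E[\xi],\quad b_2=\mathbb E[\xi^2],\quad c_1=\frac{a_1b_1}{1-m^{-1}},$$ $$c_2=\frac{1}{1-m^{-2}}\Big(\frac{3a_1^2}{m-1}+a_2\Big),\quad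 c_3=\frac{2a_1c_1}{m-1}-\frac{2b_1c_2}{m},\quad c_4=\frac{b_1}{1-m^{-1}}\Big(\frac{c_3}{c_1}+a_1\Big)-b_2\frac{c_2}{c_1}.$$ Assume that $\mathbb E[\xi^3+\xi^{-1}+\nu^4]<\infty$. Then almost surely all the limits $W^{(x)}$ exist and $W>0$, the series $$S=\sum_{\ell=1}^\infty \frac1{m^{\ell}}\sum_{|x|=\ell}W^{(x)}\Big(1-\frac{\xi_x}{c_1}W^{(x)}\Big)$$ converges almost surely and in $L^2$, and $$n\big(\{C_n\}-W\big)\longrightarrow S\quad\text{in probability as } n\to\infty .$$ Moreover there is a constant $c_0\in\mathbb R$ such that, as $n\to\infty$, $$\mathbb E[C_n]=\frac1{c_1n}-\frac{c_4}{c_1^2}\frac{\log n}{n^2}-\frac{c_0}{c_1^2}\frac1{n^2}+O\Big(\frac{(\log n)^2}{n^3}\Big),$$ and, with this same (uniquely determined) constant $c_0$, $$R_n-\bigg(\frac{c_1}{W}n+\frac{c_4}{W}\log n+\frac1W\Big(c_0-\frac1W\sum_{\ell=1}^\infty\frac1{m^{\ell}}\sum_{|x|=\ell}W^{(x)}\big(c_1-\xi_xW^{(x)}\big)\Big)\bigg)\longrightarrow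 0\quad\text{in probability.}$$ -/

import Mathlib

open MeasureTheory ProbabilityTheory Filter Topology Asymptotics
open scoped ENNReal

/-! ### Electric networks: flows, energy, effective resistance -/

section Network

variable {V : Type*}

/-- `θ` is a flow of unit strength from `A` to `Z` in the graph `G`. A flow is an antisymmetric
function on directed edges (extended by zero to pairs that are not adjacent), with zero divergence
outside `A ∪ Z`; its strength is the net amount that leaves `A`, and the net amount that
enters `Z`. (All sums are finite when `G` is locally finite and `A`, `Z` are finite.) -/
structure IsUnitFlow (G : SimpleGraph V) (A Z : Set V) (θ : V → V → ℝ) : Prop where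
  antisymm : ∀ x y, θ x y = -θ y x
  support : ∀ x y, ¬ G.Adj x y → θ x y = 0
  node_law : ∀ x, x ∉ A ∪ Z → ∑ᶠ y, θ x y = 0
  source : ∑ᶠ a ∈ A, ∑ᶠ y ∈ Aᶜ, θ a y = 1
  sink : ∑ᶠ z ∈ Z, ∑ᶠ y ∈ Zᶜ, θ y z = 1

/-- The energy `∑ₑ r(e) θ(e)²` of a flow, in `[0, ∞]`. The double sum runs over directed edges, so
that every edge is counted twice, whence the factor `1/2`. -/
noncomputable def flowEnergy (r θ : V → V → ℝ) : ℝ≥0∞ :=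
  2⁻¹ * ∑' x, ∑' y, ENNReal.ofReal (r x y * θ x y ^ 2)

/-- The effective resistance between `A` and `Z` in the network `(G, r)`: the minimal energy of a
unit flow from `A` to `Z`. -/
noncomputable def effResistance (G : SimpleGraph V) (r : V → V → ℝ) (A Z : Set V) : ℝ≥0∞ :=
  ⨅ (θ : V → V → ℝ) (_ : IsUnitFlow G A Z θ), flowEnergy r θ

end Network

/-! ### Trees of words

Vertices are finite words, read from the root; the children of `x` are `x ++ [i]`, `0 ≤ i < ν x`. -/

/-- The tree in which the vertex `x` has `ν x` children. -/
def wordTree (ν : List ℕ → ℕ) : Set (List ℕ) :=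
  {x | ∀ (y : List ℕ) (i : ℕ), y ++ [i] <+: x → i < ν y}

/-- The graph structure of the tree: every vertex of the tree is joined to its children. -/
def wordTreeGraph (ν : List ℕ → ℕ) : SimpleGraph (List ℕ) where
  Adj x y := x ∈ wordTree ν ∧ y ∈ wordTree ν ∧ ((∃ i, y = x ++ [i]) ∨ (∃ i, x = y ++ [i]))
  symm := ⟨fun _ _ h => ⟨h.2.1, h.1, h.2.2.symm⟩⟩
  loopless := ⟨by
    rintro x ⟨-, -, ⟨i, h⟩ | ⟨i, h⟩⟩ <;> simp at h⟩

/-- The set of vertices at depth `n`. -/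
def treeLevel (ν : List ℕ → ℕ) (n : ℕ) : Set (List ℕ) :=
  {x | x ∈ wordTree ν ∧ x.length = n}

/-- The set of vertices at depth `n` that are descendants of `x`. -/
def treeLevelBelow (ν : List ℕ → ℕ) (x : List ℕ) (n : ℕ) : Set (List ℕ) :=
  {y | y ∈ treeLevel ν n ∧ x <+: y}

/-- The resistance `m ^ d(e) * ξ(e)` of the edge `e = {x, y}`, where `d(e)` is the depth of the
deeper endpoint and `ξ(e)` is the mark of that endpoint. -/
noncomputable def edgeResistance (m : ℝ) (ξ : List ℕ → ℝ) (x y : List ℕ) : ℝ :=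
  if x.length ≤ y.length then m ^ y.length * ξ y else m ^ x.length * ξ x

/-- The effective resistance `R_n` between the root and the vertices at depth `n`. -/
noncomputable def resistanceToLevel (m : ℝ) (ν : List ℕ → ℕ) (ξ : List ℕ → ℝ) (n : ℕ) : ℝ :=
  (effResistance (wordTreeGraph ν) (edgeResistance m ξ) {[]} (treeLevel ν n)).toReal

/-- The effective conductance `C_n` between the root and the vertices at depth `n`. -/
noncomputable def conductanceToLevel (m : ℝ) (ν : List ℕ → ℕ) (ξ : List ℕ → ℝ) (n : ℕ) : ℝ :=
  (resistanceToLevel m ν ξ n)⁻¹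

/-- The normalized number `m ^ (|x| - n) * #T_n[x]` of descendants of `x` at depth `n`. -/
noncomputable def normalizedCount (m : ℝ) (ν : List ℕ → ℕ) (x : List ℕ) (n : ℕ) : ℝ :=
  m ^ ((x.length : ℤ) - (n : ℤ)) * ((treeLevelBelow ν x n).ncard : ℝ)

/-- The limit `W^(x)` of the normalized number of descendants of `x`. -/
noncomputable def branchLimit (m : ℝ) (ν : List ℕ → ℕ) (x : List ℕ) : ℝ :=
  limUnder atTop (normalizedCount m ν x)

/-! ### Galton–Watson trees with random resistances -/

/-- A Galton–Watson tree with offspring law `p` (given through the offspring numbers `ν x` of all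
words `x`) whose edges carry i.i.d. marks of law `ρ` that are independent of the tree; `ξ x` is the
mark of the edge between `x` and its parent. -/
structure IsBranchingNetwork {Ω : Type*} [MeasurableSpace Ω] (P : Measure Ω) (p : PMF ℕ)
    (ρ : Measure ℝ) (ν : List ℕ → Ω → ℕ) (ξ : List ℕ → Ω → ℝ) : Prop where
  measurable_offspring : ∀ x, Measurable (ν x)
  measurable_mark : ∀ x, Measurable (ξ x)
  law_offspring : ∀ x, P.map (ν x) = p.toMeasure
  law_mark : ∀ x, P.map (ξ x) = ρ
  indep_offspring : iIndepFun ν P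
  indep_mark : iIndepFun ξ P
  indep : IndepFun (fun ω x => ν x ω) (fun ω x => ξ x ω) P

/-! ### The constants -/

section Constants

variable (p : PMF ℕ) (ρ : Measure ℝ)

/-- `m = E[ν]`. -/
noncomputable def meanOffspring : ℝ := ∫ k : ℕ, (k : ℝ) ∂p.toMeasure

/-- `a₁ = m⁻² E[ν (ν - 1)]`. -/
noncomputable def constA1 : ℝ :=
  (meanOffspring p ^ 2)⁻¹ * ∫ k : ℕ, (k : ℝ) * ((k : ℝ) - 1) ∂p.toMeasure

/-- `a₂ = m⁻³ E[ν (ν - 1) (ν - 2)]`. -/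
noncomputable def constA2 : ℝ :=
  (meanOffspring p ^ 3)⁻¹ * ∫ k : ℕ, (k : ℝ) * ((k : ℝ) - 1) * ((k : ℝ) - 2) ∂p.toMeasure

/-- `b₁ = E[ξ]`. -/
noncomputable def constB1 : ℝ := ∫ t, t ∂ρ

/-- `b₂ = E[ξ²]`. -/
noncomputable def constB2 : ℝ := ∫ t, t ^ 2 ∂ρ

/-- `c₁ = a₁ b₁ / (1 - m⁻¹)`. -/
noncomputable def constC1 : ℝ := constA1 p * constB1 ρ / (1 - (meanOffspring p)⁻¹)

/-- `c₂ = (1 - m⁻²)⁻¹ (3 a₁² / (m - 1) + a₂)`. -/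
noncomputable def constC2 : ℝ :=
  (1 - (meanOffspring p ^ 2)⁻¹)⁻¹ * (3 * constA1 p ^ 2 / (meanOffspring p - 1) + constA2 p)

/-- `c₃ = 2 a₁ c₁ / (m - 1) - 2 b₁ c₂ / m`. -/
noncomputable def constC3 : ℝ :=
  2 * constA1 p * constC1 p ρ / (meanOffspring p - 1)
    - 2 * constB1 ρ * constC2 p / meanOffspring p

/-- `c₄ = b₁ / (1 - m⁻¹) * (c₃ / c₁ + a₁) - b₂ c₂ / c₁`. -/
noncomputable def constC4 : ℝ :=
  constB1 ρ / (1 - (meanOffspring p)⁻¹) * (constC3 p ρ / constC1 p ρ + constA1 p)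
    - constB2 ρ * (constC2 p / constC1 p ρ)

end Constants

/-! The whole network is a function of an i.i.d. environment, and one operator carries the branching
structure: `branchAvg m G` is `m⁻¹` times the sum of `G` over the environments of the children.
Since an edge at depth `d` has resistance proportional to `m ^ d`, the series and parallel laws read
`C_{n+1} = branchAvg (C_n / (1 + ξ C_n))` in units adapted to the root, while `W = branchAvg W`.
That this recursion computes the effective conductance is Thomson's principle on the tree
(`effResistance_eq`): the flow that splits in proportion to the conductances attains equality in the
Cauchy–Schwarz inequality at every vertex.

Two facts about `branchAvg` drive the proof. It preserves means, and on centred functions it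
contracts the `L²` norm by exactly `m^{-1/2}` (`lpNorm_two_branchAvg`), because different children
are independent; in `L⁴` it contracts up to a multiple of the `L²` norm. Moreover `C_n` and `W`
depend only on what lies below the root, so they are independent of the mark `ξ` of the edge above
it.

Mean. Put `x_n = E[C_n]`. Testing with the flow proportional to the limits `W^(x)`, whose mean
energy is `c₁ n`, gives `x_n ≥ 1 / (c₁ n)`; a potential with a constant drop parameter on the stem
edge gives `x_{n+1} ≤ x_n - κ x_n²`, hence `x_n = O(1/n)`. The moments of orders 2 to 4 then have
order `x_n^j` (`isBigO_condMoment_aux`). Expanding `C / (1 + ξ C)` and solving the contracting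
moment recursions for the coefficients of powers of `x_n` yields `1/x_{n+1} - 1/x_n = c₁ + c₁ c₄ x_n
+ O(x_n²)` (`reciprocal_recursion`). Summation gives `1/x_n = c₁ n + c₄ log n + c₀ + O(log n / n)`
(`reciprocal_expansion`), where `c₀` appears as a limit.

Fluctuations. Let `Δ_n = C_n / x_n - W`. The recursion writes `Δ_{n+1}` as `branchAvg` of a centred
function equal to `Δ_n` up to a small error, so contraction gives `Δ_n → 0` in `L²` and `L⁴`. At the
next order, `F = W (1 - ξ W / c₁)` is centred because `E[ξ W²] = c₁`; its iterates under `branchAvg`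
decay geometrically and sum to `S`, which satisfies `S = branchAvg (S + F)`. The difference `n Δ_n -
S` obeys a contracting recursion with vanishing error (`tendsto_lpNorm_two_secondError`), so `n Δ_n
→ S` in `L²`.

Resistance. Finally `R_n = 1 / (x_n (W + n Δ_n / n))`; along almost surely convergent subsequences
this is an expansion of deterministic sequences (`tendsto_resistance_expansion`), with the same
`c₀`. -/

namespace GWNetwork

/-! ### The canonical space of environments -/

/-- An environment attaches to every word an offspring number and a mark. -/
abbrev Env := List ℕ → ℕ × ℝ

/-- The environment seen from the child `i` of the root. -/
def shift (i : ℕ) (e : Env) : Env := fun x => e (i :: x)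

/-- The offspring number of the root together with the environments of the children. -/
def offspringView (e : Env) : ℕ × (ℕ → Env) := ((e []).1, fun i => shift i e)

/-- The mark of the root. -/
def rootMark (e : Env) : ℝ := (e []).2

/-- The law of an environment with i.i.d. entries. -/
noncomputable def envLaw (p : PMF ℕ) (ρ : Measure ℝ) [IsProbabilityMeasure ρ] : Measure Env :=
  Measure.infinitePi fun _ => p.toMeasure.prod ρ

/-- The sum of `G` over the first `k` entries. -/
def partialSum (G : Env → ℝ) (a : ℕ × (ℕ → Env)) : ℝ := ∑ i ∈ Finset.range a.1, G (a.2 i)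

/-- `branchAvg m G e` is `m⁻¹` times the sum of `G` over the environments of the children. -/
noncomputable def branchAvg (m : ℝ) (G : Env → ℝ) (e : Env) : ℝ :=
  m⁻¹ * ∑ i ∈ Finset.range (e []).1, G (shift i e)

lemma branchAvg_eq (m : ℝ) (G : Env → ℝ) (e : Env) :
    branchAvg m G e = m⁻¹ * partialSum G (offspringView e) := rfl

@[fun_prop]
lemma measurable_shift (i : ℕ) : Measurable (shift i) := by
  unfold shift; fun_prop

@[fun_prop]
lemma measurable_offspringView : Measurable offspringView := by
  unfold offspringView shift; fun_prop

@[fun_prop]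
lemma measurable_rootMark : Measurable rootMark := by
  unfold rootMark; fun_prop

lemma measurable_partialSum {G : Env → ℝ} (hG : Measurable G) : Measurable (partialSum G) := by
  unfold partialSum
  refine measurable_from_prod_countable_right fun k => ?_
  dsimp only
  fun_prop

lemma measurable_branchAvg {m : ℝ} {G : Env → ℝ} (hG : Measurable G) :
    Measurable (branchAvg m G) := by
  have h : Measurable fun e => m⁻¹ * partialSum G (offspringView e) :=
    ((measurable_partialSum hG).comp measurable_offspringView).const_mul _
  exact h

/-! ### Joint law of the root and the environments of its children. -/

section Law

variable {p : PMF ℕ} {ρ : Measure ℝ} [IsProbabilityMeasure ρ]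

instance : IsProbabilityMeasure (envLaw p ρ) := by unfold envLaw; infer_instance

lemma map_root : (envLaw p ρ).map (fun e => e []) = p.toMeasure.prod ρ :=
  Measure.infinitePi_map_eval (fun _ : List ℕ => p.toMeasure.prod ρ) []

lemma map_rootMark : (envLaw p ρ).map rootMark = ρ := by
  have h : rootMark = Prod.snd ∘ fun e : Env => e [] := rfl
  rw [h, ← Measure.map_map measurable_snd (by fun_prop), map_root, ← Measure.snd,
    Measure.snd_prod]

/-- The map `(i, x) ↦ i :: x` is injective, so these coordinates of the product measure form a
product over `ℕ × List ℕ`, and currying turns it into a product of environment laws. -/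
lemma map_shifts : (envLaw p ρ).map (fun e i => shift i e)
    = Measure.infinitePi fun _ : ℕ => envLaw p ρ := by
  have h1 := Measure.map_infinitePi_infinitePi_of_inj (P := fun _ : List ℕ => p.toMeasure.prod ρ)
    (f := fun q : ℕ × List ℕ => q.1 :: q.2) (by
      rintro ⟨a, b⟩ ⟨c, d⟩ h
      simpa using h)
  have h2 := Measure.infinitePi_map_curry (fun (_ : ℕ) (_ : List ℕ) => p.toMeasure.prod ρ)
  rw [← h1, Measure.map_map (by fun_prop) (by fun_prop)] at h2
  exact h2

lemma map_shift (i : ℕ) : (envLaw p ρ).map (shift i) = envLaw p ρ := by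
  have h : shift i = (fun f : ℕ → Env => f i) ∘ fun e i => shift i e := rfl
  rw [h, ← Measure.map_map (by fun_prop) (by fun_prop), map_shifts]
  exact Measure.infinitePi_map_eval (fun _ : ℕ => envLaw p ρ) i

lemma measurePreserving_shift (i : ℕ) :
    MeasurePreserving (shift i) (envLaw p ρ) (envLaw p ρ) :=
  ⟨measurable_shift i, map_shift i⟩

lemma indepFun_root_shifts :
    IndepFun (fun e : Env => e []) (fun e i => shift i e) (envLaw p ρ) := by
  have hind : iIndepFun (fun (x : List ℕ) (e : Env) => e x) (envLaw p ρ) :=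
    iIndepFun_infinitePi (P := fun _ : List ℕ => p.toMeasure.prod ρ) (X := fun _ a => a)
      (fun _ => measurable_id)
  have h := indep_iSup_of_disjoint (S := {[]}) (T := {x | x ≠ []})
    (m := fun x : List ℕ => MeasurableSpace.comap (fun e : Env => e x) inferInstance)
    (fun x => (measurable_pi_apply x).comap_le) hind (by simp)
  refine indep_of_indep_of_le_left (indep_of_indep_of_le_right h ?_) ?_
  · refine measurable_iff_comap_le.1 (@measurable_pi_lambda _ _ _ (_) _ _ fun i =>
      @measurable_pi_lambda _ _ _ (_) _ _ fun x => measurable_iff_comap_le.2 ?_)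
    exact le_iSup₂_of_le (i :: x) (by simp) le_rfl
  · exact le_iSup₂_of_le [] (by simp) le_rfl

/-- The root mark is separated from everything else, including the offspring number of the root,
because the conductances above level `n` are functions of `offspringView` and must be independent of
the mark on the stem. -/
lemma map_mark_view : (envLaw p ρ).map (fun e => (rootMark e, offspringView e))
    = ρ.prod (p.toMeasure.prod (Measure.infinitePi fun _ : ℕ => envLaw p ρ)) := by
  have h := (indepFun_iff_map_prod_eq_prod_map_map
    (measurable_pi_apply _).aemeasurable (by fun_prop)).1
    (indepFun_root_shifts (p := p) (ρ := ρ))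
  rw [map_root, map_shifts] at h
  -- The entry at the root lists the offspring number first: swap the pair, then reassociate.
  have h1 : (p.toMeasure.prod ρ).map Prod.swap = ρ.prod p.toMeasure := Measure.prod_swap
  have h2 := (measurePreserving_prodAssoc ρ p.toMeasure
    (Measure.infinitePi fun _ : ℕ => envLaw p ρ)).map_eq
  rw [← h1] at h2
  have h3 := Measure.map_prod_map (p.toMeasure.prod ρ)
    (Measure.infinitePi fun _ : ℕ => envLaw p ρ) measurable_swap measurable_id
  rw [Measure.map_id] at h3
  rw [h3, ← h, Measure.map_map (by fun_prop) (by fun_prop),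
    Measure.map_map (by fun_prop) (by fun_prop)] at h2
  exact h2

lemma map_offspringView : (envLaw p ρ).map offspringView
    = p.toMeasure.prod (Measure.infinitePi fun _ : ℕ => envLaw p ρ) := by
  have h : offspringView = Prod.snd ∘ fun e => (rootMark e, offspringView e) := rfl
  rw [h, ← Measure.map_map measurable_snd (by fun_prop), map_mark_view, ← Measure.snd,
    Measure.snd_prod]

lemma indepFun_rootMark_offspringView :
    IndepFun rootMark offspringView (envLaw p ρ) := by
  rw [indepFun_iff_map_prod_eq_prod_map_map (by fun_prop) (by fun_prop), map_mark_view,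
    map_rootMark, map_offspringView]

end Law

/-! ### Moments of sums of independent copies -/

section IidSums

variable {S : Type*} [MeasurableSpace S] {σ : Measure S} [IsProbabilityMeasure σ]

lemma integrable_pow_of_memLp {f : S → ℝ} {n k : ℕ} (hf : MemLp f n σ) (hk : k ≤ n) :
    Integrable (fun s => f s ^ k) σ := by
  rcases Nat.eq_zero_or_pos k with rfl | hk0
  · simp
  · have h : MemLp f k σ := hf.mono_exponent (by exact_mod_cast hk)
    have h2 := h.integrable_norm_pow hk0.ne'
    refine (integrable_norm_iff (h.1.pow k)).1 ?_
    simpa [norm_pow] using h2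

lemma integrable_pow_mul_pow_of_indepFun {X Y : S → ℝ} (h : IndepFun X Y σ) {n a b : ℕ}
    (hX : MemLp X n σ) (hY : MemLp Y n σ) (ha : a ≤ n) (hb : b ≤ n) :
    Integrable (fun s => X s ^ a * Y s ^ b) σ :=
  (h.comp (measurable_id.pow_const a) (measurable_id.pow_const b)).integrable_mul
    (integrable_pow_of_memLp hX ha) (integrable_pow_of_memLp hY hb)

omit [IsProbabilityMeasure σ] in
lemma integral_pow_mul_pow_of_indepFun {X Y : S → ℝ} (h : IndepFun X Y σ) {n : ℕ}
    (hX : MemLp X n σ) (hY : MemLp Y n σ) (a b : ℕ) :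
    ∫ s, X s ^ a * Y s ^ b ∂σ = (∫ s, X s ^ a ∂σ) * ∫ s, Y s ^ b ∂σ :=
  h.integral_fun_comp_mul_comp (f := fun t => t ^ a) (g := fun t => t ^ b)
    hX.1.aemeasurable hY.1.aemeasurable
    (by fun_prop) (by fun_prop)

variable {G : S → ℝ}

lemma memLp_eval {q : ℝ≥0∞} (hL : MemLp G q σ) (i : ℕ) :
    MemLp (fun f : ℕ → S => G (f i)) q (Measure.infinitePi fun _ : ℕ => σ) :=
  hL.comp_measurePreserving (measurePreserving_eval_infinitePi (fun _ : ℕ => σ) i)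

lemma memLp_sum_eval {q : ℝ≥0∞} (hL : MemLp G q σ) (k : ℕ) :
    MemLp (fun f : ℕ → S => ∑ i ∈ Finset.range k, G (f i)) q
      (Measure.infinitePi fun _ : ℕ => σ) :=
  memLp_finsetSum _ fun i _ => memLp_eval hL i

lemma integral_eval (hG : Measurable G) (j i : ℕ) :
    ∫ f : ℕ → S, G (f i) ^ j ∂(Measure.infinitePi fun _ : ℕ => σ) = ∫ s, G s ^ j ∂σ := by
  have h := (measurePreserving_eval_infinitePi (fun _ : ℕ => σ) i).map_eq
  conv_rhs => rw [← h]
  rw [integral_map (measurable_pi_apply i).aemeasurable (by fun_prop)]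

lemma indepFun_sum_eval (hG : Measurable G) (k : ℕ) :
    IndepFun (fun f : ℕ → S => ∑ i ∈ Finset.range k, G (f i)) (fun f => G (f k))
      (Measure.infinitePi fun _ : ℕ => σ) := by
  have hind : iIndepFun (fun (i : ℕ) (f : ℕ → S) => G (f i))
      (Measure.infinitePi fun _ : ℕ => σ) :=
    iIndepFun_infinitePi (P := fun _ : ℕ => σ) (X := fun _ => G) (fun _ => hG)
  have := hind.indepFun_sum_range_succ (fun i => by fun_prop) k
  convert this using 1
  ext f; simp

lemma integral_sum_eval_pow_one (hG : Measurable G) (hL : MemLp G 1 σ) (k : ℕ) :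
    ∫ f : ℕ → S, (∑ i ∈ Finset.range k, G (f i)) ^ 1 ∂(Measure.infinitePi fun _ : ℕ => σ)
      = k * ∫ s, G s ^ 1 ∂σ := by
  simp only [pow_one]
  rw [integral_finsetSum _ fun i _ => memLp_one_iff_integrable.1 (memLp_eval hL i)]
  have := fun i => integral_eval (σ := σ) hG 1 i
  simp only [pow_one] at this
  simp [this]

/-- Binomial expansion in the last summand, which is independent of the others. The closed forms for
`j = 2, 3, 4` follow by induction on `k`; their coefficients count set partitions of the `j`
factors, weighted by falling factorials of `k`, which become the factorial moments of the offspring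
law. -/
lemma integral_sum_eval_pow_succ (hG : Measurable G) {j : ℕ} (hL : MemLp G j σ) (k : ℕ) :
    ∫ f : ℕ → S, (∑ i ∈ Finset.range (k + 1), G (f i)) ^ j ∂(Measure.infinitePi fun _ : ℕ => σ)
      = ∑ a ∈ Finset.range (j + 1),
        (∫ f : ℕ → S, (∑ i ∈ Finset.range k, G (f i)) ^ a ∂(Measure.infinitePi fun _ : ℕ => σ))
          * (∫ s, G s ^ (j - a) ∂σ) * (j.choose a) := by
  have hi := indepFun_sum_eval (σ := σ) hG k
  have hm := memLp_sum_eval hL k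
  have hm' := memLp_eval hL k
  simp only [Finset.sum_range_succ _ k, add_pow]
  rw [integral_finsetSum]
  · refine Finset.sum_congr rfl fun a _ => ?_
    rw [integral_mul_const, integral_pow_mul_pow_of_indepFun hi hm hm', integral_eval hG]
  · intro a ha
    exact (integrable_pow_mul_pow_of_indepFun hi hm hm' (by simp at ha; omega)
      (by omega)).mul_const _

lemma integral_sum_eval_pow_two (hG : Measurable G) (hL : MemLp G 2 σ) (k : ℕ) :
    ∫ f : ℕ → S, (∑ i ∈ Finset.range k, G (f i)) ^ 2 ∂(Measure.infinitePi fun _ : ℕ => σ)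
      = k * (∫ s, G s ^ 2 ∂σ) + k * (k - 1) * (∫ s, G s ∂σ) ^ 2 := by
  have h1 := integral_sum_eval_pow_one hG (hL.mono_exponent one_le_two)
  induction k with
  | zero => simp
  | succ k ih =>
    rw [integral_sum_eval_pow_succ hG (j := 2) (by exact_mod_cast hL)]
    simp only [Finset.sum_range_succ, Finset.sum_range_zero, h1, ih]
    norm_num [Nat.choose]
    ring

lemma integral_sum_eval_pow_three (hG : Measurable G) (hL : MemLp G 3 σ) (k : ℕ) :
    ∫ f : ℕ → S, (∑ i ∈ Finset.range k, G (f i)) ^ 3 ∂(Measure.infinitePi fun _ : ℕ => σ)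
      = k * (∫ s, G s ^ 3 ∂σ) + 3 * (k * (k - 1)) * ((∫ s, G s ^ 2 ∂σ) * (∫ s, G s ∂σ))
        + k * (k - 1) * (k - 2) * (∫ s, G s ∂σ) ^ 3 := by
  have h1 := integral_sum_eval_pow_one hG (hL.mono_exponent (by norm_num))
  have h2 := integral_sum_eval_pow_two hG (hL.mono_exponent (by norm_num))
  induction k with
  | zero => simp
  | succ k ih =>
    rw [integral_sum_eval_pow_succ hG (j := 3) (by exact_mod_cast hL)]
    simp only [Finset.sum_range_succ, Finset.sum_range_zero, h1, h2, ih]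
    norm_num [Nat.choose]
    ring

lemma integral_sum_eval_pow_four (hG : Measurable G) (hL : MemLp G 4 σ) (k : ℕ) :
    ∫ f : ℕ → S, (∑ i ∈ Finset.range k, G (f i)) ^ 4 ∂(Measure.infinitePi fun _ : ℕ => σ)
      = k * (∫ s, G s ^ 4 ∂σ) + 4 * (k * (k - 1)) * ((∫ s, G s ^ 3 ∂σ) * (∫ s, G s ∂σ))
        + 3 * (k * (k - 1)) * (∫ s, G s ^ 2 ∂σ) ^ 2
        + 6 * (k * (k - 1) * (k - 2)) * ((∫ s, G s ^ 2 ∂σ) * (∫ s, G s ∂σ) ^ 2)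
        + k * (k - 1) * (k - 2) * (k - 3) * (∫ s, G s ∂σ) ^ 4 := by
  have h1 := integral_sum_eval_pow_one hG (hL.mono_exponent (by norm_num))
  have h2 := integral_sum_eval_pow_two hG (hL.mono_exponent (by norm_num))
  have h3 := integral_sum_eval_pow_three hG (hL.mono_exponent (by norm_num))
  induction k with
  | zero => simp
  | succ k ih =>
    rw [integral_sum_eval_pow_succ hG (j := 4) (by exact_mod_cast hL)]
    simp only [Finset.sum_range_succ, Finset.sum_range_zero, h1, h2, h3, ih]
    norm_num [Nat.choose]
    ring

/-- Minkowski's inequality. The crude factor `k ^ j` is enough for integrability of random sums, as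
the offspring law has four moments. -/
lemma lintegral_sum_eval_pow_le (hG : Measurable G) (j : ℕ) (hj : j ≠ 0) (k : ℕ) :
    ∫⁻ f : ℕ → S, ‖∑ i ∈ Finset.range k, G (f i)‖ₑ ^ j ∂(Measure.infinitePi fun _ : ℕ => σ)
      ≤ (k : ℝ≥0∞) ^ j * eLpNorm G j σ ^ j := by
  have h1 : ∫⁻ f : ℕ → S, ‖∑ i ∈ Finset.range k, G (f i)‖ₑ ^ j
        ∂(Measure.infinitePi fun _ : ℕ => σ)
      = eLpNorm (fun f : ℕ → S => ∑ i ∈ Finset.range k, G (f i)) j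
        (Measure.infinitePi fun _ : ℕ => σ) ^ j := by
    have := eLpNorm_nnreal_pow_eq_lintegral (p := (j : NNReal))
      (f := fun f : ℕ → S => ∑ i ∈ Finset.range k, G (f i))
      (μ := Measure.infinitePi fun _ : ℕ => σ) (by exact_mod_cast hj)
    simpa using this.symm
  rw [h1, ← mul_pow]
  gcongr
  have h2 : (fun f : ℕ → S => ∑ i ∈ Finset.range k, G (f i))
      = ∑ i ∈ Finset.range k, fun f : ℕ → S => G (f i) := by ext; simp
  rw [h2]
  refine (eLpNorm_sum_le (fun i _ => (show Measurable fun f : ℕ → S => G (f i) from hG.comp (measurable_pi_apply i)).aestronglyMeasurable)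
    (by exact_mod_cast Nat.one_le_iff_ne_zero.2 hj)).trans ?_
  have h3 : ∀ i, eLpNorm (fun f : ℕ → S => G (f i)) j (Measure.infinitePi fun _ : ℕ => σ)
      = eLpNorm G j σ := fun i =>
    eLpNorm_comp_measurePreserving hG.aestronglyMeasurable
      (measurePreserving_eval_infinitePi (fun _ : ℕ => σ) i)
  simp [h3]

end IidSums

/-! ### Moments of `branchAvg` -/

/-- The integrability and positivity conditions on the offspring law and the law of the marks. -/
structure Admissible (p : PMF ℕ) (ρ : Measure ℝ) : Prop where
  offspring_zero : p 0 = 0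
  one_lt_mean : 1 < meanOffspring p
  mark_pos : ∀ᵐ t ∂ρ, 0 < t
  integrable_cube : Integrable (fun t : ℝ => t ^ 3) ρ
  integrable_inv : Integrable (fun t : ℝ => t⁻¹) ρ
  integrable_offspring : Integrable (fun k : ℕ => (k : ℝ) ^ 4) p.toMeasure

section LinearCombination

variable {S : Type*} [MeasurableSpace S] {σ : Measure S} {f₁ f₂ f₃ f₄ f₅ : S → ℝ}

lemma integral_lincomb_three (h₁ : Integrable f₁ σ) (h₂ : Integrable f₂ σ)
    (h₃ : Integrable f₃ σ) (a b c : ℝ) :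
    ∫ s, (f₁ s * a + f₂ s * b + f₃ s * c) ∂σ
      = (∫ s, f₁ s ∂σ) * a + (∫ s, f₂ s ∂σ) * b + (∫ s, f₃ s ∂σ) * c := by
  have h12 : Integrable (fun s => f₁ s * a + f₂ s * b) σ := (h₁.mul_const a).add (h₂.mul_const b)
  rw [integral_add h12 (h₃.mul_const c), integral_add (h₁.mul_const a) (h₂.mul_const b)]
  simp only [integral_mul_const]

lemma integral_lincomb_five (h₁ : Integrable f₁ σ) (h₂ : Integrable f₂ σ)
    (h₃ : Integrable f₃ σ) (h₄ : Integrable f₄ σ) (h₅ : Integrable f₅ σ) (a b c d e : ℝ) :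
    ∫ s, (f₁ s * a + f₂ s * b + f₃ s * c + f₄ s * d + f₅ s * e) ∂σ
      = (∫ s, f₁ s ∂σ) * a + (∫ s, f₂ s ∂σ) * b + (∫ s, f₃ s ∂σ) * c + (∫ s, f₄ s ∂σ) * d
        + (∫ s, f₅ s ∂σ) * e := by
  have h12 : Integrable (fun s => f₁ s * a + f₂ s * b) σ := (h₁.mul_const a).add (h₂.mul_const b)
  have h123 : Integrable (fun s => f₁ s * a + f₂ s * b + f₃ s * c) σ := h12.add (h₃.mul_const c)
  have h1234 : Integrable (fun s => f₁ s * a + f₂ s * b + f₃ s * c + f₄ s * d) σ :=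
    h123.add (h₄.mul_const d)
  rw [integral_add h1234 (h₅.mul_const e), integral_add h123 (h₄.mul_const d),
    integral_lincomb_three h₁ h₂ h₃]
  simp only [integral_mul_const]

end LinearCombination

variable {p : PMF ℕ} {ρ : Measure ℝ}

lemma Admissible.memLp_offspring (h : Admissible p ρ) :
    MemLp (fun k : ℕ => (k : ℝ)) 4 p.toMeasure := by
  have := (integrable_norm_rpow_iff (μ := p.toMeasure) (f := fun k : ℕ => (k : ℝ)) (p := 4)
    (by fun_prop) (by norm_num) (by norm_num)).1
  refine this ?_
  simpa using h.integrable_offspring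

lemma Admissible.integrable_offspring_pow (h : Admissible p ρ) {j : ℕ} (hj : j ≤ 4) :
    Integrable (fun k : ℕ => (k : ℝ) ^ j) p.toMeasure :=
  integrable_pow_of_memLp (by exact_mod_cast h.memLp_offspring) hj

/-- The normalized fourth factorial moment of the offspring law. -/
noncomputable def constA3 (p : PMF ℕ) : ℝ :=
  (meanOffspring p ^ 4)⁻¹ *
    ∫ k : ℕ, (k : ℝ) * ((k : ℝ) - 1) * ((k : ℝ) - 2) * ((k : ℝ) - 3) ∂p.toMeasure

lemma Admissible.integrable_factorial_two (h : Admissible p ρ) :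
    Integrable (fun k : ℕ => (k : ℝ) * ((k : ℝ) - 1)) p.toMeasure := by
  have h1 := h.integrable_offspring_pow (j := 1) (by norm_num)
  have h2 := h.integrable_offspring_pow (j := 2) (by norm_num)
  refine (h2.sub h1).congr (.of_forall fun k => ?_)
  simp only [Pi.sub_apply]; ring

lemma Admissible.integrable_factorial_three (h : Admissible p ρ) :
    Integrable (fun k : ℕ => (k : ℝ) * ((k : ℝ) - 1) * ((k : ℝ) - 2)) p.toMeasure := by
  have h1 := h.integrable_offspring_pow (j := 1) (by norm_num)
  have h2 := h.integrable_offspring_pow (j := 2) (by norm_num)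
  have h3 := h.integrable_offspring_pow (j := 3) (by norm_num)
  refine ((h3.sub (h2.const_mul 3)).add (h1.const_mul 2)).congr (.of_forall fun k => ?_)
  simp only [Pi.sub_apply, Pi.add_apply]; ring

lemma Admissible.integrable_factorial_four (h : Admissible p ρ) :
    Integrable (fun k : ℕ => (k : ℝ) * ((k : ℝ) - 1) * ((k : ℝ) - 2) * ((k : ℝ) - 3))
      p.toMeasure := by
  have h1 := h.integrable_offspring_pow (j := 1) (by norm_num)
  have h2 := h.integrable_offspring_pow (j := 2) (by norm_num)
  have h3 := h.integrable_offspring_pow (j := 3) (by norm_num)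
  have h4 := h.integrable_offspring_pow (j := 4) (by norm_num)
  refine (((h4.sub (h3.const_mul 6)).add (h2.const_mul 11)).sub (h1.const_mul 6)).congr
    (.of_forall fun k => ?_)
  simp only [Pi.sub_apply, Pi.add_apply]; ring

lemma Admissible.integral_offspring {m : ℝ} (hm : m = meanOffspring p) :
    ∫ k : ℕ, (k : ℝ) ∂p.toMeasure = m := hm.symm

lemma Admissible.integral_factorial_two (h : Admissible p ρ) {m : ℝ} (hm : m = meanOffspring p) :
    ∫ k : ℕ, (k : ℝ) * ((k : ℝ) - 1) ∂p.toMeasure = m ^ 2 * constA1 p := by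
  have h1 : m ≠ 0 := hm ▸ (zero_lt_one.trans h.one_lt_mean).ne'
  rw [constA1, ← hm]; field_simp

lemma Admissible.integral_factorial_three (h : Admissible p ρ) {m : ℝ} (hm : m = meanOffspring p) :
    ∫ k : ℕ, (k : ℝ) * ((k : ℝ) - 1) * ((k : ℝ) - 2) ∂p.toMeasure = m ^ 3 * constA2 p := by
  have h1 : m ≠ 0 := hm ▸ (zero_lt_one.trans h.one_lt_mean).ne'
  rw [constA2, ← hm]; field_simp

lemma Admissible.integral_factorial_four (h : Admissible p ρ) {m : ℝ} (hm : m = meanOffspring p) :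
    ∫ k : ℕ, (k : ℝ) * ((k : ℝ) - 1) * ((k : ℝ) - 2) * ((k : ℝ) - 3) ∂p.toMeasure
      = m ^ 4 * constA3 p := by
  have h1 : m ≠ 0 := hm ▸ (zero_lt_one.trans h.one_lt_mean).ne'
  rw [constA3, ← hm]; field_simp

variable [IsProbabilityMeasure ρ]

lemma lintegral_partialSum_pow_lt_top (h : Admissible p ρ) {G : Env → ℝ} (hG : Measurable G)
    {j : ℕ} (hj : j ≠ 0) (hj4 : j ≤ 4) (hL : MemLp G j (envLaw p ρ)) :
    ∫⁻ e, ‖partialSum G (offspringView e)‖ₑ ^ j ∂(envLaw p ρ) < ∞ := by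
  have hm : Measurable fun a => ‖partialSum G a‖ₑ ^ j := (measurable_partialSum hG).enorm.pow_const j
  rw [← lintegral_map (f := fun a => ‖partialSum G a‖ₑ ^ j) hm measurable_offspringView,
    map_offspringView, lintegral_prod _ hm.aemeasurable]
  refine (lintegral_mono fun k => lintegral_sum_eval_pow_le hG j hj k).trans_lt ?_
  rw [lintegral_mul_const _ (measurable_of_countable _)]
  refine ENNReal.mul_lt_top ?_ (ENNReal.pow_lt_top hL.2)
  have := (h.integrable_offspring_pow hj4).2
  simpa [HasFiniteIntegral, enorm_pow] using this

lemma memLp_branchAvg (h : Admissible p ρ) {m : ℝ} {G : Env → ℝ} (hG : Measurable G)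
    {j : ℕ} (hj : j ≠ 0) (hj4 : j ≤ 4) (hL : MemLp G j (envLaw p ρ)) :
    MemLp (branchAvg m G) j (envLaw p ρ) := by
  have hmeas : Measurable fun e => partialSum G (offspringView e) :=
    (measurable_partialSum hG).comp measurable_offspringView
  have : MemLp (fun e => partialSum G (offspringView e)) j (envLaw p ρ) := by
    refine ⟨hmeas.aestronglyMeasurable, ?_⟩
    have h1 := eLpNorm_nnreal_pow_eq_lintegral (p := (j : NNReal))
      (f := fun e => partialSum G (offspringView e)) (μ := envLaw p ρ) (by exact_mod_cast hj)
    have h2 := lintegral_partialSum_pow_lt_top h hG hj hj4 hL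
    have h3 : eLpNorm (fun e => partialSum G (offspringView e)) j (envLaw p ρ) ^ j < ∞ := by
      simp only [NNReal.coe_natCast, ENNReal.rpow_natCast, ENNReal.coe_natCast] at h1
      exact h1.trans_lt h2
    exact (ENNReal.pow_lt_top_iff.1 h3).resolve_right hj
  exact this.const_mul m⁻¹

/-- Fubini: condition on the number of children, then average over their independent environments.
-/
lemma integral_branchAvg_pow (h : Admissible p ρ) (m : ℝ) {G : Env → ℝ} (hG : Measurable G)
    {j : ℕ} (hj : j ≠ 0) (hj4 : j ≤ 4) (hL : MemLp G j (envLaw p ρ)) :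
    ∫ e, branchAvg m G e ^ j ∂(envLaw p ρ)
      = (m ^ j)⁻¹ * ∫ k : ℕ, (∫ f : ℕ → Env, (∑ i ∈ Finset.range k, G (f i)) ^ j
        ∂(Measure.infinitePi fun _ : ℕ => envLaw p ρ)) ∂p.toMeasure := by
  have hmeas : Measurable fun a => partialSum G a ^ j := (measurable_partialSum hG).pow_const j
  simp only [branchAvg_eq, mul_pow, inv_pow]
  rw [integral_const_mul]
  congr 1
  rw [← integral_map (f := fun a => partialSum G a ^ j) measurable_offspringView.aemeasurable
    hmeas.aestronglyMeasurable, map_offspringView, integral_prod]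
  · rfl
  · rw [← map_offspringView, integrable_map_measure hmeas.aestronglyMeasurable
      measurable_offspringView.aemeasurable]
    have h2 := lintegral_partialSum_pow_lt_top h hG hj hj4 hL
    refine ⟨(hmeas.comp measurable_offspringView).aestronglyMeasurable, ?_⟩
    simpa [HasFiniteIntegral, enorm_pow] using h2

section Moments

variable {m : ℝ} {G : Env → ℝ}

lemma integral_branchAvg (h : Admissible p ρ) (hm : m = meanOffspring p)
    (hG : Measurable G) (hL : MemLp G 1 (envLaw p ρ)) :
    ∫ e, branchAvg m G e ∂(envLaw p ρ) = ∫ e, G e ∂(envLaw p ρ) := by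
  have hm1 : 1 < m := hm ▸ h.one_lt_mean
  have h1 := integral_branchAvg_pow h m hG (j := 1) (by norm_num) (by norm_num) (by exact_mod_cast hL)
  simp only [integral_sum_eval_pow_one hG hL] at h1
  simp only [pow_one] at h1
  rw [h1, integral_mul_const, Admissible.integral_offspring hm]
  field_simp

/-- The diagonal terms carry the factor `m⁻¹`, and the off-diagonal ones see only the mean of `G`.
This is the source of every contraction below. -/
lemma integral_branchAvg_sq (h : Admissible p ρ) (hm : m = meanOffspring p)
    (hG : Measurable G) (hL : MemLp G 2 (envLaw p ρ)) :
    ∫ e, branchAvg m G e ^ 2 ∂(envLaw p ρ)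
      = m⁻¹ * ∫ e, G e ^ 2 ∂(envLaw p ρ) + constA1 p * (∫ e, G e ∂(envLaw p ρ)) ^ 2 := by
  have hm1 : 1 < m := hm ▸ h.one_lt_mean
  have i1 := h.integrable_offspring_pow (j := 1) (by norm_num)
  simp only [pow_one] at i1
  have i2 := h.integrable_factorial_two
  rw [integral_branchAvg_pow h m hG (j := 2) (by norm_num) (by norm_num) (by exact_mod_cast hL)]
  simp only [integral_sum_eval_pow_two hG hL]
  rw [integral_add (i1.mul_const _) (i2.mul_const _), integral_mul_const, integral_mul_const,
    Admissible.integral_offspring hm, h.integral_factorial_two hm]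
  field_simp

lemma integral_branchAvg_cube (h : Admissible p ρ) (hm : m = meanOffspring p)
    (hG : Measurable G) (hL : MemLp G 3 (envLaw p ρ)) :
    ∫ e, branchAvg m G e ^ 3 ∂(envLaw p ρ)
      = (m ^ 2)⁻¹ * ∫ e, G e ^ 3 ∂(envLaw p ρ)
        + 3 * (constA1 p / m) * ((∫ e, G e ^ 2 ∂(envLaw p ρ)) * ∫ e, G e ∂(envLaw p ρ))
        + constA2 p * (∫ e, G e ∂(envLaw p ρ)) ^ 3 := by
  have hm1 : 1 < m := hm ▸ h.one_lt_mean
  have i1 := h.integrable_offspring_pow (j := 1) (by norm_num)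
  simp only [pow_one] at i1
  have i2 := h.integrable_factorial_two
  have i3 := h.integrable_factorial_three
  rw [integral_branchAvg_pow h m hG (j := 3) (by norm_num) (by norm_num) (by exact_mod_cast hL)]
  simp only [integral_sum_eval_pow_three hG hL]
  rw [integral_lincomb_three i1 (i2.const_mul 3) i3, integral_const_mul,
    Admissible.integral_offspring hm, h.integral_factorial_two hm, h.integral_factorial_three hm]
  field_simp

lemma integral_branchAvg_pow_four (h : Admissible p ρ) (hm : m = meanOffspring p)
    (hG : Measurable G) (hL : MemLp G 4 (envLaw p ρ)) :
    ∫ e, branchAvg m G e ^ 4 ∂(envLaw p ρ)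
      = (m ^ 3)⁻¹ * ∫ e, G e ^ 4 ∂(envLaw p ρ)
        + 4 * (constA1 p / m ^ 2) * ((∫ e, G e ^ 3 ∂(envLaw p ρ)) * ∫ e, G e ∂(envLaw p ρ))
        + 3 * (constA1 p / m ^ 2) * (∫ e, G e ^ 2 ∂(envLaw p ρ)) ^ 2
        + 6 * (constA2 p / m) * ((∫ e, G e ^ 2 ∂(envLaw p ρ)) * (∫ e, G e ∂(envLaw p ρ)) ^ 2)
        + constA3 p * (∫ e, G e ∂(envLaw p ρ)) ^ 4 := by
  have hm1 : 1 < m := hm ▸ h.one_lt_mean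
  have i1 := h.integrable_offspring_pow (j := 1) (by norm_num)
  simp only [pow_one] at i1
  have i2 := h.integrable_factorial_two
  have i3 := h.integrable_factorial_three
  have i4 := h.integrable_factorial_four
  rw [integral_branchAvg_pow h m hG (j := 4) (by norm_num) (by norm_num) (by exact_mod_cast hL)]
  simp only [integral_sum_eval_pow_four hG hL]
  rw [integral_lincomb_five i1 (i2.const_mul 4) (i2.const_mul 3) (i3.const_mul 6) i4]
  simp only [integral_const_mul]
  rw [Admissible.integral_offspring hm, h.integral_factorial_two hm,
    h.integral_factorial_three hm, h.integral_factorial_four hm]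
  field_simp

/-- Independence of the root mark from quantities that only depend on the subtrees. -/
lemma indepFun_rootMark_branchAvg {G H : Env → ℝ} (hG : Measurable G) (hH : Measurable H) :
    IndepFun rootMark (fun e => (branchAvg m G e, branchAvg m H e)) (envLaw p ρ) :=
  indepFun_rootMark_offspringView.comp (φ := id)
    (ψ := fun a => (m⁻¹ * partialSum G a, m⁻¹ * partialSum H a)) measurable_id
    (((measurable_partialSum hG).const_mul _).prodMk ((measurable_partialSum hH).const_mul _))

end Moments

end GWNetwork

/-! ### Analytic tools: perturbed contractions and series in `L^q`. -/

namespace GWNetwork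

/-! ### Real sequences -/

/-- A sequence contracted up to a vanishing error tends to zero. -/
lemma tendsto_zero_of_contraction {u v c : ℕ → ℝ} {θ : ℝ} (hθ : θ < 1) (hu : ∀ n, 0 ≤ u n)
    (hc : Tendsto c atTop (𝓝 θ)) (hv : Tendsto v atTop (𝓝 0))
    (h : ∀ᶠ n in atTop, u (n + 1) ≤ c n * u n + v n) : Tendsto u atTop (𝓝 0) := by
  -- The maximum makes `q` positive whatever the sign of `θ`. The error level `(1 - q) * (ε / 2)`
  -- chosen below makes `ε / 2` the fixed point of the dominating affine recursion.
  obtain ⟨q, hq1, hq2⟩ := exists_between (max_lt hθ zero_lt_one)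
  have hqθ : θ < q := (le_max_left _ _).trans_lt hq1
  have hq0 : 0 < q := (le_max_right _ _).trans_lt hq1
  refine Metric.tendsto_atTop.2 fun ε hε => ?_
  have hev : ∀ᶠ n in atTop, u (n + 1) ≤ c n * u n + v n ∧ c n < q ∧ v n < (1 - q) * (ε / 2) :=
    h.and ((hc.eventually_lt_const hqθ).and
      (hv.eventually_lt_const (mul_pos (by linarith) (by linarith))))
  obtain ⟨N, hN⟩ := eventually_atTop.1 hev
  have hstep : ∀ k, u (N + k) ≤ ε / 2 + q ^ k * u N := by
    intro k
    induction k with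
    | zero => simp; linarith
    | succ k ih =>
      obtain ⟨h1, h2, h3⟩ := hN (N + k) (by omega)
      have h4 : c (N + k) * u (N + k) ≤ q * u (N + k) :=
        mul_le_mul_of_nonneg_right h2.le (hu _)
      have h5 := mul_le_mul_of_nonneg_left ih hq0.le
      rw [← add_assoc, pow_succ]
      nlinarith
  have hlim : Tendsto (fun k => q ^ k * u N) atTop (𝓝 0) := by
    simpa using (tendsto_pow_atTop_nhds_zero_of_lt_one hq0.le hq2).mul_const (u N)
  obtain ⟨M, hM⟩ := eventually_atTop.1 (hlim.eventually_lt_const (half_pos hε))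
  refine ⟨N + M, fun n hn => ?_⟩
  obtain ⟨k, rfl⟩ := Nat.exists_eq_add_of_le (le_of_add_le_left hn : N ≤ n)
  have h1 := hstep k
  have h2 := hM k (by omega)
  rw [Real.dist_eq, sub_zero, abs_of_nonneg (hu _)]
  linarith

/-- A sequence contracted up to an error of order `g`, with `g` slowly varying, is of
order `g`. -/
lemma isBigO_of_le_contraction {u v g : ℕ → ℝ} {θ : ℝ} (hθ0 : 0 ≤ θ) (hθ : θ < 1)
    (hg : ∀ᶠ n in atTop, 0 < g n) (hratio : Tendsto (fun n => g n / g (n + 1)) atTop (𝓝 1))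
    (hv : v =O[atTop] g) (h : ∀ᶠ n in atTop, |u (n + 1)| ≤ θ * |u n| + v n) : u =O[atTop] g := by
  obtain ⟨K, hK0, hK⟩ := hv.exists_pos
  obtain ⟨q, hq1, hq2⟩ := exists_between hθ
  have hr : ∀ᶠ n in atTop, θ * (g n / g (n + 1)) < q ∧ g n / g (n + 1) < 2 :=
    (((hratio.const_mul θ).eventually_lt_const (by simpa using hq1))).and
      (hratio.eventually_lt_const (by norm_num))
  have hev := ((hK.bound.and h).and hr).and (hg.and ((tendsto_add_atTop_nat 1).eventually hg))
  obtain ⟨N, hN⟩ := eventually_atTop.1 hev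
  have hgN := (hN N le_rfl).2.1
  -- The first entry starts the induction at `N`; the second is the condition `q * M + 2 * K ≤ M`
  -- that closes the induction step, the factor 2 bounding `g n / g (n + 1)`.
  set M := max (|u N| / g N) (2 * K / (1 - q)) with hM
  have hM1 : |u N| ≤ M * g N := (div_le_iff₀ hgN).1 (le_max_left _ _)
  have hM2 : 2 * K ≤ M * (1 - q) := (div_le_iff₀ (by linarith)).1 (le_max_right _ _)
  have hM0 : 0 ≤ M := le_max_of_le_left (by positivity)
  refine IsBigO.of_bound M ?_
  filter_upwards [eventually_ge_atTop N] with n hn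
  induction n, hn using Nat.le_induction with
  | base => simpa [abs_of_pos hgN] using hM1
  | succ n hn ih =>
    obtain ⟨⟨⟨h1, h0⟩, h2, h3⟩, h4, h5⟩ := hN n hn
    simp only [Real.norm_eq_abs, abs_of_pos h4, abs_of_pos h5] at *
    have h6 : |u (n + 1)| ≤ θ * |u n| + K * g n := by
      have := le_abs_self (v n)
      linarith
    have h7 : θ * g n ≤ q * g (n + 1) := by
      rw [← mul_div_assoc, div_lt_iff₀ h5] at h2; exact h2.le
    have h8 : g n ≤ 2 * g (n + 1) := by
      rw [div_lt_iff₀ h5] at h3; exact h3.le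
    have h9 : θ * |u n| ≤ θ * (M * g n) := mul_le_mul_of_nonneg_left ih hθ0
    nlinarith

lemma isBigO_of_contraction {u g : ℕ → ℝ} {θ : ℝ} (hθ0 : 0 ≤ θ) (hθ : θ < 1)
    (hg : ∀ᶠ n in atTop, 0 < g n) (hratio : Tendsto (fun n => g n / g (n + 1)) atTop (𝓝 1))
    (h : (fun n => u (n + 1) - θ * u n) =O[atTop] g) : u =O[atTop] g := by
  refine isBigO_of_le_contraction hθ0 hθ hg hratio h.abs_left (.of_forall fun n => ?_)
  have := abs_add_le (u (n + 1) - θ * u n) (θ * u n)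
  rw [abs_mul θ, abs_of_nonneg hθ0] at this
  simp only [sub_add_cancel] at this
  linarith

/-! ### `L^p` norms -/

section Norms

variable {S : Type*} [MeasurableSpace S] {σ : Measure S}

lemma lpNorm_two_sq {f : S → ℝ} (hf : MemLp f 2 σ) : lpNorm f 2 σ ^ 2 = ∫ s, f s ^ 2 ∂σ := by
  rw [lpNorm_eq_integral_norm_rpow_toReal (by norm_num) (by norm_num) hf.1, ← Real.rpow_natCast,
    ← Real.rpow_mul (by positivity)]
  simp

lemma lpNorm_four_pow {f : S → ℝ} (hf : MemLp f 4 σ) : lpNorm f 4 σ ^ 4 = ∫ s, f s ^ 4 ∂σ := by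
  rw [lpNorm_eq_integral_norm_rpow_toReal (by norm_num) (by norm_num) hf.1, ← Real.rpow_natCast,
    ← Real.rpow_mul (by positivity)]
  have h : ∀ x : ℝ, |x| ^ 4 = x ^ 4 := fun x => Even.pow_abs ⟨2, rfl⟩ x
  simp [h]

lemma lpNorm_congr {f g : S → ℝ} {q : ℝ≥0∞} (hf : AEStronglyMeasurable f σ) (h : f =ᵐ[σ] g) :
    lpNorm f q σ = lpNorm g q σ := by
  rw [← toReal_eLpNorm hf, ← toReal_eLpNorm (hf.congr h), eLpNorm_congr_ae h]

lemma lpNorm_mono_ae {f g : S → ℝ} {q : ℝ≥0∞} (hg : MemLp g q σ)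
    (h : ∀ᵐ s ∂σ, |f s| ≤ |g s|) : lpNorm f q σ ≤ lpNorm g q σ := by
  by_cases hf : AEStronglyMeasurable f σ
  · rw [← toReal_eLpNorm hf, ← toReal_eLpNorm hg.1]
    exact ENNReal.toReal_mono hg.eLpNorm_ne_top (eLpNorm_mono_ae h)
  · rw [lpNorm_of_not_aestronglyMeasurable hf]; exact lpNorm_nonneg

lemma lpNorm_const_mul (c : ℝ) (f : S → ℝ) (q : ℝ≥0∞) :
    lpNorm (fun s => c * f s) q σ = |c| * lpNorm f q σ := by
  have h := lpNorm_const_smul (p := q) c f σ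
  simp only [coe_nnnorm, Real.norm_eq_abs] at h
  exact h

/-- Dominated convergence for the `q`-th powers, followed by a `q`-th root; `q` is even, so the
powers need no absolute values. -/
lemma tendsto_lpNorm_zero_of_dominated {f : ℕ → S → ℝ} {g : S → ℝ} {q : ℕ} (hq : q = 2 ∨ q = 4)
    (hf : ∀ᶠ n in atTop, AEStronglyMeasurable (f n) σ) (hg : MemLp g q σ)
    (hfg : ∀ᶠ n in atTop, ∀ᵐ s ∂σ, |f n s| ≤ |g s|)
    (hlim : ∀ᵐ s ∂σ, Tendsto (fun n => f n s) atTop (𝓝 0)) :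
    Tendsto (fun n => lpNorm (f n) q σ) atTop (𝓝 0) := by
  have hq0 : q ≠ 0 := by rcases hq with rfl | rfl <;> norm_num
  have hqe : Even q := by rcases hq with rfl | rfl <;> decide
  have h1 : Tendsto (fun n => ∫ s, f n s ^ q ∂σ) atTop (𝓝 (∫ _, 0 ∂σ)) := by
    refine tendsto_integral_filter_of_dominated_convergence (fun s => |g s| ^ q) ?_ ?_ ?_ ?_
    · filter_upwards [hf] with n hn using hn.pow q
    · filter_upwards [hfg] with n hn
      filter_upwards [hn] with s hs
      rw [norm_pow]
      exact pow_le_pow_left₀ (norm_nonneg _) hs q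
    · simpa using hg.integrable_norm_pow hq0
    · filter_upwards [hlim] with s hs
      simpa [hq0] using hs.pow q
  have h2 : ∀ᶠ n in atTop, ∫ s, f n s ^ q ∂σ = lpNorm (f n) q σ ^ q := by
    filter_upwards [hf, hfg] with n hn hn2
    have hm : MemLp (f n) q σ := hg.mono hn hn2
    rcases hq with rfl | rfl
    · exact (lpNorm_two_sq (by exact_mod_cast hm)).symm
    · exact (lpNorm_four_pow (by exact_mod_cast hm)).symm
  have h3 := h1.congr' h2
  simp only [integral_zero] at h3
  have h4 : Tendsto (fun n => (lpNorm (f n) q σ ^ q) ^ ((q : ℝ)⁻¹)) atTop (𝓝 (0 ^ ((q : ℝ)⁻¹))) :=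
    h3.rpow_const (Or.inr (by positivity))
  rw [Real.zero_rpow (by positivity)] at h4
  refine h4.congr fun n => ?_
  rw [← Real.rpow_natCast, ← Real.rpow_mul lpNorm_nonneg, mul_inv_cancel₀ (by positivity),
    Real.rpow_one]

variable [IsProbabilityMeasure σ]

lemma integral_abs_le_lpNorm {f : S → ℝ} {q : ℝ≥0∞} (hq : 1 ≤ q) (hf : MemLp f q σ) :
    ∫ s, |f s| ∂σ ≤ lpNorm f q σ := by
  have h := lpNorm_one_eq_integral_norm hf.1
  simp only [Real.norm_eq_abs] at h
  rw [← h, ← toReal_eLpNorm hf.1, ← toReal_eLpNorm hf.1]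
  exact ENNReal.toReal_mono hf.eLpNorm_ne_top (eLpNorm_le_eLpNorm_of_exponent_le hq hf.1)

/-- On a probability space the `L^q` norms dominate the `L¹` norms, so by Tonelli the sum of the
absolute values has finite integral. -/
lemma ae_summable_of_summable_lpNorm {f : ℕ → S → ℝ} {q : ℝ≥0∞} (hq : 1 ≤ q)
    (hf : ∀ k, MemLp (f k) q σ) (hsum : Summable fun k => lpNorm (f k) q σ) :
    ∀ᵐ s ∂σ, Summable fun k => f k s := by
  have h1 : ∀ k, ∫⁻ s, ‖f k s‖ₑ ∂σ = ENNReal.ofReal (∫ s, ‖f k s‖ ∂σ) := fun k => by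
    rw [ofReal_integral_norm_eq_lintegral_enorm ((hf k).integrable hq)]
  have h2 : ∫⁻ s, ∑' k, ‖f k s‖ₑ ∂σ < ∞ := by
    rw [lintegral_tsum fun k => (hf k).1.enorm]
    simp only [h1]
    rw [← ENNReal.ofReal_tsum_of_nonneg (fun k => integral_nonneg fun s => norm_nonneg _)]
    · exact ENNReal.ofReal_lt_top
    · exact hsum.of_nonneg_of_le (fun k => integral_nonneg fun _ => norm_nonneg _)
        fun k => integral_abs_le_lpNorm hq (hf k)
  filter_upwards [ae_lt_top' (AEMeasurable.tsum fun k => (hf k).1.enorm) h2.ne] with s hs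
  have h3 : Summable fun k => ‖f k s‖₊ := ENNReal.tsum_coe_ne_top_iff_summable.1 hs.ne
  exact Summable.of_norm (NNReal.summable_coe.2 h3)

lemma eLpNorm_sum_sub_tsum_le {f : ℕ → S → ℝ} {q : ℝ≥0∞} (hq : 1 ≤ q)
    (hf : ∀ k, MemLp (f k) q σ) (hsum : Summable fun k => lpNorm (f k) q σ) (K : ℕ) :
    eLpNorm (fun s => (∑ k ∈ Finset.range K, f k s) - ∑' k, f k s) q σ
      ≤ ENNReal.ofReal (∑' k, lpNorm (f (k + K)) q σ) := by
  have hlim : ∀ᵐ s ∂σ, Tendsto (fun n => (∑ k ∈ Finset.range K, f k s)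
      - ∑ k ∈ Finset.range (n + K), f k s) atTop
      (𝓝 ((∑ k ∈ Finset.range K, f k s) - ∑' k, f k s)) := by
    filter_upwards [ae_summable_of_summable_lpNorm hq hf hsum] with s hs
    exact ((hs.hasSum.tendsto_sum_nat).comp (tendsto_add_atTop_nat K)).const_sub _
  have hm : ∀ A : Finset ℕ, MemLp (fun s => ∑ k ∈ A, f k s) q σ := fun A =>
    memLp_finsetSum _ fun k _ => hf k
  -- Lower semicontinuity of the norm (Fatou) reduces the tail to finite blocks, which Minkowski's
  -- inequality bounds by the tail of the series of norms.
  refine (Lp.eLpNorm_lim_le_liminf_eLpNorm (fun n => ((hm _).sub (hm _)).1) _ hlim).trans ?_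
  refine liminf_le_of_le ?_ fun b hb => ?_
  · isBoundedDefault
  · obtain ⟨n, hn⟩ := hb.exists
    refine hn.trans ?_
    have h1 : (fun s => (∑ k ∈ Finset.range K, f k s) - ∑ k ∈ Finset.range (n + K), f k s)
        = -∑ k ∈ Finset.range n, f (k + K) := by
      ext s
      rw [add_comm n K, Finset.sum_range_add]
      simp [add_comm]
    have h2 : eLpNorm (-∑ k ∈ Finset.range n, f (k + K)) q σ
        = eLpNorm (∑ k ∈ Finset.range n, f (k + K)) q σ := eLpNorm_neg _ _ _
    have h3 := eLpNorm_sum_le (s := Finset.range n) (f := fun k => f (k + K)) (μ := σ)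
      (fun i _ => (hf _).1) hq
    have h4 : ∀ k, eLpNorm (f k) q σ = ENNReal.ofReal (lpNorm (f k) q σ) :=
      fun k => (ofReal_lpNorm (hf k)).symm
    simp only [h4] at h3
    rw [← ENNReal.ofReal_sum_of_nonneg (fun _ _ => lpNorm_nonneg)] at h3
    calc _ = eLpNorm (∑ k ∈ Finset.range n, f (k + K)) q σ := by
            rw [← h2]; exact congrArg (fun F => eLpNorm F q σ) h1
      _ ≤ _ := h3
      _ ≤ _ := ENNReal.ofReal_le_ofReal
            (((summable_nat_add_iff K).2 hsum).sum_le_tsum _ fun _ _ => lpNorm_nonneg)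

lemma tendsto_eLpNorm_sum_sub_tsum {f : ℕ → S → ℝ} {q : ℝ≥0∞} (hq : 1 ≤ q)
    (hf : ∀ k, MemLp (f k) q σ) (hsum : Summable fun k => lpNorm (f k) q σ) :
    Tendsto (fun K : ℕ => eLpNorm (fun s => (∑ k ∈ Finset.range K, f k s) - ∑' k, f k s) q σ)
      atTop (𝓝 0) := by
  refine tendsto_of_tendsto_of_tendsto_of_le_of_le tendsto_const_nhds ?_ (fun _ => zero_le)
    (eLpNorm_sum_sub_tsum_le hq hf hsum)
  have := ENNReal.tendsto_ofReal (tendsto_sum_nat_add fun k => lpNorm (f k) q σ)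
  simpa using this

lemma memLp_tsum {f : ℕ → S → ℝ} {q : ℝ≥0∞} (hq : 1 ≤ q)
    (hf : ∀ k, MemLp (f k) q σ) (hsum : Summable fun k => lpNorm (f k) q σ) :
    MemLp (fun s => ∑' k, f k s) q σ := by
  have hm : AEStronglyMeasurable (fun s => ∑' k, f k s) σ := by
    refine aestronglyMeasurable_of_tendsto_ae atTop
      (f := fun n s => ∑ k ∈ Finset.range n, f k s)
      (fun n => (memLp_finsetSum _ fun k _ => hf k).1) ?_
    filter_upwards [ae_summable_of_summable_lpNorm hq hf hsum] with s hs
    exact hs.hasSum.tendsto_sum_nat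
  refine ⟨hm, ?_⟩
  have := eLpNorm_sum_sub_tsum_le hq hf hsum 0
  have h2 : (fun s => (∑ k ∈ Finset.range 0, f k s) - ∑' k, f k s)
      = -fun s => ∑' k, f k s := by ext; simp
  rw [h2, eLpNorm_neg] at this
  exact this.trans_lt ENNReal.ofReal_lt_top

lemma hasSum_integral_of_summable_lpNorm {f : ℕ → S → ℝ} {q : ℝ≥0∞} (hq : 1 ≤ q)
    (hf : ∀ k, MemLp (f k) q σ) (hsum : Summable fun k => lpNorm (f k) q σ) :
    HasSum (fun k => ∫ s, f k s ∂σ) (∫ s, ∑' k, f k s ∂σ) :=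
  hasSum_integral_of_summable_integral_norm (fun k => (hf k).integrable hq)
    (hsum.of_nonneg_of_le (fun _ => integral_nonneg fun _ => norm_nonneg _)
        fun k => integral_abs_le_lpNorm hq (hf k))

end Norms

end GWNetwork

/-! ### Contraction by `branchAvg` and the martingale limit `W`. -/

namespace GWNetwork

variable {p : PMF ℕ} {ρ : Measure ℝ} {m : ℝ}

/-- For natural `k`, `(k - 1) * (k - 2) ≥ 0`, that is `k * (k - 1) ≥ 2 * k - 2`; the right side has
positive mean since the mean offspring exceeds 1. -/
lemma Admissible.constA1_pos (h : Admissible p ρ) : 0 < constA1 p := by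
  have hm := h.one_lt_mean
  have i2 := h.integrable_factorial_two
  have i1 := h.integrable_offspring_pow (j := 1) (by norm_num)
  simp only [pow_one] at i1
  have hge : ∫ k : ℕ, (k : ℝ) * ((k : ℝ) - 1) ∂p.toMeasure
      ≥ ∫ k : ℕ, ((k : ℝ) * 2 - 2) ∂p.toMeasure := by
    refine integral_mono ((i1.mul_const 2).sub (integrable_const _)) i2 fun k => ?_
    rcases k with _ | _ | k
    · norm_num
    · norm_num
    · push_cast; nlinarith [Nat.cast_nonneg (α := ℝ) k]
  rw [integral_sub (i1.mul_const 2) (integrable_const _), integral_mul_const] at hge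
  simp only [integral_const, probReal_univ, smul_eq_mul, one_mul] at hge
  change _ ≥ meanOffspring p * 2 - 2 at hge
  unfold constA1
  have : 0 < ∫ k : ℕ, (k : ℝ) * ((k : ℝ) - 1) ∂p.toMeasure := by linarith
  positivity

variable [IsProbabilityMeasure ρ]

/-! ### Contraction of centred functions under `branchAvg` -/

/-- The factor by which `branchAvg` contracts the `L²` norm of a centred function. -/
noncomputable def ratioTwo (m : ℝ) : ℝ := √(m⁻¹)

lemma ratioTwo_nonneg : 0 ≤ ratioTwo m := Real.sqrt_nonneg _

lemma ratioTwo_lt_one (hm : 1 < m) : ratioTwo m < 1 := by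
  rw [ratioTwo, Real.sqrt_lt' one_pos]
  simpa using inv_lt_one_of_one_lt₀ hm

/-- For centred `G` the contributions of distinct children are orthogonal, so only the term `m⁻¹ *
E[G ^ 2]` of the second moment remains. -/
lemma lpNorm_two_branchAvg (h : Admissible p ρ) (hm : m = meanOffspring p) {G : Env → ℝ}
    (hG : Measurable G) (hL : MemLp G 2 (envLaw p ρ)) (h0 : ∫ e, G e ∂(envLaw p ρ) = 0) :
    lpNorm (branchAvg m G) 2 (envLaw p ρ) = ratioTwo m * lpNorm G 2 (envLaw p ρ) := by
  have hm1 : 1 < m := hm ▸ h.one_lt_mean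
  have hT : MemLp (branchAvg m G) 2 (envLaw p ρ) :=
    memLp_branchAvg h hG (j := 2) (by norm_num) (by norm_num) hL
  rw [← sq_eq_sq₀ lpNorm_nonneg (mul_nonneg ratioTwo_nonneg lpNorm_nonneg), mul_pow,
    lpNorm_two_sq hT, lpNorm_two_sq hL, integral_branchAvg_sq h hm hG hL, h0, ratioTwo,
    Real.sq_sqrt (by positivity)]
  ring

/-- With zero mean the fourth moment keeps two terms, `m⁻³ * E[G ^ 4]` and a multiple of `E[G ^ 2] ^
2`. The `L⁴` norm therefore contracts once the `L²` norm is under control. -/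
lemma exists_lpNorm_four_branchAvg_le (h : Admissible p ρ) (hm : m = meanOffspring p) :
    ∃ θ K : ℝ, 0 ≤ θ ∧ θ < 1 ∧ 0 ≤ K ∧ ∀ G : Env → ℝ, Measurable G → MemLp G 4 (envLaw p ρ) →
      ∫ e, G e ∂(envLaw p ρ) = 0 → lpNorm (branchAvg m G) 4 (envLaw p ρ)
        ≤ θ * lpNorm G 4 (envLaw p ρ) + K * lpNorm G 2 (envLaw p ρ) := by
  have hm1 : 1 < m := hm ▸ h.one_lt_mean
  have ha := h.constA1_pos
  have hr : ∀ x : ℝ, 0 ≤ x → √(√x) ^ 4 = x := fun x hx => by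
    rw [show 4 = 2 * 2 from rfl, pow_mul, Real.sq_sqrt (Real.sqrt_nonneg _), Real.sq_sqrt hx]
  -- Fourth roots of the two surviving coefficients; the sum of fourth powers is then bounded
  -- through `a ^ 4 + b ^ 4 ≤ (a + b) ^ 4`.
  refine ⟨√(√((m ^ 3)⁻¹)), √(√(3 * (constA1 p / m ^ 2))), by positivity, ?_, by positivity, ?_⟩
  · rw [Real.sqrt_lt' one_pos, Real.sqrt_lt' (by norm_num)]
    simpa using inv_lt_one_of_one_lt₀ (one_lt_pow₀ hm1 (by norm_num))
  intro G hG hL h0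
  have hL2 : MemLp G 2 (envLaw p ρ) := hL.mono_exponent (by norm_num)
  have hT : MemLp (branchAvg m G) 4 (envLaw p ρ) :=
    memLp_branchAvg h hG (j := 4) (by norm_num) (by norm_num) hL
  have key : lpNorm (branchAvg m G) 4 (envLaw p ρ) ^ 4
      = (√(√((m ^ 3)⁻¹)) * lpNorm G 4 (envLaw p ρ)) ^ 4
        + (√(√(3 * (constA1 p / m ^ 2))) * lpNorm G 2 (envLaw p ρ)) ^ 4 := by
    rw [mul_pow, mul_pow, hr _ (by positivity), hr _ (by positivity), lpNorm_four_pow hT,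
      lpNorm_four_pow hL, integral_branchAvg_pow_four h hm hG hL, h0,
      show lpNorm G 2 (envLaw p ρ) ^ 4 = (lpNorm G 2 (envLaw p ρ) ^ 2) ^ 2 by ring,
      lpNorm_two_sq hL2]
    ring
  have h1 : 0 ≤ √(√((m ^ 3)⁻¹)) * lpNorm G 4 (envLaw p ρ) :=
    mul_nonneg (Real.sqrt_nonneg _) lpNorm_nonneg
  have h2 : 0 ≤ √(√(3 * (constA1 p / m ^ 2))) * lpNorm G 2 (envLaw p ρ) :=
    mul_nonneg (Real.sqrt_nonneg _) lpNorm_nonneg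
  refine (pow_le_pow_iff_left₀ lpNorm_nonneg (add_nonneg h1 h2) (by norm_num : 4 ≠ 0)).1 ?_
  rw [key]
  exact pow_add_pow_le h1 h2 (by norm_num)

/-! ### Iterating `branchAvg` on a centred function -/

lemma measurable_branchAvg_iterate {G : Env → ℝ} (hG : Measurable G) (n : ℕ) :
    Measurable ((branchAvg m)^[n] G) := by
  induction n with
  | zero => exact hG
  | succ n ih => rw [Function.iterate_succ_apply']; exact measurable_branchAvg ih

lemma memLp_branchAvg_iterate (h : Admissible p ρ) {G : Env → ℝ} (hG : Measurable G)
    {j : ℕ} (hj : j ≠ 0) (hj4 : j ≤ 4) (hL : MemLp G j (envLaw p ρ)) (n : ℕ) :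
    MemLp ((branchAvg m)^[n] G) j (envLaw p ρ) := by
  induction n with
  | zero => exact hL
  | succ n ih =>
    rw [Function.iterate_succ_apply']
    exact memLp_branchAvg h (measurable_branchAvg_iterate hG n) hj hj4 ih

lemma integral_branchAvg_iterate (h : Admissible p ρ) (hm : m = meanOffspring p) {G : Env → ℝ}
    (hG : Measurable G) (hL : MemLp G 1 (envLaw p ρ)) (n : ℕ) :
    ∫ e, (branchAvg m)^[n] G e ∂(envLaw p ρ) = ∫ e, G e ∂(envLaw p ρ) := by
  induction n with
  | zero => rfl
  | succ n ih =>
    rw [Function.iterate_succ_apply', integral_branchAvg h hm (measurable_branchAvg_iterate hG n), ih]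
    exact_mod_cast memLp_branchAvg_iterate h hG (j := 1) (by norm_num) (by norm_num)
      (by exact_mod_cast hL) n

lemma lpNorm_two_branchAvg_iterate (h : Admissible p ρ) (hm : m = meanOffspring p) {G : Env → ℝ}
    (hG : Measurable G) (hL : MemLp G 2 (envLaw p ρ)) (h0 : ∫ e, G e ∂(envLaw p ρ) = 0) (n : ℕ) :
    lpNorm ((branchAvg m)^[n] G) 2 (envLaw p ρ) = ratioTwo m ^ n * lpNorm G 2 (envLaw p ρ) := by
  induction n with
  | zero => simp
  | succ n ih =>
    rw [Function.iterate_succ_apply', lpNorm_two_branchAvg h hm (measurable_branchAvg_iterate hG n)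
      (memLp_branchAvg_iterate h hG (j := 2) (by norm_num) (by norm_num) hL n), ih]
    · ring
    · rw [integral_branchAvg_iterate h hm hG (hL.mono_exponent one_le_two), h0]

lemma summable_lpNorm_branchAvg_iterate (h : Admissible p ρ) (hm : m = meanOffspring p)
    {G : Env → ℝ} (hG : Measurable G) (hL : MemLp G 2 (envLaw p ρ))
    (h0 : ∫ e, G e ∂(envLaw p ρ) = 0) :
    Summable fun n => lpNorm ((branchAvg m)^[n] G) 2 (envLaw p ρ) := by
  simp only [lpNorm_two_branchAvg_iterate h hm hG hL h0]
  exact (summable_geometric_of_lt_one ratioTwo_nonneg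
    (ratioTwo_lt_one (hm ▸ h.one_lt_mean))).mul_right _

lemma branchAvg_sub (G H : Env → ℝ) : branchAvg m (G - H) = branchAvg m G - branchAvg m H := by
  ext e; simp [branchAvg, Finset.sum_sub_distrib, mul_sub]

/-! ### The normalized generation sizes and their limit -/

/-- The normalized number `m⁻ⁿ #T_n` of vertices at depth `n`. -/
noncomputable def genSize (m : ℝ) (n : ℕ) : Env → ℝ := (branchAvg m)^[n] fun _ => 1

/-- The limit of the normalized number of vertices at depth `n`. -/
noncomputable def growthLimit (m : ℝ) (e : Env) : ℝ := limUnder atTop fun n => genSize m n e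

lemma genSize_succ (n : ℕ) : genSize m (n + 1) = branchAvg m (genSize m n) :=
  Function.iterate_succ_apply' _ _ _

lemma measurable_genSize (n : ℕ) : Measurable (genSize m n) :=
  measurable_branchAvg_iterate measurable_const n

lemma measurable_growthLimit : Measurable (growthLimit m) :=
  (StronglyMeasurable.limUnder fun n => (measurable_genSize n).stronglyMeasurable).measurable

lemma genSize_nonneg (hm : 0 ≤ m) (n : ℕ) (e : Env) : 0 ≤ genSize m n e := by
  induction n generalizing e with
  | zero => simp [genSize]
  | succ n ih =>
    rw [genSize_succ]
    exact mul_nonneg (by positivity) (Finset.sum_nonneg fun i _ => ih _)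

lemma memLp_genSize (h : Admissible p ρ) {j : ℕ} (hj : j ≠ 0) (hj4 : j ≤ 4) (n : ℕ) :
    MemLp (genSize m n) j (envLaw p ρ) :=
  memLp_branchAvg_iterate h measurable_const hj hj4 (memLp_const 1) n

lemma integral_genSize (h : Admissible p ρ) (hm : m = meanOffspring p) (n : ℕ) :
    ∫ e, genSize m n e ∂(envLaw p ρ) = 1 := by
  rw [genSize, integral_branchAvg_iterate h hm measurable_const (memLp_const 1)]
  simp

/-- By linearity the martingale increments are iterates of `branchAvg` on the centred first
increment, so their `L²` norms decay geometrically. -/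
lemma genSize_succ_sub (n : ℕ) :
    genSize m (n + 1) - genSize m n = (branchAvg m)^[n] (genSize m 1 - fun _ => 1) := by
  induction n with
  | zero => rfl
  | succ n ih =>
    rw [Function.iterate_succ_apply', ← ih, branchAvg_sub, ← genSize_succ, ← genSize_succ]

/-- The centred first normalized generation size. -/
noncomputable def genIncrement (m : ℝ) : Env → ℝ := genSize m 1 - fun _ => 1

lemma measurable_genIncrement : Measurable (genIncrement m) :=
  (measurable_genSize 1).sub measurable_const

lemma memLp_genIncrement (h : Admissible p ρ) {j : ℕ} (hj : j ≠ 0) (hj4 : j ≤ 4) :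
    MemLp (genIncrement m) j (envLaw p ρ) :=
  (memLp_genSize h hj hj4 1).sub (memLp_const 1)

lemma integral_genIncrement (h : Admissible p ρ) (hm : m = meanOffspring p) :
    ∫ e, genIncrement m e ∂(envLaw p ρ) = 0 := by
  have h1 : Integrable (genSize m 1) (envLaw p ρ) :=
    (memLp_genSize h (j := 2) (by norm_num) (by norm_num) 1).integrable (by norm_num)
  have h2 := integral_genSize h hm 1
  simp only [genIncrement, Pi.sub_apply]
  rw [integral_sub h1 (integrable_const _), h2]
  simp

lemma genSize_eq_sum (n : ℕ) (e : Env) :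
    genSize m n e = 1 + ∑ k ∈ Finset.range n, (branchAvg m)^[k] (genIncrement m) e := by
  simp only [genIncrement, ← genSize_succ_sub, Pi.sub_apply]
  rw [Finset.sum_range_sub (fun k => genSize m k e)]
  simp [genSize]

lemma ae_tendsto_genSize_aux (h : Admissible p ρ) (hm : m = meanOffspring p) :
    ∀ᵐ e ∂(envLaw p ρ), Tendsto (fun n => genSize m n e) atTop
      (𝓝 (1 + ∑' k, (branchAvg m)^[k] (genIncrement m) e)) := by
  have hL : MemLp (genIncrement m) 2 (envLaw p ρ) :=
    memLp_genIncrement h (j := 2) (by norm_num) (by norm_num)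
  filter_upwards [ae_summable_of_summable_lpNorm one_le_two
    (fun k => memLp_branchAvg_iterate h measurable_genIncrement (j := 2) (by norm_num)
      (by norm_num) hL k)
    (summable_lpNorm_branchAvg_iterate h hm measurable_genIncrement hL
      (integral_genIncrement h hm))] with e he
  simp only [genSize_eq_sum]
  exact he.hasSum.tendsto_sum_nat.const_add 1

lemma ae_tendsto_genSize (h : Admissible p ρ) (hm : m = meanOffspring p) :
    ∀ᵐ e ∂(envLaw p ρ), Tendsto (fun n => genSize m n e) atTop (𝓝 (growthLimit m e)) := by
  filter_upwards [ae_tendsto_genSize_aux h hm] with e he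
  exact tendsto_nhds_limUnder ⟨_, he⟩

lemma growthLimit_ae_eq (h : Admissible p ρ) (hm : m = meanOffspring p) :
    growthLimit m =ᵐ[envLaw p ρ] fun e => 1 + ∑' k, (branchAvg m)^[k] (genIncrement m) e := by
  filter_upwards [ae_tendsto_genSize_aux h hm] with e he using he.limUnder_eq

lemma integral_growthLimit (h : Admissible p ρ) (hm : m = meanOffspring p) :
    ∫ e, growthLimit m e ∂(envLaw p ρ) = 1 := by
  have hL : MemLp (genIncrement m) 2 (envLaw p ρ) :=
    memLp_genIncrement h (j := 2) (by norm_num) (by norm_num)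
  have hk := fun k => memLp_branchAvg_iterate (m := m) h measurable_genIncrement (j := 2)
    (by norm_num) (by norm_num) hL k
  have hs := summable_lpNorm_branchAvg_iterate h hm measurable_genIncrement hL
      (integral_genIncrement h hm)
  rw [integral_congr_ae (growthLimit_ae_eq h hm), integral_add (integrable_const _)
    ((memLp_tsum one_le_two hk hs).integrable one_le_two)]
  have h1 := hasSum_integral_of_summable_lpNorm one_le_two hk hs
  simp only [integral_branchAvg_iterate h hm measurable_genIncrement (hL.mono_exponent one_le_two),
    integral_genIncrement h hm] at h1
  rw [h1.unique hasSum_zero]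
  simp

/-- The sum over children is finite, so the limit passes through the recursion for the generation
sizes. -/
lemma growthLimit_fixed (h : Admissible p ρ) (hm : m = meanOffspring p) :
    branchAvg m (growthLimit m) =ᵐ[envLaw p ρ] growthLimit m := by
  have h1 : ∀ᵐ e ∂(envLaw p ρ), ∀ i, Tendsto (fun n => genSize m n (shift i e)) atTop
      (𝓝 (growthLimit m (shift i e))) :=
    ae_all_iff.2 fun i => (measurePreserving_shift i).quasiMeasurePreserving.ae
      (ae_tendsto_genSize h hm)
  filter_upwards [h1, ae_tendsto_genSize h hm] with e he he2
  refine tendsto_nhds_unique ?_ (he2.comp (tendsto_add_atTop_nat 1))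
  have : ∀ n, genSize m (n + 1) e = branchAvg m (genSize m n) e := fun n => by rw [genSize_succ]
  simp only [Function.comp_def, this]
  exact (tendsto_finsetSum _ fun i _ => he i).const_mul _

lemma growthLimit_nonneg (h : Admissible p ρ) (hm : m = meanOffspring p) :
    ∀ᵐ e ∂(envLaw p ρ), 0 ≤ growthLimit m e := by
  have hm0 : 0 ≤ m := hm ▸ (zero_lt_one.trans h.one_lt_mean).le
  filter_upwards [ae_tendsto_genSize h hm] with e he
  exact ge_of_tendsto' he fun n => genSize_nonneg hm0 n e

/-- The centred sizes satisfy `U (n + 1) = branchAvg m (U n) + genIncrement m`. Contraction bounds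
them first in `L²` and then, with that bound as an error term, in `L⁴`; by Fatou this puts
`growthLimit` in `L⁴`. -/
lemma isBigO_lpNorm_four_genSize (h : Admissible p ρ) (hm : m = meanOffspring p) :
    (fun n => lpNorm (genSize m n - fun _ => 1) 4 (envLaw p ρ)) =O[atTop] fun _ => (1 : ℝ) := by
  have hm1 : 1 < m := hm ▸ h.one_lt_mean
  set U : ℕ → Env → ℝ := fun n => genSize m n - fun _ => 1 with hU
  have hUm : ∀ n, Measurable (U n) := fun n => (measurable_genSize n).sub measurable_const
  have hU4 : ∀ n, MemLp (U n) 4 (envLaw p ρ) := fun n =>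
    (memLp_genSize h (j := 4) (by norm_num) (by norm_num) n).sub (memLp_const 1)
  have hU2 : ∀ n, MemLp (U n) 2 (envLaw p ρ) := fun n => (hU4 n).mono_exponent (by norm_num)
  have hU0 : ∀ n, ∫ e, U n e ∂(envLaw p ρ) = 0 := fun n => by
    have h1 : Integrable (genSize m n) (envLaw p ρ) :=
      (memLp_genSize h (j := 2) (by norm_num) (by norm_num) n).integrable (by norm_num)
    have h2 := integral_genSize h hm n
    simp only [hU, Pi.sub_apply]
    rw [integral_sub h1 (integrable_const _), h2]
    simp
  have hrec : ∀ n, U (n + 1) = branchAvg m (U n) + genIncrement m := fun n => by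
    simp only [hU, genIncrement, branchAvg_sub, ← genSize_succ]
    have : branchAvg m (fun _ => 1) = genSize m 1 := rfl
    rw [this]; abel
  have hI4 : MemLp (genIncrement m) 4 (envLaw p ρ) :=
    memLp_genIncrement h (j := 4) (by norm_num) (by norm_num)
  have hratio : Tendsto (fun _ : ℕ => (1 : ℝ) / 1) atTop (𝓝 1) := by simp
  have hT4 : ∀ n, MemLp (branchAvg m (U n)) 4 (envLaw p ρ) := fun n =>
    memLp_branchAvg h (hUm n) (j := 4) (by norm_num) (by norm_num) (hU4 n)
  -- `L²` bound
  have b2 : ∀ n, lpNorm (U n) 2 (envLaw p ρ)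
      ≤ lpNorm (genIncrement m) 2 (envLaw p ρ) / (1 - ratioTwo m) := by
    have hr1 := ratioTwo_lt_one hm1
    intro n
    induction n with
    | zero =>
      have : U 0 = 0 := by ext; simp [hU, genSize]
      rw [this, lpNorm_zero]
      exact div_nonneg lpNorm_nonneg (by linarith)
    | succ n ih =>
      rw [hrec]
      refine (lpNorm_add_le ((hT4 n).mono_exponent (by norm_num)) one_le_two).trans ?_
      rw [lpNorm_two_branchAvg h hm (hUm n) (hU2 n) (hU0 n)]
      have := mul_le_mul_of_nonneg_left ih (ratioTwo_nonneg (m := m))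
      calc _ ≤ ratioTwo m * (lpNorm (genIncrement m) 2 (envLaw p ρ) / (1 - ratioTwo m))
            + lpNorm (genIncrement m) 2 (envLaw p ρ) := by linarith
        _ = _ := by field_simp [(by linarith : 1 - ratioTwo m ≠ 0)]; ring
  obtain ⟨θ, K, hθ0, hθ1, hK0, hθK⟩ := exists_lpNorm_four_branchAvg_le h hm
  set B := K * (lpNorm (genIncrement m) 2 (envLaw p ρ) / (1 - ratioTwo m))
    + lpNorm (genIncrement m) 4 (envLaw p ρ) with hB
  have hstep : ∀ n, lpNorm (U (n + 1)) 4 (envLaw p ρ) ≤ θ * lpNorm (U n) 4 (envLaw p ρ) + B := by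
    intro n
    rw [hrec]
    refine (lpNorm_add_le (hT4 n) (by norm_num)).trans ?_
    have h1 := hθK (U n) (hUm n) (hU4 n) (hU0 n)
    have h2 := mul_le_mul_of_nonneg_left (b2 n) hK0
    linarith
  -- The bound is the fixed point of `x ↦ θ * x + B`, and the sequence starts at `U 0 = 0`.
  have b4 : ∀ n, lpNorm (U n) 4 (envLaw p ρ) ≤ B / (1 - θ) := by
    have hB0 : 0 ≤ B := by
      have := hstep 0
      have h0 : U 0 = 0 := by ext; simp [hU, genSize]
      simp only [h0, lpNorm_zero, mul_zero, zero_add] at this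
      exact lpNorm_nonneg.trans this
    intro n
    induction n with
    | zero =>
      have : U 0 = 0 := by ext; simp [hU, genSize]
      rw [this, lpNorm_zero]
      exact div_nonneg hB0 (by linarith)
    | succ n ih =>
      refine (hstep n).trans ?_
      have := mul_le_mul_of_nonneg_left ih hθ0
      calc _ ≤ θ * (B / (1 - θ)) + B := by linarith
        _ = _ := by field_simp [(by linarith : 1 - θ ≠ 0)]; ring
  refine IsBigO.of_bound (B / (1 - θ)) (.of_forall fun n => ?_)
  simpa [abs_of_nonneg lpNorm_nonneg] using b4 n

lemma memLp_growthLimit (h : Admissible p ρ) (hm : m = meanOffspring p) :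
    MemLp (growthLimit m) 4 (envLaw p ρ) := by
  obtain ⟨B, hB⟩ := (isBigO_lpNorm_four_genSize h hm).bound
  have hmem : ∀ n, MemLp (genSize m n - fun _ => 1) 4 (envLaw p ρ) := fun n =>
    (memLp_genSize h (j := 4) (by norm_num) (by norm_num) n).sub (memLp_const 1)
  have key : MemLp (growthLimit m - fun _ => 1) 4 (envLaw p ρ) := by
    refine ⟨(measurable_growthLimit.sub measurable_const).aestronglyMeasurable, ?_⟩
    refine (Lp.eLpNorm_lim_le_liminf_eLpNorm (f := fun n => genSize m n - fun _ => 1)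
      (fun n => (hmem n).1) _ ?_).trans_lt ?_
    · filter_upwards [ae_tendsto_genSize h hm] with e he
      exact he.sub_const 1
    · refine (liminf_le_of_le (by isBoundedDefault) (a := ENNReal.ofReal B) fun b hb => ?_).trans_lt
        ENNReal.ofReal_lt_top
      obtain ⟨n, hn, hn2⟩ := (hb.and hB).exists
      refine hn.trans ?_
      rw [← ofReal_lpNorm (hmem n)]
      refine ENNReal.ofReal_le_ofReal ?_
      simpa [abs_of_nonneg lpNorm_nonneg] using hn2
  have := key.add (memLp_const (1 : ℝ))
  simpa using this

/-- Taking second moments in `W = branchAvg W` gives `w = m⁻¹ * w + a₁`. The same constant is the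
limit of `E[C_n²] / E[C_n]²`. -/
lemma integral_growthLimit_sq (h : Admissible p ρ) (hm : m = meanOffspring p) :
    ∫ e, growthLimit m e ^ 2 ∂(envLaw p ρ) = constA1 p / (1 - m⁻¹) := by
  have hm1 : 1 < m := hm ▸ h.one_lt_mean
  have h1 := integral_branchAvg_sq h hm measurable_growthLimit
    ((memLp_growthLimit h hm).mono_exponent (by norm_num))
  have h2 : ∫ e, branchAvg m (growthLimit m) e ^ 2 ∂(envLaw p ρ)
      = ∫ e, growthLimit m e ^ 2 ∂(envLaw p ρ) := by
    refine integral_congr_ae ?_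
    filter_upwards [growthLimit_fixed h hm] with e he
    rw [he]
  rw [h2, integral_growthLimit h hm] at h1
  have : 1 - m⁻¹ ≠ 0 := by
    have := inv_lt_one_of_one_lt₀ hm1
    linarith
  rw [eq_div_iff this]
  linarith

end GWNetwork

/-! ### Positivity of `W`; recursion and integrability of the conductances. -/

namespace GWNetwork

variable {p : PMF ℕ} {ρ : Measure ℝ} {m : ℝ}

/-! ### Almost sure properties of the environment -/

/-- Every vertex has a child and every mark is positive. -/
def IsRegular (e : Env) : Prop := ∀ x, 1 ≤ (e x).1 ∧ 0 < (e x).2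

lemma IsRegular.shift {e : Env} (he : IsRegular e) (i : ℕ) : IsRegular (shift i e) :=
  fun x => he (i :: x)

lemma IsRegular.rootMark_pos {e : Env} (he : IsRegular e) : 0 < rootMark e := (he []).2

lemma IsRegular.branchAvg_pos {e : Env} (he : IsRegular e) (hm : 0 < m) {G : Env → ℝ}
    (hG : ∀ i, 0 < G (GWNetwork.shift i e)) : 0 < branchAvg m G e := by
  refine mul_pos (inv_pos.2 hm) (Finset.sum_pos (fun i _ => hG i) ?_)
  exact ⟨0, Finset.mem_range.2 (he []).1⟩

lemma Admissible.ae_offspring_pos (h : Admissible p ρ) : ∀ᵐ k ∂p.toMeasure, 1 ≤ k := by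
  have h0 : p.toMeasure {0} = 0 := by
    rw [PMF.toMeasure_apply_singleton _ _ (measurableSet_singleton 0), h.offspring_zero]
  rw [ae_iff]
  convert h0 using 2
  ext k; simp

lemma Admissible.offspring_one_lt_one (h : Admissible p ρ) : p.toMeasure.real {1} < 1 := by
  refine lt_of_le_of_ne measureReal_le_one fun h1 => ?_
  have h2 : ∀ᵐ k ∂p.toMeasure, k = 1 := by
    have : p.toMeasure {1} = 1 := by
      rw [← ENNReal.toReal_eq_one_iff]; exact h1
    rw [ae_iff]
    have hc := prob_compl_eq_zero_iff (μ := p.toMeasure) (measurableSet_singleton 1)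
    exact hc.2 this
  have h3 : meanOffspring p = 1 := by
    unfold meanOffspring
    rw [integral_congr_ae (g := fun _ => (1 : ℝ)) (h2.mono fun k hk => by simp [hk])]
    simp
  exact h.one_lt_mean.ne' h3

lemma memLp_of_integrable_pow {S : Type*} [MeasurableSpace S] {σ : Measure S} {f : S → ℝ}
    (hf : AEStronglyMeasurable f σ) {j : ℕ} (hj : j ≠ 0) (h0 : ∀ᵐ s ∂σ, 0 ≤ f s)
    (h : Integrable (fun s => f s ^ j) σ) : MemLp f j σ := by
  refine (integrable_norm_rpow_iff hf (by exact_mod_cast hj) (by simp)).1 ?_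
  refine h.congr ?_
  filter_upwards [h0] with s hs
  simp [abs_of_nonneg hs]

variable [IsProbabilityMeasure ρ]

lemma ae_isRegular (h : Admissible p ρ) : ∀ᵐ e ∂(envLaw p ρ), IsRegular e := by
  refine ae_all_iff.2 fun x => ?_
  have hx : (envLaw p ρ).map (fun e => e x) = p.toMeasure.prod ρ :=
    Measure.infinitePi_map_eval (fun _ : List ℕ => p.toMeasure.prod ρ) x
  have h1 : ∀ᵐ a ∂(p.toMeasure.prod ρ), 1 ≤ a.1 ∧ 0 < a.2 :=
    (Measure.quasiMeasurePreserving_fst.ae h.ae_offspring_pos).and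
      (Measure.quasiMeasurePreserving_snd.ae h.mark_pos)
  rw [← hx] at h1
  exact ae_of_ae_map (measurable_pi_apply x).aemeasurable h1

lemma ae_forall_shift {q : Env → Prop} (hq : ∀ᵐ e ∂(envLaw p ρ), q e) :
    ∀ᵐ e ∂(envLaw p ρ), ∀ i, q (shift i e) :=
  ae_all_iff.2 fun i => (measurePreserving_shift i).quasiMeasurePreserving.ae hq

/-- If `W` vanishes at the root, it vanishes at every child. With `q = P(W = 0)` and `p₁ = P(ν = 1)
< 1` this yields `q ≤ p₁ q + (1 - p₁) q²`, so `q` is 0 or 1, and `E[W] = 1` excludes 1. -/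
lemma growthLimit_pos (h : Admissible p ρ) (hm : m = meanOffspring p) :
    ∀ᵐ e ∂(envLaw p ρ), 0 < growthLimit m e := by
  have hm0 : 0 < m := hm ▸ zero_lt_one.trans h.one_lt_mean
  set A : Set Env := {e | growthLimit m e = 0} with hA
  have hAm : MeasurableSet A := measurable_growthLimit (measurableSet_singleton 0)
  -- Exactly one child, or an offspring number different from 1, almost surely at least 2; in the
  -- second case only the first two children are retained.
  set B₁ : Set (ℕ × (ℕ → Env)) := {1} ×ˢ Set.pi ({0} : Finset ℕ) (fun _ => A) with hB₁
  set B₂ : Set (ℕ × (ℕ → Env)) := {1}ᶜ ×ˢ Set.pi ({0, 1} : Finset ℕ) (fun _ => A) with hB₂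
  have hBm : ∀ s : Finset ℕ, MeasurableSet (Set.pi (s : Set ℕ) (fun _ => A)) := fun s =>
    MeasurableSet.pi s.countable_toSet fun _ _ => hAm
  have hsub : (envLaw p ρ) A ≤ (envLaw p ρ) (offspringView ⁻¹' (B₁ ∪ B₂)) := by
    refine measure_mono_ae ?_
    filter_upwards [growthLimit_fixed h hm, ae_isRegular h,
      ae_forall_shift (growthLimit_nonneg h hm)] with e h1 h2 h3 h4
    have h4' : branchAvg m (growthLimit m) e = 0 := h1.trans h4
    have h5 : ∀ i ∈ Finset.range (e []).1, growthLimit m (shift i e) = 0 := by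
      refine (Finset.sum_eq_zero_iff_of_nonneg fun i _ => h3 i).1 ?_
      exact (mul_eq_zero.1 h4').resolve_left (inv_ne_zero hm0.ne')
    have h6 := (h2 []).1
    have h0 := h5 0 (Finset.mem_range.2 h6)
    by_cases hN : (e []).1 = 1
    · left; simp [hB₁, offspringView, hN, hA, h0]
    · right
      have := h5 1 (Finset.mem_range.2 (by omega))
      simp [hB₂, offspringView, hN, hA, h0, this]
  rw [← Measure.map_apply measurable_offspringView
    (((measurableSet_singleton 1).prod (hBm _)).union ((measurableSet_singleton 1).compl.prod (hBm _))),
    map_offspringView] at hsub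
  have hle := hsub.trans (measure_union_le _ _)
  rw [Measure.prod_prod, Measure.prod_prod, Measure.infinitePi_pi _ (fun _ _ => hAm),
    Measure.infinitePi_pi _ (fun _ _ => hAm)] at hle
  simp only [Finset.prod_singleton, Finset.prod_pair (zero_ne_one (α := ℕ))] at hle
  set q := (envLaw p ρ).real A with hq
  have hqr : q ≤ p.toMeasure.real {1} * q + (1 - p.toMeasure.real {1}) * (q * q) := by
    have h1 := ENNReal.toReal_mono (by finiteness) hle
    rw [ENNReal.toReal_add (by finiteness) (by finiteness), ENNReal.toReal_mul, ENNReal.toReal_mul,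
      ENNReal.toReal_mul] at h1
    rwa [← probReal_compl_eq_one_sub (measurableSet_singleton 1)]
  have hp1 := h.offspring_one_lt_one
  have hq0 : 0 ≤ q := measureReal_nonneg
  have hq1 : q ≤ 1 := measureReal_le_one
  have hq2 : q * (1 - q) ≤ 0 := by
    by_contra hc
    push Not at hc
    nlinarith
  have hqne : q ≠ 1 := by
    intro hq1
    have h1 : (envLaw p ρ) A = 1 := by
      rw [← ENNReal.toReal_eq_one_iff]; exact hq1
    have h2 : ∀ᵐ e ∂(envLaw p ρ), e ∈ A := (prob_compl_eq_zero_iff hAm).2 h1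
    have h3 := integral_growthLimit h hm
    rw [integral_congr_ae (g := fun _ => (0 : ℝ)) (h2.mono fun e he => he)] at h3
    simp at h3
  have hqz : q = 0 := by
    by_contra hne
    have h1 : 0 < q := lt_of_le_of_ne hq0 (Ne.symm hne)
    have h2 : q < 1 := lt_of_le_of_ne hq1 hqne
    nlinarith [mul_pos h1 (sub_pos.2 h2)]
  have hA0 : (envLaw p ρ) A = 0 := (measureReal_eq_zero_iff).1 hqz
  have hA1 : ∀ᵐ e ∂(envLaw p ρ), growthLimit m e ≠ 0 := by
    rw [ae_iff]; simpa using hA0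
  filter_upwards [hA1, growthLimit_nonneg h hm] with e h1 h2
  exact lt_of_le_of_ne h2 (Ne.symm h1)

/-! ### Conductances -/

/-- The conductance, in units adapted to the root, of the tree up to depth `n` together with
the edge that joins its root to the parent. -/
noncomputable def stemCond (m : ℝ) : ℕ → Env → ℝ
  | 0 => fun e => (rootMark e)⁻¹
  | n + 1 => fun e => branchAvg m (stemCond m n) e / (1 + rootMark e * branchAvg m (stemCond m n) e)

/-- The conductance between the root and depth `n`, for `n ≥ 1`. -/
noncomputable def treeCond (m : ℝ) (n : ℕ) : Env → ℝ := branchAvg m (stemCond m (n - 1))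

lemma treeCond_succ (n : ℕ) : treeCond m (n + 1) = branchAvg m (stemCond m n) := rfl

lemma stemCond_succ (n : ℕ) (e : Env) : stemCond m (n + 1) e
    = treeCond m (n + 1) e / (1 + rootMark e * treeCond m (n + 1) e) := rfl

lemma stemCond_eq {n : ℕ} (hn : n ≠ 0) (e : Env) :
    stemCond m n e = treeCond m n e / (1 + rootMark e * treeCond m n e) := by
  obtain ⟨k, rfl⟩ := Nat.exists_eq_succ_of_ne_zero hn
  rfl

lemma measurable_stemCond (n : ℕ) : Measurable (stemCond m n) := by
  induction n with
  | zero => exact measurable_rootMark.inv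
  | succ n ih =>
    have := measurable_branchAvg (m := m) ih
    exact this.div (measurable_const.add (measurable_rootMark.mul this))

lemma measurable_treeCond (n : ℕ) : Measurable (treeCond m n) :=
  measurable_branchAvg (measurable_stemCond _)

lemma stemCond_pos (hm : 0 < m) (n : ℕ) {e : Env} (he : IsRegular e) : 0 < stemCond m n e := by
  induction n generalizing e with
  | zero => exact inv_pos.2 he.rootMark_pos
  | succ n ih =>
    have h1 : 0 < branchAvg m (stemCond m n) e := he.branchAvg_pos hm fun i => ih (he.shift i)
    have := he.rootMark_pos
    simp only [stemCond]
    positivity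

lemma treeCond_pos (hm : 0 < m) (n : ℕ) {e : Env} (he : IsRegular e) : 0 < treeCond m n e :=
  he.branchAvg_pos hm fun i => stemCond_pos hm _ (he.shift i)

lemma stemCond_le_inv (hm : 0 < m) (n : ℕ) {e : Env} (he : IsRegular e) :
    stemCond m n e ≤ (rootMark e)⁻¹ := by
  cases n with
  | zero => exact le_rfl
  | succ n =>
    have h1 := treeCond_pos hm (n + 1) he
    have h2 := he.rootMark_pos
    rw [stemCond_succ, div_le_iff₀ (by positivity)]
    have : (rootMark e)⁻¹ * (rootMark e * treeCond m (n + 1) e) = treeCond m (n + 1) e := by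
      field_simp
    have h3 : 0 < (rootMark e)⁻¹ := inv_pos.2 h2
    rw [mul_add, this]; linarith

lemma stemCond_le_treeCond (hm : 0 < m) {n : ℕ} (hn : n ≠ 0) {e : Env} (he : IsRegular e) :
    stemCond m n e ≤ treeCond m n e := by
  have h1 := treeCond_pos hm n he
  have h2 := he.rootMark_pos
  rw [stemCond_eq hn]
  exact div_le_self h1.le (by nlinarith [mul_pos h2 h1])

/-! ### Independence of the root mark -/

/-- The conductance is a `branchAvg` by definition and the growth limit is one up to a null set, so
both are functions of the subtrees of the children. Independence is stated for the pair, because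
later errors mix the two. -/
lemma indepFun_rootMark_treeCond (h : Admissible p ρ) (hm : m = meanOffspring p) (n : ℕ) :
    IndepFun rootMark (fun e => (treeCond m n e, growthLimit m e)) (envLaw p ρ) := by
  refine (indepFun_rootMark_branchAvg (m := m) (measurable_stemCond (m := m) (n - 1))
    (measurable_growthLimit (m := m))).congr (ae_eq_refl _) ?_
  filter_upwards [growthLimit_fixed h hm] with e he
  rw [he]; rfl

lemma integrable_comp_rootMark {φ : ℝ → ℝ} (hφ : Integrable φ ρ) :
    Integrable (fun e => φ (rootMark e)) (envLaw p ρ) := by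
  rw [← map_rootMark (p := p) (ρ := ρ)] at hφ
  exact (integrable_map_measure hφ.1 measurable_rootMark.aemeasurable).1 hφ

lemma integral_comp_rootMark {φ : ℝ → ℝ} (hφ : Integrable φ ρ) :
    ∫ e, φ (rootMark e) ∂(envLaw p ρ) = ∫ t, φ t ∂ρ := by
  conv_rhs => rw [← map_rootMark (p := p) (ρ := ρ)]
  rw [integral_map measurable_rootMark.aemeasurable]
  rw [map_rootMark]; exact hφ.1

lemma integrable_rootMark_mul (h : Admissible p ρ) (hm : m = meanOffspring p) (n : ℕ)
    {φ : ℝ → ℝ} (hφm : Measurable φ) (hφ : Integrable φ ρ) {ψ : ℝ × ℝ → ℝ} (hψm : Measurable ψ)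
    (hψ : Integrable (fun e => ψ (treeCond m n e, growthLimit m e)) (envLaw p ρ)) :
    Integrable (fun e => φ (rootMark e) * ψ (treeCond m n e, growthLimit m e)) (envLaw p ρ) :=
  ((indepFun_rootMark_treeCond h hm n).comp hφm hψm).integrable_mul
    (integrable_comp_rootMark hφ) hψ

lemma integral_rootMark_mul (h : Admissible p ρ) (hm : m = meanOffspring p) (n : ℕ)
    {φ : ℝ → ℝ} (hφm : Measurable φ) (hφ : Integrable φ ρ) {ψ : ℝ × ℝ → ℝ} (hψm : Measurable ψ) :
    ∫ e, φ (rootMark e) * ψ (treeCond m n e, growthLimit m e) ∂(envLaw p ρ)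
      = (∫ t, φ t ∂ρ) * ∫ e, ψ (treeCond m n e, growthLimit m e) ∂(envLaw p ρ) := by
  rw [← integral_comp_rootMark (p := p) hφ]
  exact (indepFun_rootMark_treeCond h hm n).integral_fun_comp_mul_comp
    measurable_rootMark.aemeasurable
    ((measurable_treeCond n).prodMk measurable_growthLimit).aemeasurable
    hφm.aestronglyMeasurable hψm.aestronglyMeasurable

/-! ### Integrability of the conductances -/

/-- Each generation gains one moment from `E[ξ⁻¹] < ∞` alone: the stem conductance is at most `ξ⁻¹`
and at most the tree conductance `C`, so its power `j + 2` is at most `ξ⁻¹ * C ^ (j + 1)`, a product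
of independent integrable factors. Four moments are thus available from level 3 for stems and level
4 for trees, whence the threshold `4 ≤ n` below. -/
lemma memLp_stemCond (h : Admissible p ρ) (hm : m = meanOffspring p) {j : ℕ} (hj : j + 1 ≤ 4)
    {n : ℕ} (hn : j ≤ n) : MemLp (stemCond m n) (j + 1 : ℕ) (envLaw p ρ) := by
  have hm0 : 0 < m := hm ▸ zero_lt_one.trans h.one_lt_mean
  have hpos : ∀ n, ∀ᵐ e ∂(envLaw p ρ), 0 ≤ stemCond m n e := fun n =>
    (ae_isRegular h).mono fun e he => (stemCond_pos hm0 n he).le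
  have hinv := integrable_comp_rootMark (p := p) h.integrable_inv
  induction j generalizing n with
  | zero =>
    refine memLp_of_integrable_pow (measurable_stemCond n).aestronglyMeasurable (by norm_num)
      (hpos n) ?_
    simp only [zero_add, pow_one]
    refine hinv.mono (measurable_stemCond n).aestronglyMeasurable ?_
    filter_upwards [ae_isRegular h] with e he
    have h1 := stemCond_pos hm0 n he
    have h2 := he.rootMark_pos
    rw [Real.norm_of_nonneg h1.le, Real.norm_of_nonneg (inv_pos.2 h2).le]
    exact stemCond_le_inv hm0 n he
  | succ j ih =>
    obtain ⟨k, rfl⟩ : ∃ k, n = k + 1 := ⟨n - 1, by omega⟩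
    have hC : MemLp (treeCond m (k + 1)) (j + 1 : ℕ) (envLaw p ρ) :=
      memLp_branchAvg h (measurable_stemCond k) (by omega) (by omega)
        (ih (by omega) (by omega))
    refine memLp_of_integrable_pow (measurable_stemCond _).aestronglyMeasurable (by omega)
      (hpos _) ?_
    have hint : Integrable (fun e => (rootMark e)⁻¹ * treeCond m (k + 1) e ^ (j + 1))
        (envLaw p ρ) :=
      integrable_rootMark_mul h hm (k + 1) measurable_inv h.integrable_inv
        (ψ := fun a => a.1 ^ (j + 1)) (by fun_prop) (integrable_pow_of_memLp hC le_rfl)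
    refine hint.mono ((measurable_stemCond _).pow_const _).aestronglyMeasurable ?_
    filter_upwards [ae_isRegular h] with e he
    have h1 := stemCond_pos hm0 (k + 1) he
    have h2 := he.rootMark_pos
    have h3 := treeCond_pos hm0 (k + 1) he
    rw [Real.norm_of_nonneg (by positivity), Real.norm_of_nonneg (by positivity), pow_succ' _ (j + 1)]
    gcongr
    · exact stemCond_le_inv hm0 _ he
    · exact stemCond_le_treeCond hm0 (by omega) he

lemma memLp_four_stemCond (h : Admissible p ρ) (hm : m = meanOffspring p) {n : ℕ} (hn : 3 ≤ n) :
    MemLp (stemCond m n) 4 (envLaw p ρ) :=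
  memLp_stemCond h hm (j := 3) (by norm_num) hn

lemma memLp_four_treeCond (h : Admissible p ρ) (hm : m = meanOffspring p) {n : ℕ} (hn : 4 ≤ n) :
    MemLp (treeCond m n) 4 (envLaw p ρ) :=
  memLp_branchAvg h (measurable_stemCond _) (j := 4) (by norm_num) (by norm_num)
    (memLp_four_stemCond h hm (by omega))

end GWNetwork

/-! ### The moment recursion and two-sided bounds on the mean conductance. -/

namespace GWNetwork

variable {p : PMF ℕ} {ρ : Measure ℝ} {m : ℝ}

/-! ### Moments of the marks -/

/-- The third moment of the marks. -/
noncomputable def constB3 (ρ : Measure ℝ) : ℝ := ∫ t, t ^ 3 ∂ρ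

lemma Admissible.memLp_mark (h : Admissible p ρ) : MemLp (fun t : ℝ => t) (3 : ℕ) ρ :=
  memLp_of_integrable_pow (by fun_prop) (by norm_num) (h.mark_pos.mono fun _ ht => ht.le)
    h.integrable_cube

lemma Admissible.constB2_nonneg (_h : Admissible p ρ) : 0 ≤ constB2 ρ :=
  integral_nonneg fun t => sq_nonneg t

variable [IsProbabilityMeasure ρ]

lemma Admissible.integrable_mark_pow (h : Admissible p ρ) {j : ℕ} (hj : j ≤ 3) :
    Integrable (fun t : ℝ => t ^ j) ρ := integrable_pow_of_memLp h.memLp_mark hj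

lemma Admissible.integrable_mark (h : Admissible p ρ) : Integrable (fun t : ℝ => t) ρ := by
  simpa using h.integrable_mark_pow (j := 1) (by norm_num)

lemma Admissible.constB1_pos (h : Admissible p ρ) : 0 < constB1 ρ := by
  refine (integral_pos_iff_support_of_nonneg_ae (h.mark_pos.mono fun _ ht => ht.le)
    h.integrable_mark).2 ?_
  have : ∀ᵐ t ∂ρ, t ∈ Function.support fun t : ℝ => t := h.mark_pos.mono fun t ht => ht.ne'
  have h1 : ρ (Function.support fun t : ℝ => t) = 1 := by
    exact (mem_ae_iff_prob_eq_one (measurableSet_support measurable_id)).1 this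
  simp [h1]

lemma Admissible.constC1_pos (h : Admissible p ρ) : 0 < constC1 p ρ := by
  have h1 := h.constA1_pos
  have h2 := h.constB1_pos
  have h3 := inv_lt_one_of_one_lt₀ h.one_lt_mean
  unfold constC1
  have : 0 < 1 - (meanOffspring p)⁻¹ := by linarith
  positivity

/-! ### Moments of the conductances -/

/-- The moments of `C_n`. -/
noncomputable def condMoment (p : PMF ℕ) (ρ : Measure ℝ) [IsProbabilityMeasure ρ] (j n : ℕ) : ℝ :=
  ∫ e, treeCond (meanOffspring p) n e ^ j ∂(envLaw p ρ)

/-- The moments of `C_n / (1 + ξ C_n)`. -/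
noncomputable def stemMoment (p : PMF ℕ) (ρ : Measure ℝ) [IsProbabilityMeasure ρ] (j n : ℕ) : ℝ :=
  ∫ e, stemCond (meanOffspring p) n e ^ j ∂(envLaw p ρ)

lemma ae_conductance_pos (h : Admissible p ρ) (n : ℕ) : ∀ᵐ e ∂(envLaw p ρ),
    0 < rootMark e ∧ 0 < treeCond (meanOffspring p) n e ∧ 0 < stemCond (meanOffspring p) n e :=
  (ae_isRegular h).mono fun _ he => ⟨he.rootMark_pos,
    treeCond_pos (zero_lt_one.trans h.one_lt_mean) n he,
    stemCond_pos (zero_lt_one.trans h.one_lt_mean) n he⟩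

lemma condMoment_nonneg (h : Admissible p ρ) (j n : ℕ) : 0 ≤ condMoment p ρ j n :=
  integral_nonneg_of_ae ((ae_conductance_pos h n).mono fun _ he => pow_nonneg he.2.1.le j)

lemma stemMoment_nonneg (h : Admissible p ρ) (j n : ℕ) : 0 ≤ stemMoment p ρ j n :=
  integral_nonneg_of_ae ((ae_conductance_pos h n).mono fun _ he => pow_nonneg he.2.2.le j)

lemma integrable_treeCond_pow (h : Admissible p ρ) {j n : ℕ} (hj : j ≤ 4) (hn : 4 ≤ n) :
    Integrable (fun e => treeCond (meanOffspring p) n e ^ j) (envLaw p ρ) :=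
  integrable_pow_of_memLp (by exact_mod_cast memLp_four_treeCond h rfl hn) hj

lemma integrable_stemCond_pow (h : Admissible p ρ) {j n : ℕ} (hj : j ≤ 4) (hn : 4 ≤ n) :
    Integrable (fun e => stemCond (meanOffspring p) n e ^ j) (envLaw p ρ) :=
  integrable_pow_of_memLp
    (by exact_mod_cast memLp_four_stemCond h rfl (by omega : 3 ≤ n)) hj

lemma integrable_mark_pow_mul_treeCond_pow (h : Admissible p ρ) {i j n : ℕ} (hi : i ≤ 3)
    (hj : j ≤ 4) (hn : 4 ≤ n) :
    Integrable (fun e => rootMark e ^ i * treeCond (meanOffspring p) n e ^ j) (envLaw p ρ) :=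
  integrable_rootMark_mul h rfl n (φ := fun t => t ^ i) (by fun_prop) (h.integrable_mark_pow hi)
    (ψ := fun a => a.1 ^ j) (by fun_prop) (integrable_treeCond_pow h hj hn)

lemma integral_mark_pow_mul_treeCond_pow (h : Admissible p ρ) {i : ℕ} (j n : ℕ) (hi : i ≤ 3) :
    ∫ e, rootMark e ^ i * treeCond (meanOffspring p) n e ^ j ∂(envLaw p ρ)
      = (∫ t, t ^ i ∂ρ) * condMoment p ρ j n :=
  integral_rootMark_mul h rfl n (φ := fun t => t ^ i) (by fun_prop) (h.integrable_mark_pow hi)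
    (ψ := fun a => a.1 ^ j) (by fun_prop)

lemma stemMoment_le_condMoment (h : Admissible p ρ) {j n : ℕ} (hj : j ≤ 4) (hn : 4 ≤ n) :
    stemMoment p ρ j n ≤ condMoment p ρ j n := by
  refine integral_mono_ae (integrable_stemCond_pow h hj hn) (integrable_treeCond_pow h hj hn) ?_
  filter_upwards [ae_isRegular h] with e he
  have hm0 := zero_lt_one.trans h.one_lt_mean
  exact pow_le_pow_left₀ (stemCond_pos hm0 n he).le
    (stemCond_le_treeCond hm0 (by omega) he) j

/-- Finite geometric expansion of `u / (1 + t * u)` in `t * u` with remainder `t ^ 3 * u ^ 4 / (1 +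
t * u)`; independence of mark and conductance factorizes every moment. This is where the third
moment of the marks enters. -/
lemma abs_stemMoment_one_sub_le (h : Admissible p ρ) {n : ℕ} (hn : 4 ≤ n) :
    |stemMoment p ρ 1 n - (condMoment p ρ 1 n - constB1 ρ * condMoment p ρ 2 n
      + constB2 ρ * condMoment p ρ 3 n)| ≤ constB3 ρ * condMoment p ρ 4 n := by
  have i1 := integrable_treeCond_pow h (j := 1) (by norm_num) hn
  have i2 := integrable_mark_pow_mul_treeCond_pow h (i := 1) (j := 2) (by norm_num) (by norm_num) hn
  have i3 := integrable_mark_pow_mul_treeCond_pow h (i := 2) (j := 3) (by norm_num) (by norm_num) hn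
  have i4 := integrable_mark_pow_mul_treeCond_pow h (i := 3) (j := 4) (by norm_num) (by norm_num) hn
  have s1 := integrable_stemCond_pow h (j := 1) (by norm_num) hn
  have e2 := integral_mark_pow_mul_treeCond_pow h (i := 1) 2 n (by norm_num)
  have e3 := integral_mark_pow_mul_treeCond_pow h (i := 2) 3 n (by norm_num)
  have e4 := integral_mark_pow_mul_treeCond_pow h (i := 3) 4 n (by norm_num)
  simp only [pow_one] at e2
  have i12 : Integrable (fun e => treeCond (meanOffspring p) n e ^ 1
      - rootMark e ^ 1 * treeCond (meanOffspring p) n e ^ 2) (envLaw p ρ) := i1.sub i2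
  have i123 : Integrable (fun e => treeCond (meanOffspring p) n e ^ 1
      - rootMark e ^ 1 * treeCond (meanOffspring p) n e ^ 2
      + rootMark e ^ 2 * treeCond (meanOffspring p) n e ^ 3) (envLaw p ρ) := i12.add i3
  have key : stemMoment p ρ 1 n - (condMoment p ρ 1 n - constB1 ρ * condMoment p ρ 2 n
      + constB2 ρ * condMoment p ρ 3 n)
      = ∫ e, (stemCond (meanOffspring p) n e ^ 1 - (treeCond (meanOffspring p) n e ^ 1
      - rootMark e ^ 1 * treeCond (meanOffspring p) n e ^ 2
      + rootMark e ^ 2 * treeCond (meanOffspring p) n e ^ 3)) ∂(envLaw p ρ) := by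
    rw [integral_sub s1 i123, integral_add i12 i3, integral_sub i1 i2]
    simp only [pow_one, e2, e3]
    simp [stemMoment, condMoment, constB1, constB2]
  rw [key, constB3, ← e4, ← Real.norm_eq_abs]
  refine (norm_integral_le_integral_norm _).trans (integral_mono_ae (s1.sub i123).norm i4 ?_)
  filter_upwards [ae_conductance_pos h n] with e ⟨h1, h2, h3⟩
  rw [stemCond_eq (by omega), Real.norm_eq_abs]
  set t := rootMark e
  set u := treeCond (meanOffspring p) n e
  have hd : 0 < 1 + t * u := by positivity
  have : (u / (1 + t * u)) ^ 1 - (u ^ 1 - t ^ 1 * u ^ 2 + t ^ 2 * u ^ 3)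
      = -(t ^ 3 * u ^ 4 / (1 + t * u)) := by field_simp; ring
  rw [this, abs_neg, abs_of_nonneg (by positivity)]
  exact div_le_self (by positivity) (by nlinarith [mul_pos h1 h2])

lemma abs_stemMoment_two_sub_le (h : Admissible p ρ) {n : ℕ} (hn : 4 ≤ n) :
    |stemMoment p ρ 2 n - (condMoment p ρ 2 n - 2 * constB1 ρ * condMoment p ρ 3 n)|
      ≤ 3 * constB2 ρ * condMoment p ρ 4 n := by
  have i1 := integrable_treeCond_pow h (j := 2) (by norm_num) hn
  have i2 := (integrable_mark_pow_mul_treeCond_pow h (i := 1) (j := 3) (by norm_num) (by norm_num)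
    hn).const_mul 2
  have i4 := (integrable_mark_pow_mul_treeCond_pow h (i := 2) (j := 4) (by norm_num) (by norm_num)
    hn).const_mul 3
  have s1 := integrable_stemCond_pow h (j := 2) (by norm_num) hn
  have e2 := integral_mark_pow_mul_treeCond_pow h (i := 1) 3 n (by norm_num)
  have e4 := integral_mark_pow_mul_treeCond_pow h (i := 2) 4 n (by norm_num)
  have i123 : Integrable (fun e => treeCond (meanOffspring p) n e ^ 2
      - 2 * (rootMark e ^ 1 * treeCond (meanOffspring p) n e ^ 3)) (envLaw p ρ) := i1.sub i2
  have key : stemMoment p ρ 2 n - (condMoment p ρ 2 n - 2 * constB1 ρ * condMoment p ρ 3 n)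
      = ∫ e, (stemCond (meanOffspring p) n e ^ 2 - (treeCond (meanOffspring p) n e ^ 2
      - 2 * (rootMark e ^ 1 * treeCond (meanOffspring p) n e ^ 3))) ∂(envLaw p ρ) := by
    rw [integral_sub s1 i123, integral_sub i1 i2, integral_const_mul, e2]
    simp only [stemMoment, condMoment, constB1, pow_one]
    ring
  have key2 : 3 * constB2 ρ * condMoment p ρ 4 n
      = ∫ e, 3 * (rootMark e ^ 2 * treeCond (meanOffspring p) n e ^ 4) ∂(envLaw p ρ) := by
    rw [integral_const_mul, e4, constB2]; ring
  rw [key, key2, ← Real.norm_eq_abs]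
  refine (norm_integral_le_integral_norm _).trans (integral_mono_ae (s1.sub i123).norm i4 ?_)
  filter_upwards [ae_conductance_pos h n] with e ⟨h1, h2, h3⟩
  rw [stemCond_eq (by omega), Real.norm_eq_abs]
  set t := rootMark e
  set u := treeCond (meanOffspring p) n e
  have hd : 0 < 1 + t * u := by positivity
  have : (u / (1 + t * u)) ^ 2 - (u ^ 2 - 2 * (t ^ 1 * u ^ 3))
      = t ^ 2 * u ^ 4 * (3 + 2 * (t * u)) / (1 + t * u) ^ 2 := by field_simp; ring
  rw [this, abs_of_nonneg (by positivity), div_le_iff₀ (by positivity)]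
  -- The numerator of the exact remainder is dominated by three times its denominator, which gives
  -- the constant 3.
  have h5 : 3 + 2 * (t * u) ≤ 3 * (1 + t * u) ^ 2 := by nlinarith [mul_pos h1 h2]
  calc _ ≤ t ^ 2 * u ^ 4 * (3 * (1 + t * u) ^ 2) := by gcongr
    _ = _ := by ring

lemma abs_stemMoment_three_sub_le (h : Admissible p ρ) {n : ℕ} (hn : 4 ≤ n) :
    |stemMoment p ρ 3 n - condMoment p ρ 3 n| ≤ 3 * constB1 ρ * condMoment p ρ 4 n := by
  have i1 := integrable_treeCond_pow h (j := 3) (by norm_num) hn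
  have i4 := (integrable_mark_pow_mul_treeCond_pow h (i := 1) (j := 4) (by norm_num) (by norm_num)
    hn).const_mul 3
  have s1 := integrable_stemCond_pow h (j := 3) (by norm_num) hn
  have e4 := integral_mark_pow_mul_treeCond_pow h (i := 1) 4 n (by norm_num)
  have key : stemMoment p ρ 3 n - condMoment p ρ 3 n
      = ∫ e, (stemCond (meanOffspring p) n e ^ 3 - treeCond (meanOffspring p) n e ^ 3)
        ∂(envLaw p ρ) := by
    rw [integral_sub s1 i1]; rfl
  have key2 : 3 * constB1 ρ * condMoment p ρ 4 n
      = ∫ e, 3 * (rootMark e ^ 1 * treeCond (meanOffspring p) n e ^ 4) ∂(envLaw p ρ) := by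
    rw [integral_const_mul, e4, constB1]; simp only [pow_one]; ring
  rw [key, key2, ← Real.norm_eq_abs]
  refine (norm_integral_le_integral_norm _).trans (integral_mono_ae (s1.sub i1).norm i4 ?_)
  filter_upwards [ae_conductance_pos h n] with e ⟨h1, h2, h3⟩
  rw [stemCond_eq (by omega), Real.norm_eq_abs]
  set t := rootMark e
  set u := treeCond (meanOffspring p) n e
  have hd : 0 < 1 + t * u := by positivity
  have : (u / (1 + t * u)) ^ 3 - u ^ 3
      = -(t * u ^ 4 * (3 + 3 * (t * u) + (t * u) ^ 2) / (1 + t * u) ^ 3) := by field_simp; ring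
  rw [this, abs_neg, abs_of_nonneg (by positivity), div_le_iff₀ (by positivity)]
  have h6 := mul_pos h1 h2
  have h5 : 3 + 3 * (t * u) + (t * u) ^ 2 ≤ 3 * (1 + t * u) ^ 3 := by
    nlinarith [pow_pos h6 2, pow_pos h6 3]
  calc _ ≤ t * u ^ 4 * (3 * (1 + t * u) ^ 3) := by gcongr
    _ = _ := by ring

lemma condMoment_one_succ (h : Admissible p ρ) {n : ℕ} (hn : 4 ≤ n) :
    condMoment p ρ 1 (n + 1) = stemMoment p ρ 1 n := by
  simp only [condMoment, stemMoment, pow_one]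
  exact integral_branchAvg h rfl (measurable_stemCond n)
    ((memLp_four_stemCond h rfl (by omega)).mono_exponent (by norm_num))

lemma condMoment_two_succ (h : Admissible p ρ) {n : ℕ} (hn : 4 ≤ n) :
    condMoment p ρ 2 (n + 1) = (meanOffspring p)⁻¹ * stemMoment p ρ 2 n
      + constA1 p * stemMoment p ρ 1 n ^ 2 := by
  simp only [condMoment, stemMoment, pow_one]
  exact integral_branchAvg_sq h rfl (measurable_stemCond n)
    ((memLp_four_stemCond h rfl (by omega)).mono_exponent (by norm_num))

lemma condMoment_three_succ (h : Admissible p ρ) {n : ℕ} (hn : 4 ≤ n) :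
    condMoment p ρ 3 (n + 1) = (meanOffspring p ^ 2)⁻¹ * stemMoment p ρ 3 n
      + 3 * (constA1 p / meanOffspring p) * (stemMoment p ρ 2 n * stemMoment p ρ 1 n)
      + constA2 p * stemMoment p ρ 1 n ^ 3 := by
  simp only [condMoment, stemMoment, pow_one]
  exact integral_branchAvg_cube h rfl (measurable_stemCond n)
    ((memLp_four_stemCond h rfl (by omega)).mono_exponent (by norm_num))

lemma condMoment_four_succ (h : Admissible p ρ) {n : ℕ} (hn : 4 ≤ n) :
    condMoment p ρ 4 (n + 1) = (meanOffspring p ^ 3)⁻¹ * stemMoment p ρ 4 n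
      + 4 * (constA1 p / meanOffspring p ^ 2) * (stemMoment p ρ 3 n * stemMoment p ρ 1 n)
      + 3 * (constA1 p / meanOffspring p ^ 2) * stemMoment p ρ 2 n ^ 2
      + 6 * (constA2 p / meanOffspring p) * (stemMoment p ρ 2 n * stemMoment p ρ 1 n ^ 2)
      + constA3 p * stemMoment p ρ 1 n ^ 4 := by
  simp only [condMoment, stemMoment, pow_one]
  exact integral_branchAvg_pow_four h rfl (measurable_stemCond n)
    (memLp_four_stemCond h rfl (by omega))

/-! ### Two-sided bounds on the mean conductance -/

/-- Dirichlet's principle for an edge in series with the tree, with trial potential drop `s * ξ`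
across the edge: the conductance is at most `C * (1 - s * ξ) ^ 2 + s ^ 2 * ξ`. As `s` is
deterministic, only the first moment of `C` appears, so the bound needs no prior knowledge of higher
moments. -/
lemma stemMoment_one_le (h : Admissible p ρ) {n : ℕ} (hn : 4 ≤ n) (s : ℝ) :
    stemMoment p ρ 1 n ≤ condMoment p ρ 1 n - 2 * s * (constB1 ρ * condMoment p ρ 1 n)
      + s ^ 2 * (constB1 ρ + constB2 ρ * condMoment p ρ 1 n) := by
  have i1 := integrable_treeCond_pow h (j := 1) (by norm_num) hn
  have i2 := (integrable_mark_pow_mul_treeCond_pow h (i := 1) (j := 1) (by norm_num) (by norm_num)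
    hn).const_mul (2 * s)
  have i3 := (integrable_mark_pow_mul_treeCond_pow h (i := 1) (j := 0) (by norm_num) (by norm_num)
    hn).const_mul (s ^ 2)
  have i4 := (integrable_mark_pow_mul_treeCond_pow h (i := 2) (j := 1) (by norm_num) (by norm_num)
    hn).const_mul (s ^ 2)
  have e2 := integral_mark_pow_mul_treeCond_pow h (i := 1) 1 n (by norm_num)
  have e3 := integral_mark_pow_mul_treeCond_pow h (i := 1) 0 n (by norm_num)
  have e4 := integral_mark_pow_mul_treeCond_pow h (i := 2) 1 n (by norm_num)
  have c0 : condMoment p ρ 0 n = 1 := by simp [condMoment]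
  have i12 : Integrable (fun e => treeCond (meanOffspring p) n e ^ 1
      - 2 * s * (rootMark e ^ 1 * treeCond (meanOffspring p) n e ^ 1)) (envLaw p ρ) := i1.sub i2
  have i123 : Integrable (fun e => treeCond (meanOffspring p) n e ^ 1
      - 2 * s * (rootMark e ^ 1 * treeCond (meanOffspring p) n e ^ 1)
      + s ^ 2 * (rootMark e ^ 1 * treeCond (meanOffspring p) n e ^ 0)) (envLaw p ρ) := i12.add i3
  have key : condMoment p ρ 1 n - 2 * s * (constB1 ρ * condMoment p ρ 1 n)
      + s ^ 2 * (constB1 ρ + constB2 ρ * condMoment p ρ 1 n)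
      = ∫ e, (treeCond (meanOffspring p) n e ^ 1
      - 2 * s * (rootMark e ^ 1 * treeCond (meanOffspring p) n e ^ 1)
      + s ^ 2 * (rootMark e ^ 1 * treeCond (meanOffspring p) n e ^ 0)
      + s ^ 2 * (rootMark e ^ 2 * treeCond (meanOffspring p) n e ^ 1)) ∂(envLaw p ρ) := by
    rw [integral_add i123 i4, integral_add i12 i3, integral_sub i1 i2, integral_const_mul,
      integral_const_mul, integral_const_mul, e2, e3, e4, c0]
    simp only [constB1, constB2, condMoment, pow_one]
    ring
  rw [key]
  refine integral_mono_ae (integrable_stemCond_pow h (by norm_num) hn) (i123.add i4) ?_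
  filter_upwards [ae_conductance_pos h n] with e ⟨h1, h2, h3⟩
  rw [stemCond_eq (by omega)]
  set t := rootMark e
  set u := treeCond (meanOffspring p) n e
  have hd : 0 < 1 + t * u := by positivity
  have : u ^ 1 - 2 * s * (t ^ 1 * u ^ 1) + s ^ 2 * (t ^ 1 * u ^ 0) + s ^ 2 * (t ^ 2 * u ^ 1)
      = (u / (1 + t * u)) ^ 1 + t * (u - s * (1 + t * u)) ^ 2 / (1 + t * u) := by
    field_simp; ring
  rw [this]
  have : 0 ≤ t * (u - s * (1 + t * u)) ^ 2 / (1 + t * u) := by positivity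
  linarith

/-- The energy of the flow to level `n` in proportion to the limiting generation sizes. -/
noncomputable def uniformEnergy (m : ℝ) : ℕ → Env → ℝ
  | 0 => 0
  | n + 1 => branchAvg m fun e => uniformEnergy m n e + rootMark e * growthLimit m e ^ 2

lemma measurable_uniformEnergy (n : ℕ) : Measurable (uniformEnergy m n) := by
  induction n with
  | zero => exact measurable_const
  | succ n ih =>
    exact measurable_branchAvg (ih.add (measurable_rootMark.mul (measurable_growthLimit.pow_const 2)))

lemma integrable_mark_mul_growthLimit_sq (h : Admissible p ρ) (hm : m = meanOffspring p) :
    Integrable (fun e => rootMark e * growthLimit m e ^ 2) (envLaw p ρ) :=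
  integrable_rootMark_mul h hm 1 (φ := fun t => t) (by fun_prop) h.integrable_mark
    (ψ := fun a => a.2 ^ 2) (by fun_prop)
    (integrable_pow_of_memLp (n := 4) (by exact_mod_cast memLp_growthLimit h hm) (by norm_num))

lemma integral_mark_mul_growthLimit_sq (h : Admissible p ρ) (hm : m = meanOffspring p) :
    ∫ e, rootMark e * growthLimit m e ^ 2 ∂(envLaw p ρ) = constC1 p ρ := by
  have h1 := integral_rootMark_mul h hm 1 (φ := fun t => t) (by fun_prop) h.integrable_mark
    (ψ := fun a => a.2 ^ 2) (by fun_prop)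
  dsimp only at h1
  rw [h1, integral_growthLimit_sq h hm, constC1, ← hm, constB1]
  ring

lemma memLp_uniformEnergy (h : Admissible p ρ) (hm : m = meanOffspring p) (n : ℕ) :
    MemLp (uniformEnergy m n) 1 (envLaw p ρ) := by
  induction n with
  | zero => exact MemLp.zero
  | succ n ih =>
    have h1 := memLp_branchAvg (m := m) h (j := 1) ((measurable_uniformEnergy (m := m) n).add
      (measurable_rootMark.mul (measurable_growthLimit (m := m) |>.pow_const 2)))
      (by norm_num) (by norm_num) (by
        exact_mod_cast ih.add (memLp_one_iff_integrable.2 (integrable_mark_mul_growthLimit_sq h hm)))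
    exact_mod_cast h1

/-- Every generation contributes `E[ξ W²] = c₁`. -/
lemma integral_uniformEnergy (h : Admissible p ρ) (hm : m = meanOffspring p) (n : ℕ) :
    ∫ e, uniformEnergy m n e ∂(envLaw p ρ) = n * constC1 p ρ := by
  induction n with
  | zero => simp [uniformEnergy]
  | succ n ih =>
    have h1 := memLp_uniformEnergy h hm n
    have h2 := integrable_mark_mul_growthLimit_sq h hm
    rw [uniformEnergy, integral_branchAvg (G := fun e => uniformEnergy m n e
        + rootMark e * growthLimit m e ^ 2) h hm ((measurable_uniformEnergy (m := m) n).add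
      (measurable_rootMark.mul (measurable_growthLimit (m := m) |>.pow_const 2)))
      (h1.add (memLp_one_iff_integrable.2 h2)),
      integral_add (memLp_one_iff_integrable.1 h1) h2, ih, integral_mark_mul_growthLimit_sq h hm]
    push_cast; ring

/-- The easy half of Thomson's principle for the flow of strength `W`: its energy is at least `W²`
times the resistance, by Cauchy–Schwarz at each vertex. -/
lemma growthLimit_sq_le (h : Admissible p ρ) (hm : m = meanOffspring p) (n : ℕ) :
    ∀ᵐ e ∂(envLaw p ρ), growthLimit m e ^ 2
      ≤ stemCond m n e * (uniformEnergy m n e + rootMark e * growthLimit m e ^ 2) := by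
  have hm0 : 0 < m := hm ▸ zero_lt_one.trans h.one_lt_mean
  induction n with
  | zero =>
    filter_upwards [ae_isRegular h] with e he
    have := he.rootMark_pos
    have h2 : (rootMark e)⁻¹ * (rootMark e * growthLimit m e ^ 2) = growthLimit m e ^ 2 := by
      field_simp
    simp [stemCond, uniformEnergy, h2]
  | succ n ih =>
    filter_upwards [ae_forall_shift ih, growthLimit_fixed h hm, ae_isRegular h] with e h1 h2 h3
    have hC := treeCond_pos hm0 (n + 1) h3
    have hξ := h3.rootMark_pos
    have key : growthLimit m e ^ 2 ≤ treeCond m (n + 1) e * uniformEnergy m (n + 1) e := by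
      rw [← h2, treeCond_succ, uniformEnergy]
      simp only [branchAvg]
      -- Cauchy–Schwarz over the children, each satisfying the inequality of the previous level;
      -- both averages carry `m⁻¹`, hence the factor `(m⁻¹) ^ 2` below.
      have hcs := Finset.sum_sq_le_sum_mul_sum_of_sq_le_mul (Finset.range (e []).1)
        (r := fun i => growthLimit m (shift i e)) (f := fun i => stemCond m n (shift i e))
        (g := fun i => uniformEnergy m n (shift i e)
          + rootMark (shift i e) * growthLimit m (shift i e) ^ 2)
        (fun i _ => (stemCond_pos hm0 n (h3.shift i)).le)
        (fun i _ => by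
          have := (sq_nonneg _).trans (h1 i)
          exact nonneg_of_mul_nonneg_right this (stemCond_pos hm0 n (h3.shift i)))
        (fun i _ => h1 i)
      have hm2 : 0 ≤ (m⁻¹) ^ 2 := by positivity
      have := mul_le_mul_of_nonneg_left hcs hm2
      nlinarith
    rw [stemCond_succ, div_mul_eq_mul_div, le_div_iff₀ (by positivity)]
    nlinarith

lemma growthLimit_sq_le_treeCond (h : Admissible p ρ) (hm : m = meanOffspring p) {n : ℕ}
    (hn : n ≠ 0) : ∀ᵐ e ∂(envLaw p ρ), growthLimit m e ^ 2
      ≤ treeCond m n e * uniformEnergy m n e := by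
  have hm0 : 0 < m := hm ▸ zero_lt_one.trans h.one_lt_mean
  filter_upwards [growthLimit_sq_le h hm n, ae_isRegular h] with e h1 h3
  have hC := treeCond_pos hm0 n h3
  have hξ := h3.rootMark_pos
  rw [stemCond_eq hn, div_mul_eq_mul_div, le_div_iff₀ (by positivity)] at h1
  nlinarith

/-- If `G` is the energy of the flow `W`, then `W² ≤ C G` gives `C ≥ 2 t W - t² G` for each `t > 0`,
a linearized Cauchy–Schwarz inequality that needs only `E[W] = 1` and `E[G] = c₁ n`. The chosen `t`
is the optimal one. -/
lemma inv_le_condMoment_one (h : Admissible p ρ) {n : ℕ} (hn : 4 ≤ n) :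
    1 / (n * constC1 p ρ) ≤ condMoment p ρ 1 n := by
  have hc := h.constC1_pos
  have hn0 : (0 : ℝ) < n := by exact_mod_cast (by omega : 0 < n)
  set t := 1 / (n * constC1 p ρ) with ht
  have ht0 : 0 < t := by positivity
  have hW := (memLp_growthLimit h rfl).integrable (by norm_num)
  have hG := memLp_one_iff_integrable.1 (memLp_uniformEnergy h rfl n)
  have hC := integrable_treeCond_pow h (j := 1) (by norm_num) hn
  have hle : ∫ e, (2 * t * growthLimit (meanOffspring p) e
      - t ^ 2 * uniformEnergy (meanOffspring p) n e) ∂(envLaw p ρ) ≤ condMoment p ρ 1 n := by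
    refine integral_mono_ae ((hW.const_mul _).sub (hG.const_mul _)) hC ?_
    filter_upwards [growthLimit_sq_le_treeCond h rfl (by omega : n ≠ 0), ae_conductance_pos h n]
      with e h1 ⟨h2, h3, h4⟩
    rw [pow_one]
    set u := treeCond (meanOffspring p) n e
    set w := growthLimit (meanOffspring p) e
    set g := uniformEnergy (meanOffspring p) n e
    have hg : 0 ≤ g := nonneg_of_mul_nonneg_right ((sq_nonneg _).trans h1) h3
    have h5 : 2 * t * w ≤ u + t ^ 2 * g := by
      refine abs_le_of_sq_le_sq' ?_ (by positivity) |>.2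
      nlinarith [sq_nonneg (u - t ^ 2 * g), mul_le_mul_of_nonneg_left h1 (sq_nonneg t)]
    linarith
  rw [integral_sub (hW.const_mul _) (hG.const_mul _), integral_const_mul, integral_const_mul,
    integral_growthLimit h rfl, integral_uniformEnergy h rfl] at hle
  have : 2 * t * 1 - t ^ 2 * (n * constC1 p ρ) = t := by
    rw [ht]; field_simp; ring
  linarith

end GWNetwork

/-! ### Deterministic asymptotics of the moment recursion. -/

namespace GWNetwork

/-! ### Asymptotic analysis of the moment recursion -/

lemma isBigO_of_sub_eq {f g k : ℕ → ℝ} (h : ∀ᶠ n in atTop, f n = k n) (hk : k =O[atTop] g) :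
    f =O[atTop] g := hk.congr' (h.mono fun _ hn => hn.symm) .rfl

/-- If the moments of orders 2 to 4 are comparable with powers of the first one, then the
recursion for the reciprocal of the first moment follows. -/
lemma reciprocal_recursion {m a₁ a₂ b₁ b₂ κ c₁ c₂ c₃ c₄ : ℝ} {x y z w s₂ s₃ : ℕ → ℝ} (hm : 1 < m)
    (hc₁ : c₁ ≠ 0) (hκ : κ = a₁ / (1 - m⁻¹)) (hc₁κ : c₁ = b₁ * κ)
    (hc₂ : c₂ = (1 - (m ^ 2)⁻¹)⁻¹ * (3 * a₁ ^ 2 / (m - 1) + a₂))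
    (hc₃ : c₃ = 2 * a₁ * c₁ / (m - 1) - 2 * b₁ * c₂ / m)
    (hc₄ : c₄ = b₁ / (1 - m⁻¹) * (c₃ / c₁ + a₁) - b₂ * (c₂ / c₁))
    (hx : ∀ᶠ n in atTop, 0 < x n) (hx0 : Tendsto x atTop (𝓝 0))
    (hy : y =O[atTop] fun n => x n ^ 2) (hz : z =O[atTop] fun n => x n ^ 3)
    (hw : w =O[atTop] fun n => x n ^ 4)
    (hx' : (fun n => x (n + 1) - (x n - b₁ * y n + b₂ * z n)) =O[atTop] w)
    (hs₂ : (fun n => s₂ n - (y n - 2 * b₁ * z n)) =O[atTop] w)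
    (hs₃ : (fun n => s₃ n - z n) =O[atTop] w)
    (hy' : ∀ᶠ n in atTop, y (n + 1) = m⁻¹ * s₂ n + a₁ * x (n + 1) ^ 2)
    (hz' : ∀ᶠ n in atTop, z (n + 1) = (m ^ 2)⁻¹ * s₃ n + 3 * (a₁ / m) * (s₂ n * x (n + 1))
      + a₂ * x (n + 1) ^ 3) :
    (fun n => x (n + 1) - x n) =O[atTop] (fun n => x n ^ 2) ∧
    Tendsto (fun n => x n / x (n + 1)) atTop (𝓝 1) ∧
    (fun n => (x (n + 1))⁻¹ - (x n)⁻¹ - c₁ - c₁ * c₄ * x n) =O[atTop] fun n => x n ^ 2 := by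
  have hm0 : m ≠ 0 := by positivity
  have hm1 : m - 1 ≠ 0 := by linarith
  have hm2 : m ^ 2 - 1 ≠ 0 := by nlinarith
  have hx1 : x =O[atTop] fun _ => (1 : ℝ) := hx0.isBigO_one ℝ
  have pw : ∀ j k : ℕ, k ≤ j → (fun n => x n ^ j) =O[atTop] fun n => x n ^ k := fun j k hk => by
    have : (fun n => x n ^ j) = fun n => x n ^ k * x n ^ (j - k) := by
      ext n; rw [← pow_add]; congr 1; omega
    rw [this]
    simpa using (isBigO_refl (fun n => x n ^ k) atTop).mul (hx1.pow (j - k))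
  have hx_self : x =O[atTop] fun n => x n ^ 1 := by simpa using isBigO_refl x atTop
  replace hx' := hx'.trans hw
  replace hs₂ := hs₂.trans hw
  replace hs₃ := hs₃.trans hw
  -- increments of `x`
  have d1 : (fun n => x (n + 1) - x n) =O[atTop] fun n => x n ^ 2 := by
    have h := ((hx'.trans (pw 4 2 (by norm_num))).add (hy.const_mul_left (-b₁))).add
      ((hz.trans (pw 3 2 (by norm_num))).const_mul_left b₂)
    exact isBigO_of_sub_eq (.of_forall fun n => by ring) h
  have hxs : (fun n => x (n + 1)) =O[atTop] fun n => x n ^ 1 := by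
    have h := (d1.trans (pw 2 1 (by norm_num))).add hx_self
    exact isBigO_of_sub_eq (.of_forall fun n => by ring) h
  have hratio' : Tendsto (fun n => x (n + 1) / x n) atTop (𝓝 1) := by
    have h1 : (fun n => (x (n + 1) - x n) * (x n)⁻¹) =O[atTop] fun n => x n ^ 2 * (x n)⁻¹ :=
      d1.mul (isBigO_refl _ _)
    have h2 : (fun n => x n ^ 2 * (x n)⁻¹) =ᶠ[atTop] x := by
      filter_upwards [hx] with n hn
      field_simp
    have h3 := ((h1.trans_eventuallyEq h2).trans_tendsto hx0).const_add 1
    rw [add_zero] at h3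
    refine h3.congr' ?_
    filter_upwards [hx] with n hn
    field_simp; ring
  have hratio : Tendsto (fun n => x n / x (n + 1)) atTop (𝓝 1) := by
    have := hratio'.inv₀ one_ne_zero
    simpa using this
  have hgp : ∀ k : ℕ, Tendsto (fun n => x n ^ k / x (n + 1) ^ k) atTop (𝓝 1) := fun k => by
    have := hratio.pow k
    simpa [div_pow] using this
  have hpos : ∀ k : ℕ, ∀ᶠ n in atTop, 0 < x n ^ k := fun k => hx.mono fun n hn => pow_pos hn k
  have hminv0 : 0 ≤ m⁻¹ := by positivity
  have hminv1 : m⁻¹ < 1 := inv_lt_one_of_one_lt₀ hm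
  -- differences of powers
  have dsq : (fun n => x (n + 1) ^ 2 - x n ^ 2) =O[atTop] fun n => x n ^ 3 := by
    have h := d1.mul (hxs.add hx_self)
    exact (isBigO_of_sub_eq (.of_forall fun n => by ring) h).congr_right fun n => by ring
  have dcube : (fun n => x (n + 1) ^ 3 - x n ^ 3) =O[atTop] fun n => x n ^ 4 := by
    have h1 : (fun n => x (n + 1) ^ 2 + x (n + 1) * x n + x n ^ 2) =O[atTop] fun n => x n ^ 2 := by
      have h2 := ((hxs.mul hxs).add (hxs.mul hx_self)).add (hx_self.mul hx_self)
      exact (isBigO_of_sub_eq (.of_forall fun n => by ring) h2).congr_right fun n => by ring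
    have h := d1.mul h1
    exact (isBigO_of_sub_eq (.of_forall fun n => by ring) h).congr_right fun n => by ring
  have hs₂y : (fun n => s₂ n - y n) =O[atTop] fun n => x n ^ 3 := by
    have h := (hs₂.trans (pw 4 3 (by norm_num))).add (hz.const_mul_left (-2 * b₁))
    exact isBigO_of_sub_eq (.of_forall fun n => by ring) h
  -- first order expansion of `y`
  have hu : (fun n => y n - κ * x n ^ 2) =O[atTop] fun n => x n ^ 3 := by
    -- `κ` solves `κ = m⁻¹ * κ + a₁`, so the terms of order `x ^ 2` cancel and what remains
    -- contracts by `m⁻¹` up to `O(x ^ 3)`.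
    refine isBigO_of_contraction hminv0 hminv1 (hpos 3) (hgp 3) ?_
    have h := (hs₂y.const_mul_left m⁻¹).add (dsq.const_mul_left (-(κ * m⁻¹)))
    refine isBigO_of_sub_eq ?_ h
    filter_upwards [hy'] with n hn
    rw [hn, hκ]
    have : 1 - m⁻¹ ≠ 0 := by linarith
    field_simp
    ring
  have d2 : (fun n => x (n + 1) - x n + c₁ * x n ^ 2) =O[atTop] fun n => x n ^ 3 := by
    have h := ((hx'.trans (pw 4 3 (by norm_num))).add (hu.const_mul_left (-b₁))).add
      (hz.const_mul_left b₂)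
    exact isBigO_of_sub_eq (.of_forall fun n => by rw [hc₁κ]; ring) h
  -- first order expansion of `z`
  have hc₂' : 3 * (a₁ / m) * κ + a₂ - c₂ + (m ^ 2)⁻¹ * c₂ = 0 := by
    have h1 : c₂ * (1 - (m ^ 2)⁻¹) = 3 * a₁ ^ 2 / (m - 1) + a₂ := by
      have : 1 - (m ^ 2)⁻¹ ≠ 0 := by
        have : 1 - (m ^ 2)⁻¹ = (m ^ 2 - 1) / m ^ 2 := by field_simp
        rw [this]; positivity
      rw [hc₂]; field_simp
    have h2 : 3 * (a₁ / m) * κ = 3 * a₁ ^ 2 / (m - 1) := by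
      rw [hκ]; have : 1 - m⁻¹ = (m - 1) / m := by field_simp
      rw [this]; field_simp
    linarith
  have hv : (fun n => z n - c₂ * x n ^ 3) =O[atTop] fun n => x n ^ 4 := by
    refine isBigO_of_contraction (θ := (m ^ 2)⁻¹) (by positivity)
      (inv_lt_one_of_one_lt₀ (one_lt_pow₀ hm (by norm_num))) (hpos 4) (hgp 4) ?_
    have h1 : (fun n => (s₂ n - y n + (y n - κ * x n ^ 2)) * x (n + 1))
        =O[atTop] fun n => x n ^ 4 := ((hs₂y.add hu).mul hxs).congr_right fun n => by ring
    have h2 : (fun n => x n ^ 2 * (x (n + 1) - x n)) =O[atTop] fun n => x n ^ 4 :=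
      ((isBigO_refl (fun n => x n ^ 2) atTop).mul d1).congr_right fun n => by ring
    have h := (((hs₃.const_mul_left (m ^ 2)⁻¹).add (h1.const_mul_left (3 * (a₁ / m)))).add
      (h2.const_mul_left (3 * (a₁ / m) * κ))).add (dcube.const_mul_left (a₂ - c₂))
    refine isBigO_of_sub_eq ?_ h
    filter_upwards [hz'] with n hn
    rw [hn]
    linear_combination x n ^ 3 * hc₂'
  -- second order expansion of `y`
  set γ := c₃ / (1 - m⁻¹) with hγ
  have dsq2 : (fun n => x (n + 1) ^ 2 - x n ^ 2 + 2 * c₁ * x n ^ 3) =O[atTop]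
      fun n => x n ^ 4 := by
    have h1 := (d2.mul (hxs.add hx_self)).congr_right
      (g₂ := fun n => x n ^ 4) fun n => by ring
    have h2 := ((isBigO_refl (fun n => x n ^ 2) atTop).mul d1).congr_right
      (g₂ := fun n => x n ^ 4) fun n => by ring
    have h := h1.add (h2.const_mul_left (-c₁))
    refine isBigO_of_sub_eq (.of_forall fun n => by ring) h
  -- The fixed-point equation for the coefficient `γ` of `x ^ 3` in the second moment. The term with
  -- `2 * c₁` comes from the change of `x ^ 2` over one step, the one with `c₂` from the damping.
  have hγ' : m⁻¹ * (-2 * b₁ * c₂) + κ * m⁻¹ * (2 * c₁) - γ + m⁻¹ * γ = 0 := by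
    have h1 : γ * (1 - m⁻¹) = c₃ := by
      have : 1 - m⁻¹ ≠ 0 := by linarith
      rw [hγ]; field_simp
    have h2 : κ * m⁻¹ = a₁ / (m - 1) := by
      rw [hκ]; have : 1 - m⁻¹ = (m - 1) / m := by field_simp
      rw [this]; field_simp
    have h3 : c₃ = a₁ / (m - 1) * (2 * c₁) + m⁻¹ * (-2 * b₁ * c₂) := by
      rw [hc₃]; field_simp; ring
    rw [h2]; linarith
  have hu2 : (fun n => y n - κ * x n ^ 2 - γ * x n ^ 3) =O[atTop] fun n => x n ^ 4 := by
    refine isBigO_of_contraction hminv0 hminv1 (hpos 4) (hgp 4) ?_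
    have h := (((hs₂.const_mul_left m⁻¹).add (hv.const_mul_left (-2 * b₁ * m⁻¹))).add
      (dsq2.const_mul_left (-(κ * m⁻¹)))).add (dcube.const_mul_left (-γ))
    refine isBigO_of_sub_eq ?_ h
    filter_upwards [hy'] with n hn
    have hk : κ * (1 - m⁻¹) = a₁ := by
      have : 1 - m⁻¹ ≠ 0 := by linarith
      rw [hκ]; field_simp
    rw [hn]
    linear_combination x n ^ 3 * hγ' - x (n + 1) ^ 2 * hk
  -- third order expansion of `x`
  have d3 : (fun n => x (n + 1) - x n + c₁ * x n ^ 2 + (b₁ * γ - b₂ * c₂) * x n ^ 3)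
      =O[atTop] fun n => x n ^ 4 := by
    have h := (hx'.add (hu2.const_mul_left (-b₁))).add (hv.const_mul_left b₂)
    exact isBigO_of_sub_eq (.of_forall fun n => by rw [hc₁κ]; ring) h
  refine ⟨d1, hratio, ?_⟩
  -- Passing to reciprocals adds `c₁ ^ 2` to the cubic coefficient of `x`; this equation is what
  -- determines `c₄`.
  have hc₄' : b₁ * γ - b₂ * c₂ + c₁ ^ 2 - c₁ * c₄ = 0 := by
    have h1 : c₁ * c₄ = b₁ / (1 - m⁻¹) * (c₃ + a₁ * c₁) - b₂ * c₂ := by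
      rw [hc₄]; field_simp
    have h2 : b₁ / (1 - m⁻¹) * (a₁ * c₁) = c₁ ^ 2 := by
      rw [sq]; nth_rewrite 2 [hc₁κ]; rw [hκ]; ring
    have h3 : b₁ * γ = b₁ / (1 - m⁻¹) * c₃ := by rw [hγ]; ring
    rw [h1, h3, mul_add, h2]; ring
  -- The claim multiplied by `x n * x (n + 1)`; dividing `O(x ^ 4)` by this product leaves `O(x ^
  -- 2)`.
  have hnum : (fun n => x n - x (n + 1) - c₁ * (x n * x (n + 1))
      - c₁ * c₄ * (x n ^ 2 * x (n + 1))) =O[atTop] fun n => x n ^ 4 := by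
    have h1 := ((isBigO_refl x atTop).mul d2).congr_right
      (g₂ := fun n => x n ^ 4) fun n => by ring
    have h2 := ((isBigO_refl (fun n => x n ^ 2) atTop).mul d1).congr_right
      (g₂ := fun n => x n ^ 4) fun n => by ring
    have h := ((d3.const_mul_left (-1)).add (h1.const_mul_left (-c₁))).add
      (h2.const_mul_left (-(c₁ * c₄)))
    refine isBigO_of_sub_eq (.of_forall fun n => ?_) h
    linear_combination x n ^ 3 * hc₄'
  have hinv : (fun n => (x (n + 1))⁻¹) =O[atTop] fun n => (x n)⁻¹ := by
    have h1 : (fun n => x n / x (n + 1) * (x n)⁻¹) =O[atTop] fun n => 1 * (x n)⁻¹ :=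
      (hratio.isBigO_one ℝ).mul (isBigO_refl _ _)
    simp only [one_mul] at h1
    refine isBigO_of_sub_eq ?_ h1
    filter_upwards [hx] with n hn
    field_simp
  have hfin := (hnum.mul ((isBigO_refl (fun n => (x n)⁻¹) atTop).mul hinv))
  refine (isBigO_of_sub_eq ?_ hfin).trans_eventuallyEq ?_
  · filter_upwards [hx, (tendsto_add_atTop_nat 1).eventually hx] with n h1 h2
    field_simp
  · filter_upwards [hx] with n h1
    field_simp

/-- Since `1 / n ≤ 2 * (log (n + 1) - log n)`, the increments are dominated by a telescoping
multiple of the logarithm. -/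
lemma isBigO_log_of_increments {u : ℕ → ℝ}
    (h : (fun n => u (n + 1) - u n) =O[atTop] fun n : ℕ => (n : ℝ)⁻¹) :
    u =O[atTop] fun n : ℕ => Real.log n := by
  obtain ⟨K, hK0, hK⟩ := h.exists_pos
  obtain ⟨N, hN⟩ := eventually_atTop.1 (hK.bound.and (eventually_ge_atTop 1))
  have hN1 : 1 ≤ N := (hN N le_rfl).2
  have hstep : ∀ n ≥ N, |u n| ≤ |u N| + 2 * K * (Real.log n - Real.log N) := by
    intro n hn
    induction n, hn using Nat.le_induction with
    | base => simp
    | succ n hn ih =>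
      have hn0 : (1 : ℝ) ≤ n := by exact_mod_cast hN1.trans hn
      have h1 := (hN n hn).1
      rw [Real.norm_eq_abs, norm_inv, Real.norm_natCast] at h1
      have h2 : (n : ℝ)⁻¹ ≤ 2 * (Real.log (n + 1 : ℕ) - Real.log n) := by
        have h3 : Real.log ((n : ℝ) / (n + 1 : ℕ)) ≤ (n : ℝ) / (n + 1 : ℕ) - 1 :=
          Real.log_le_sub_one_of_pos (by positivity)
        rw [Real.log_div (by positivity) (by positivity)] at h3
        have h4 : (n : ℝ)⁻¹ ≤ 2 * (1 - (n : ℝ) / (n + 1 : ℕ)) := by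
          push_cast
          have : 2 * (1 - (n : ℝ) / (n + 1)) = 2 / (n + 1) := by field_simp; ring
          rw [this, inv_eq_one_div, div_le_div_iff₀ (by positivity) (by positivity)]
          linarith
        linarith
      have h5 : |u (n + 1)| ≤ |u n| + |u (n + 1) - u n| := by
        have := abs_add_le (u n) (u (n + 1) - u n); simpa using this
      have h6 := mul_le_mul_of_nonneg_left h2 hK0.le
      linarith
  have hlog : Tendsto (fun n : ℕ => Real.log n) atTop atTop :=
    Real.tendsto_log_atTop.comp tendsto_natCast_atTop_atTop
  refine IsBigO.of_bound (|u N| + 2 * K) ?_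
  filter_upwards [eventually_ge_atTop N, hlog.eventually_ge_atTop 1] with n hn hl
  have h1 := hstep n hn
  have h2 : 0 ≤ Real.log N := Real.log_natCast_nonneg N
  rw [Real.norm_eq_abs, Real.norm_eq_abs, abs_of_nonneg (by linarith : (0 : ℝ) ≤ Real.log n)]
  nlinarith [abs_nonneg (u N)]

/-- A sequence with increments `O(log n / n²)` converges at rate `log n / n`. -/
lemma exists_limit_of_increments {u : ℕ → ℝ}
    (h : (fun n => u (n + 1) - u n) =O[atTop] fun n : ℕ => Real.log n / (n : ℝ) ^ 2) :
    ∃ c : ℝ, (fun n => u n - c) =O[atTop] fun n : ℕ => Real.log n / (n : ℝ) := by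
  obtain ⟨K, hK0, hK⟩ := h.exists_pos
  -- A telescoping majorant: `t n - t (n + 1)` dominates `K * log n / n ^ 2`. The summand 2
  -- compensates for `n * (log (n + 1) - log n) ≤ 1`, and is absorbed at the end by `2 ≤ log n`.
  set t : ℕ → ℝ := fun n => 2 * K * ((Real.log n + 2) / n) with ht
  have hlog : Tendsto (fun n : ℕ => Real.log n) atTop atTop :=
    Real.tendsto_log_atTop.comp tendsto_natCast_atTop_atTop
  obtain ⟨N, hN⟩ := eventually_atTop.1
    (hK.bound.and ((eventually_ge_atTop 1).and (hlog.eventually_ge_atTop 2)))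
  have hstep : ∀ n ≥ N, |u (n + 1) - u n| ≤ t n - t (n + 1) := by
    intro n hn
    obtain ⟨h1, h2, h3⟩ := hN n hn
    have hn0 : (1 : ℝ) ≤ n := by exact_mod_cast h2
    rw [Real.norm_eq_abs, Real.norm_eq_abs,
      abs_of_nonneg (div_nonneg (Real.log_natCast_nonneg n) (by positivity))] at h1
    refine h1.trans ?_
    have h4 : Real.log (n + 1 : ℕ) - Real.log n ≤ 1 / n := by
      have := Real.log_le_sub_one_of_pos (x := ((n + 1 : ℕ) : ℝ) / n) (by positivity)
      rw [Real.log_div (by positivity) (by positivity)] at this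
      refine this.trans (le_of_eq ?_)
      push_cast; field_simp; ring
    have h5 : (n : ℝ) * Real.log (n + 1 : ℕ) ≤ n * Real.log n + 1 := by
      have := mul_le_mul_of_nonneg_left h4 (by positivity : (0 : ℝ) ≤ n)
      rw [mul_one_div_cancel (by positivity)] at this
      linarith
    have h6 : t n - t (n + 1)
        = 2 * K * ((Real.log n + 2 + (n * Real.log n - n * Real.log (n + 1 : ℕ)))
          / (n * (n + 1))) := by
      simp only [ht]; push_cast; field_simp; ring
    rw [h6]
    have h7 : Real.log n / (n : ℝ) ^ 2 ≤ 2 * ((Real.log n + 1) / (n * (n + 1))) := by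
      rw [← mul_div_assoc, div_le_div_iff₀ (by positivity) (by positivity)]
      nlinarith [mul_nonneg (by linarith : (0:ℝ) ≤ Real.log n) (by linarith : (0:ℝ) ≤ (n:ℝ) - 1),
        mul_pos (by linarith : (0:ℝ) < n) (by linarith : (0:ℝ) < n)]
    have h8 : (Real.log n + 1) / (n * (n + 1))
        ≤ (Real.log n + 2 + (n * Real.log n - n * Real.log (n + 1 : ℕ))) / (n * (n + 1) : ℝ) :=
      div_le_div_of_nonneg_right (by linarith) (by positivity)
    calc K * (Real.log n / (n : ℝ) ^ 2) ≤ K * (2 * ((Real.log n + 1) / (n * (n + 1)))) := by gcongr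
      _ = 2 * K * ((Real.log n + 1) / (n * (n + 1))) := by ring
      _ ≤ _ := by gcongr
  have ht0 : Tendsto t atTop (𝓝 0) := by
    have h1 : Tendsto (fun n : ℕ => Real.log n / n) atTop (𝓝 0) :=
      (Real.isLittleO_log_id_atTop.tendsto_div_nhds_zero).comp tendsto_natCast_atTop_atTop
    have h2 : Tendsto (fun n : ℕ => (2 : ℝ) / n) atTop (𝓝 0) :=
      tendsto_const_div_atTop_nhds_zero_nat 2
    have h3 := (h1.add h2).const_mul (2 * K)
    simp only [add_zero, mul_zero] at h3
    refine h3.congr fun n => ?_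
    simp only [ht]; ring
  have htel : ∀ n ≥ N, ∀ k, |u (n + k) - u n| ≤ t n - t (n + k) := by
    intro n hn k
    induction k with
    | zero => simp
    | succ k ih =>
      have h1 := hstep (n + k) (by omega)
      have h2 : |u (n + (k + 1)) - u n| ≤ |u (n + k + 1) - u (n + k)| + |u (n + k) - u n| := by
        have := abs_add_le (u (n + k + 1) - u (n + k)) (u (n + k) - u n)
        simpa [add_assoc] using this
      rw [← add_assoc] at h2 ⊢
      linarith
  have ht_nonneg : ∀ n : ℕ, 0 ≤ t n := fun n => by
    have := Real.log_natCast_nonneg n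
    positivity
  have hcauchy : CauchySeq fun n => u (n + N) := by
    refine cauchySeq_of_le_tendsto_0' (fun n => t (n + N)) ?_ ((tendsto_add_atTop_iff_nat N).2 ht0)
    intro n k hnk
    obtain ⟨j, rfl⟩ := Nat.exists_eq_add_of_le hnk
    rw [dist_comm, Real.dist_eq]
    have h1 := htel (n + N) (by omega) j
    have h2 := ht_nonneg (n + N + j)
    rw [show n + j + N = n + N + j by omega]
    linarith
  obtain ⟨c, hc'⟩ := cauchySeq_tendsto_of_complete hcauchy
  have hc : Tendsto u atTop (𝓝 c) := (tendsto_add_atTop_iff_nat N).1 hc'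
  refine ⟨c, IsBigO.of_bound (4 * K) ?_⟩
  filter_upwards [eventually_ge_atTop N] with n hn
  obtain ⟨-, h2, h3⟩ := hN n hn
  have hn0 : (1 : ℝ) ≤ n := by exact_mod_cast h2
  have h4 : |c - u n| ≤ t n := by
    have hlim : Tendsto (fun k => |u (n + k) - u n|) atTop (𝓝 |c - u n|) := by
      have := (hc.comp (tendsto_add_atTop_nat n)).sub_const (u n)
      refine (this.abs).congr fun k => ?_
      simp [add_comm]
    refine le_of_tendsto' hlim fun k => ?_
    have := htel n hn k
    have := ht_nonneg (n + k)
    linarith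
  rw [Real.norm_eq_abs, abs_sub_comm, Real.norm_eq_abs,
    abs_of_nonneg (div_nonneg (Real.log_natCast_nonneg n) (by positivity))]
  refine h4.trans ?_
  simp only [ht]
  have : (Real.log n + 2) / (n : ℝ) ≤ (2 * Real.log n) / n := by gcongr; linarith
  calc _ ≤ 2 * K * ((2 * Real.log n) / n) := by gcongr
    _ = _ := by ring

/-- Expansion of a positive sequence whose reciprocal has increments `c₁ + c₁ c₄ x + O(x²)`. -/
lemma reciprocal_expansion {c₁ c₄ : ℝ} {x : ℕ → ℝ} (hc₁ : 0 < c₁) (hx : ∀ᶠ n in atTop, 0 < x n)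
    (hxO : x =O[atTop] fun n : ℕ => (n : ℝ)⁻¹)
    (hrec : (fun n => (x (n + 1))⁻¹ - (x n)⁻¹ - c₁ - c₁ * c₄ * x n) =O[atTop] fun n => x n ^ 2) :
    ∃ c₀ : ℝ, (fun n : ℕ => (x n)⁻¹ - c₁ * n - c₄ * Real.log n - c₀)
        =O[atTop] (fun n : ℕ => Real.log n / (n : ℝ)) ∧
      (fun n : ℕ => x n - (1 / (c₁ * n) - c₄ / c₁ ^ 2 * (Real.log n / (n : ℝ) ^ 2)
              - c₀ / c₁ ^ 2 * (1 / (n : ℝ) ^ 2)))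
        =O[atTop] fun n : ℕ => Real.log n ^ 2 / (n : ℝ) ^ 3 := by
  have hlog : Tendsto (fun n : ℕ => Real.log n) atTop atTop :=
    Real.tendsto_log_atTop.comp tendsto_natCast_atTop_atTop
  have hone : (fun _ : ℕ => (1 : ℝ)) =O[atTop] fun n : ℕ => Real.log n := by
    refine IsBigO.of_bound 1 ?_
    filter_upwards [hlog.eventually_ge_atTop 1] with n hn
    rw [Real.norm_eq_abs, Real.norm_eq_abs, abs_of_nonneg (Real.log_natCast_nonneg n)]
    simpa using hn
  have hinv : Tendsto (fun n : ℕ => (n : ℝ)⁻¹) atTop (𝓝 0) := tendsto_inv_atTop_nhds_zero_nat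
  have hinv1 : (fun n : ℕ => (n : ℝ)⁻¹) =O[atTop] fun _ => (1 : ℝ) := hinv.isBigO_one ℝ
  have hrec2 := hrec.trans (hxO.pow 2)
  -- first order
  have hE : (fun n : ℕ => (x n)⁻¹ - c₁ * n) =O[atTop] fun n : ℕ => Real.log n := by
    refine isBigO_log_of_increments ?_
    have h1 : (fun n : ℕ => ((n : ℝ)⁻¹) ^ 2) =O[atTop] fun n : ℕ => (n : ℝ)⁻¹ := by
      have := (isBigO_refl (fun n : ℕ => (n : ℝ)⁻¹) atTop).mul hinv1
      exact this.congr (fun n => by ring) (fun n => by ring)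
    have h := (hrec2.trans h1).add (hxO.const_mul_left (c₁ * c₄))
    refine isBigO_of_sub_eq (.of_forall fun n => ?_) h
    push_cast; ring
  -- With `E` denoting `1 / x - c₁ * n`, the difference equals `-E * x / (c₁ * n)`.
  have hx1 : (fun n : ℕ => x n - (c₁ * n)⁻¹) =O[atTop] fun n : ℕ => Real.log n / (n : ℝ) ^ 2 := by
    have h := ((hE.mul hxO).mul (isBigO_refl (fun n : ℕ => (n : ℝ)⁻¹) atTop)).const_mul_left
      (-c₁⁻¹)
    refine (isBigO_of_sub_eq ?_ h).congr_right fun n => by ring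
    filter_upwards [hx, eventually_ge_atTop 1] with n h1 h2
    have : (0 : ℝ) < n := by exact_mod_cast h2
    field_simp; ring
  have hlog1 : (fun n : ℕ => (n : ℝ)⁻¹ - (Real.log (n + 1 : ℕ) - Real.log n))
      =O[atTop] fun n : ℕ => ((n : ℝ)⁻¹) ^ 2 := by
    refine IsBigO.of_bound 1 ?_
    filter_upwards [eventually_ge_atTop 1] with n h2
    have hn : (1 : ℝ) ≤ n := by exact_mod_cast h2
    have h3 : Real.log (n + 1 : ℕ) - Real.log n ≤ (n : ℝ)⁻¹ := by
      have := Real.log_le_sub_one_of_pos (x := ((n + 1 : ℕ) : ℝ) / n) (by positivity)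
      rw [Real.log_div (by positivity) (by positivity)] at this
      refine this.trans (le_of_eq ?_)
      push_cast; field_simp; ring
    have h4 : Real.log n - Real.log (n + 1 : ℕ) ≤ -(1 / ((n : ℝ) + 1)) := by
      have := Real.log_le_sub_one_of_pos (x := (n : ℝ) / (n + 1 : ℕ)) (by positivity)
      rw [Real.log_div (by positivity) (by positivity)] at this
      refine this.trans (le_of_eq ?_)
      push_cast; field_simp; ring
    rw [Real.norm_eq_abs, Real.norm_eq_abs, abs_of_nonneg (by linarith),
      abs_of_nonneg (by positivity), one_mul]
    have h5 : (n : ℝ)⁻¹ - 1 / ((n : ℝ) + 1) ≤ ((n : ℝ)⁻¹) ^ 2 := by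
      have : (n : ℝ)⁻¹ - 1 / ((n : ℝ) + 1) = 1 / (n * (n + 1)) := by field_simp; ring
      rw [this, inv_pow, ← one_div]
      gcongr
      nlinarith
    linarith
  have hsq : (fun n : ℕ => ((n : ℝ)⁻¹) ^ 2) =O[atTop] fun n : ℕ => Real.log n / (n : ℝ) ^ 2 := by
    have := hone.mul (isBigO_refl (fun n : ℕ => ((n : ℝ)⁻¹) ^ 2) atTop)
    exact this.congr (fun n => by ring) (fun n => by ring)
  -- The increment is the recursion error plus `c₁ * c₄ * (x n - 1 / (c₁ * n))` plus `c₄ * (1 / n -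
  -- log (n + 1) + log n)`. All three are `O(log n / n ^ 2)`, so the limit `c₀` exists.
  obtain ⟨c₀, hc₀⟩ := exists_limit_of_increments
    (u := fun n : ℕ => (x n)⁻¹ - c₁ * n - c₄ * Real.log n) (by
      have h := ((hrec2.trans hsq).add (hx1.const_mul_left (c₁ * c₄))).add
        ((hlog1.trans hsq).const_mul_left c₄)
      refine isBigO_of_sub_eq ?_ h
      filter_upwards [eventually_ge_atTop 1] with n h2
      have : (0 : ℝ) < n := by exact_mod_cast h2
      push_cast; field_simp; ring)
  refine ⟨c₀, hc₀, ?_⟩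
  have hsq3 : (fun n : ℕ => Real.log n / (n : ℝ) * ((n : ℝ)⁻¹) ^ 2) =O[atTop]
      fun n : ℕ => Real.log n ^ 2 / (n : ℝ) ^ 3 := by
    have := hone.mul (isBigO_refl (fun n : ℕ => Real.log n / (n : ℝ) * ((n : ℝ)⁻¹) ^ 2) atTop)
    exact this.congr (fun n => by ring) (fun n => by ring)
  -- Exact inversion: for `E = 1 / x - c₁ * n` one has `x - 1 / (c₁ * n) + E / (c₁ * n) ^ 2 = E ^ 2
  -- * x / (c₁ * n) ^ 2`. This term determines the order `log ^ 2 / n ^ 3`.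
  have hA2 := (((hE.pow 2).mul hxO).mul
    (isBigO_refl (fun n : ℕ => ((n : ℝ)⁻¹) ^ 2) atTop)).const_mul_left (c₁ ^ 2)⁻¹
  have hA2' := hA2.congr_right (g₂ := fun n : ℕ => Real.log n ^ 2 / (n : ℝ) ^ 3) fun n => by ring
  have hA3 := ((hc₀.mul (isBigO_refl (fun n : ℕ => ((n : ℝ)⁻¹) ^ 2) atTop)).trans
    hsq3).const_mul_left (-(c₁ ^ 2)⁻¹)
  refine isBigO_of_sub_eq ?_ (hA2'.add hA3)
  filter_upwards [hx, eventually_ge_atTop 1] with n h1 h2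
  have : (0 : ℝ) < n := by exact_mod_cast h2
  field_simp; ring

end GWNetwork

/-! ### Orders of the moments and the expansion of the mean conductance. -/

namespace GWNetwork

variable {p : PMF ℕ} {ρ : Measure ℝ} [IsProbabilityMeasure ρ]

/-! ### Asymptotics of the moments of the conductance -/

lemma condMoment_one_pos (h : Admissible p ρ) {n : ℕ} (hn : 4 ≤ n) :
    0 < condMoment p ρ 1 n := by
  have hc := h.constC1_pos
  have hn0 : (0 : ℝ) < n := by exact_mod_cast (by omega : 0 < n)
  exact lt_of_lt_of_le (by positivity) (inv_le_condMoment_one h hn)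

lemma condMoment_one_succ_le (h : Admissible p ρ) {n : ℕ} (hn : 4 ≤ n) :
    condMoment p ρ 1 (n + 1) ≤ condMoment p ρ 1 n := by
  rw [condMoment_one_succ h hn]
  exact stemMoment_le_condMoment h (by norm_num) hn

lemma condMoment_one_le_four (h : Admissible p ρ) {n : ℕ} (hn : 4 ≤ n) :
    condMoment p ρ 1 n ≤ condMoment p ρ 1 4 := by
  induction n, hn using Nat.le_induction with
  | base => rfl
  | succ n hn ih => exact (condMoment_one_succ_le h hn).trans ih

/-- The quadratic decrease `x' ≤ x - κ * x ^ 2` forces `1 / x` to grow by at least `κ` per step. It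
comes from the Dirichlet bound `stemMoment_one_le`, where monotonicity of the mean bounds the
coefficient of `s ^ 2` by a constant `B`. -/
lemma isBigO_condMoment_one (h : Admissible p ρ) :
    condMoment p ρ 1 =O[atTop] fun n : ℕ => (n : ℝ)⁻¹ := by
  have hb1 := h.constB1_pos
  have hb2 := h.constB2_nonneg
  set X := condMoment p ρ 1 4 with hX
  have hX0 : 0 < X := condMoment_one_pos h le_rfl
  set B := constB1 ρ + constB2 ρ * X with hB
  have hB0 : 0 < B := by positivity
  set κ := constB1 ρ ^ 2 / B with hκ
  have hκ0 : 0 < κ := by positivity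
  have hstep : ∀ n : ℕ, 4 ≤ n → condMoment p ρ 1 (n + 1)
      ≤ condMoment p ρ 1 n - κ * condMoment p ρ 1 n ^ 2 := by
    intro n hn
    have hx := condMoment_one_pos h hn
    have hxX := condMoment_one_le_four h hn
    set x := condMoment p ρ 1 n
    rw [condMoment_one_succ h hn]
    -- The minimizer of `-2 * s * b₁ * x + s ^ 2 * B`.
    refine (stemMoment_one_le h hn (constB1 ρ / B * x)).trans ?_
    have h1 : constB2 ρ * x ≤ constB2 ρ * X := mul_le_mul_of_nonneg_left hxX hb2
    have h2 : (constB1 ρ / B * x) ^ 2 * (constB1 ρ + constB2 ρ * x)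
        ≤ (constB1 ρ / B * x) ^ 2 * B := by gcongr; linarith
    have h3 : (constB1 ρ / B * x) ^ 2 * B = κ * x ^ 2 := by rw [hκ]; field_simp
    have h4 : 2 * (constB1 ρ / B * x) * (constB1 ρ * x) = 2 * (κ * x ^ 2) := by
      rw [hκ]; field_simp
    change x - 2 * (constB1 ρ / B * x) * (constB1 ρ * x)
      + (constB1 ρ / B * x) ^ 2 * (constB1 ρ + constB2 ρ * x) ≤ _
    linarith
  have hinv : ∀ n : ℕ, 4 ≤ n → κ * ((n : ℝ) - 4) ≤ (condMoment p ρ 1 n)⁻¹ := by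
    intro n hn
    induction n, hn using Nat.le_induction with
    | base => norm_num; positivity
    | succ n hn ih =>
      have hx := condMoment_one_pos h hn
      have hx' := condMoment_one_pos h (by omega : 4 ≤ n + 1)
      have h1 := hstep n hn
      set x := condMoment p ρ 1 n
      set x' := condMoment p ρ 1 (n + 1)
      have h2 : x⁻¹ + κ ≤ x'⁻¹ := by
        have h3 : x' * (1 + κ * x) ≤ x := by
          have h6 : x' * (1 + κ * x) ≤ (x - κ * x ^ 2) * (1 + κ * x) := by gcongr
          have h5 : 0 ≤ κ ^ 2 * x ^ 3 := by positivity
          nlinarith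
        have h4 : x⁻¹ + κ = (1 + κ * x) / x := by field_simp
        rw [h4, div_le_iff₀ hx, inv_mul_eq_div, le_div_iff₀ hx']
        linarith
      push_cast
      linarith
  refine IsBigO.of_bound (2 / κ) ?_
  -- For `n ≥ 8` the offset is harmless: `n - 4 ≥ n / 2`.
  filter_upwards [eventually_ge_atTop 8] with n hn
  have hx := condMoment_one_pos h (by omega : 4 ≤ n)
  have h1 := hinv n (by omega)
  have hn8 : (8 : ℝ) ≤ n := by exact_mod_cast hn
  rw [Real.norm_eq_abs, abs_of_pos hx, norm_inv, Real.norm_natCast]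
  have h2 : κ * (n / 2) ≤ (condMoment p ρ 1 n)⁻¹ := by
    refine le_trans ?_ h1
    gcongr; linarith
  have h3 := inv_anti₀ (by positivity) h2
  rw [inv_inv] at h3
  refine h3.trans (le_of_eq ?_)
  field_simp

lemma isBigO_inv_condMoment_one (h : Admissible p ρ) :
    (fun n : ℕ => (n : ℝ)⁻¹) =O[atTop] condMoment p ρ 1 := by
  have hc := h.constC1_pos
  refine IsBigO.of_bound (constC1 p ρ) ?_
  filter_upwards [eventually_ge_atTop 4] with n hn
  have hx := condMoment_one_pos h hn
  have h1 := inv_le_condMoment_one h hn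
  rw [Real.norm_eq_abs, Real.norm_eq_abs, abs_of_pos hx, abs_of_nonneg (by positivity)]
  calc (n : ℝ)⁻¹ = constC1 p ρ * (1 / (n * constC1 p ρ)) := by field_simp
    _ ≤ _ := by gcongr

lemma tendsto_condMoment_one (h : Admissible p ρ) :
    Tendsto (condMoment p ρ 1) atTop (𝓝 0) :=
  (isBigO_condMoment_one h).trans_tendsto tendsto_inv_atTop_nhds_zero_nat

lemma tendsto_inv_pow_ratio (k : ℕ) :
    Tendsto (fun n : ℕ => ((n : ℝ)⁻¹) ^ k / (((n + 1 : ℕ) : ℝ)⁻¹) ^ k) atTop (𝓝 1) := by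
  have h1 : Tendsto (fun n : ℕ => 1 + (n : ℝ)⁻¹) atTop (𝓝 1) := by
    simpa using (tendsto_inv_atTop_nhds_zero_nat (𝕜 := ℝ)).const_add 1
  have h2 := h1.pow k
  rw [one_pow] at h2
  refine h2.congr' ?_
  filter_upwards [eventually_ge_atTop 1] with n hn
  have : (0 : ℝ) < n := by exact_mod_cast hn
  rw [← div_pow]; congr 1; push_cast; field_simp

/-- Stem moments are at most tree moments, so the moment of order `j` contracts by `m ^ (1 - j)` up
to products of lower moments of total degree `j`, already known to be `O(n ^ (-j))`. -/
lemma isBigO_condMoment_aux (h : Admissible p ρ) :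
    condMoment p ρ 2 =O[atTop] (fun n : ℕ => ((n : ℝ)⁻¹) ^ 2) ∧
    condMoment p ρ 3 =O[atTop] (fun n : ℕ => ((n : ℝ)⁻¹) ^ 3) ∧
    condMoment p ρ 4 =O[atTop] (fun n : ℕ => ((n : ℝ)⁻¹) ^ 4) := by
  have hm := h.one_lt_mean
  set m := meanOffspring p with hm_def
  have ha1 := h.constA1_pos
  have hpos : ∀ k : ℕ, ∀ᶠ n : ℕ in atTop, (0 : ℝ) < ((n : ℝ)⁻¹) ^ k := fun k => by
    filter_upwards [eventually_ge_atTop 1] with n hn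
    have : (0 : ℝ) < n := by exact_mod_cast hn
    positivity
  have hθ : ∀ k : ℕ, k ≠ 0 → (m ^ k)⁻¹ < 1 := fun k hk =>
    inv_lt_one_of_one_lt₀ (one_lt_pow₀ hm hk)
  have hθ0 : ∀ k : ℕ, 0 ≤ (m ^ k)⁻¹ := fun k => by positivity
  have hx := isBigO_condMoment_one h
  have hle : ∀ j ≤ 4, ∀ n ≥ 4, |stemMoment p ρ j n| ≤ |condMoment p ρ j n| := fun j hj n hn => by
    rw [abs_of_nonneg (stemMoment_nonneg h j n), abs_of_nonneg (condMoment_nonneg h j n)]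
    exact stemMoment_le_condMoment h hj hn
  have hs : ∀ j ≤ 4, stemMoment p ρ j =O[atTop] condMoment p ρ j := fun j hj => by
    refine IsBigO.of_bound 1 ?_
    filter_upwards [eventually_ge_atTop 4] with n hn
    simpa using hle j hj n hn
  have hs1 := (hs 1 (by norm_num)).trans hx
  have hy : condMoment p ρ 2 =O[atTop] (fun n : ℕ => ((n : ℝ)⁻¹) ^ 2) := by
    refine isBigO_of_le_contraction (hθ0 1) (hθ 1 one_ne_zero) (hpos 2) (tendsto_inv_pow_ratio 2)
      (v := fun n => |constA1 p * stemMoment p ρ 1 n ^ 2|)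
      ((hs1.pow 2).const_mul_left _).abs_left ?_
    filter_upwards [eventually_ge_atTop 4] with n hn
    rw [condMoment_two_succ h hn, pow_one]
    refine (abs_add_le _ _).trans ?_
    rw [abs_mul, abs_of_nonneg (by positivity : 0 ≤ (meanOffspring p)⁻¹)]
    have := hle 2 (by norm_num) n hn
    gcongr
  have hs2 := (hs 2 (by norm_num)).trans hy
  have hz : condMoment p ρ 3 =O[atTop] (fun n : ℕ => ((n : ℝ)⁻¹) ^ 3) := by
    have hv : (fun n => 3 * (constA1 p / m) * (stemMoment p ρ 2 n * stemMoment p ρ 1 n)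
        + constA2 p * stemMoment p ρ 1 n ^ 3) =O[atTop] fun n : ℕ => ((n : ℝ)⁻¹) ^ 3 :=
      (((hs2.mul hs1).congr_right fun n => by ring).const_mul_left _).add
        ((hs1.pow 3).const_mul_left _)
    refine isBigO_of_le_contraction (hθ0 2) (hθ 2 two_ne_zero) (hpos 3) (tendsto_inv_pow_ratio 3)
      hv.abs_left ?_
    filter_upwards [eventually_ge_atTop 4] with n hn
    rw [condMoment_three_succ h hn, add_assoc]
    refine (abs_add_le _ _).trans ?_
    rw [abs_mul, abs_of_nonneg (by positivity : 0 ≤ (meanOffspring p ^ 2)⁻¹)]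
    have := hle 3 (by norm_num) n hn
    gcongr
  have hs3 := (hs 3 (by norm_num)).trans hz
  refine ⟨hy, hz, ?_⟩
  have hv : (fun n => 4 * (constA1 p / m ^ 2) * (stemMoment p ρ 3 n * stemMoment p ρ 1 n)
      + 3 * (constA1 p / m ^ 2) * stemMoment p ρ 2 n ^ 2
      + 6 * (constA2 p / m) * (stemMoment p ρ 2 n * stemMoment p ρ 1 n ^ 2)
      + constA3 p * stemMoment p ρ 1 n ^ 4) =O[atTop] fun n : ℕ => ((n : ℝ)⁻¹) ^ 4 :=
    (((((hs3.mul hs1).congr_right fun n => by ring).const_mul_left _).add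
      (((hs2.pow 2).congr_right fun n => by ring).const_mul_left _)).add
      (((hs2.mul (hs1.pow 2)).congr_right fun n => by ring).const_mul_left _)).add
        ((hs1.pow 4).const_mul_left _)
  refine isBigO_of_le_contraction (hθ0 3) (hθ 3 three_ne_zero) (hpos 4) (tendsto_inv_pow_ratio 4)
    hv.abs_left ?_
  filter_upwards [eventually_ge_atTop 4] with n hn
  rw [condMoment_four_succ h hn, add_assoc, add_assoc, add_assoc]
  refine (abs_add_le _ _).trans ?_
  rw [abs_mul, abs_of_nonneg (by positivity : 0 ≤ (meanOffspring p ^ 3)⁻¹)]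
  have := hle 4 (by norm_num) n hn
  rw [← add_assoc, ← add_assoc]
  gcongr

lemma isBigO_condMoment_two (h : Admissible p ρ) :
    condMoment p ρ 2 =O[atTop] fun n : ℕ => ((n : ℝ)⁻¹) ^ 2 := (isBigO_condMoment_aux h).1

lemma condMoment_recursion (h : Admissible p ρ) :
    (fun n => condMoment p ρ 1 (n + 1) - condMoment p ρ 1 n)
      =O[atTop] (fun n => condMoment p ρ 1 n ^ 2) ∧
    Tendsto (fun n => condMoment p ρ 1 n / condMoment p ρ 1 (n + 1)) atTop (𝓝 1) ∧
    (fun n => (condMoment p ρ 1 (n + 1))⁻¹ - (condMoment p ρ 1 n)⁻¹ - constC1 p ρ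
      - constC1 p ρ * constC4 p ρ * condMoment p ρ 1 n) =O[atTop] fun n => condMoment p ρ 1 n ^ 2 := by
  obtain ⟨hy, hz, hw⟩ := isBigO_condMoment_aux h
  have hx := isBigO_inv_condMoment_one h
  refine reciprocal_recursion (m := meanOffspring p) (a₁ := constA1 p) (a₂ := constA2 p)
    (b₁ := constB1 ρ) (b₂ := constB2 ρ) (κ := constA1 p / (1 - (meanOffspring p)⁻¹))
    (c₂ := constC2 p) (c₃ := constC3 p ρ) (y := condMoment p ρ 2) (z := condMoment p ρ 3)
    (w := condMoment p ρ 4) (s₂ := stemMoment p ρ 2) (s₃ := stemMoment p ρ 3)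
    h.one_lt_mean h.constC1_pos.ne' rfl ?_ rfl rfl rfl ?_ (tendsto_condMoment_one h)
    (hy.trans (hx.pow 2)) (hz.trans (hx.pow 3)) (hw.trans (hx.pow 4)) ?_ ?_ ?_ ?_ ?_
  · rw [constC1]; ring
  · filter_upwards [eventually_ge_atTop 4] with n hn using condMoment_one_pos h hn
  · refine IsBigO.of_bound (constB3 ρ) ?_
    filter_upwards [eventually_ge_atTop 4] with n hn
    rw [condMoment_one_succ h hn, Real.norm_eq_abs, Real.norm_eq_abs,
      abs_of_nonneg (condMoment_nonneg h 4 n)]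
    exact abs_stemMoment_one_sub_le h hn
  · refine IsBigO.of_bound (3 * constB2 ρ) ?_
    filter_upwards [eventually_ge_atTop 4] with n hn
    rw [Real.norm_eq_abs, Real.norm_eq_abs, abs_of_nonneg (condMoment_nonneg h 4 n)]
    exact abs_stemMoment_two_sub_le h hn
  · refine IsBigO.of_bound (3 * constB1 ρ) ?_
    filter_upwards [eventually_ge_atTop 4] with n hn
    rw [Real.norm_eq_abs, Real.norm_eq_abs, abs_of_nonneg (condMoment_nonneg h 4 n)]
    exact abs_stemMoment_three_sub_le h hn
  · filter_upwards [eventually_ge_atTop 4] with n hn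
    rw [condMoment_one_succ h hn, condMoment_two_succ h hn]
  · filter_upwards [eventually_ge_atTop 4] with n hn
    rw [condMoment_one_succ h hn, condMoment_three_succ h hn]

lemma condMoment_expansion (h : Admissible p ρ) : ∃ c₀ : ℝ,
    (fun n : ℕ => (condMoment p ρ 1 n)⁻¹ - constC1 p ρ * n - constC4 p ρ * Real.log n - c₀)
      =O[atTop] (fun n : ℕ => Real.log n / (n : ℝ)) ∧
    (fun n : ℕ => condMoment p ρ 1 n - (1 / (constC1 p ρ * n)
        - constC4 p ρ / constC1 p ρ ^ 2 * (Real.log n / (n : ℝ) ^ 2)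
        - c₀ / constC1 p ρ ^ 2 * (1 / (n : ℝ) ^ 2)))
      =O[atTop] fun n : ℕ => Real.log n ^ 2 / (n : ℝ) ^ 3 :=
  reciprocal_expansion h.constC1_pos
    ((eventually_ge_atTop 4).mono fun _ hn => condMoment_one_pos h hn)
    (isBigO_condMoment_one h) (condMoment_recursion h).2.2

lemma tendsto_inv_condMoment_increment (h : Admissible p ρ) :
    Tendsto (fun n => (condMoment p ρ 1 (n + 1))⁻¹ - (condMoment p ρ 1 n)⁻¹) atTop
      (𝓝 (constC1 p ρ)) := by
  have hx := tendsto_condMoment_one h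
  have h1 := (condMoment_recursion h).2.2.trans_tendsto (by simpa using hx.pow 2)
  have h2 := (h1.add_const (constC1 p ρ)).add (hx.const_mul (constC1 p ρ * constC4 p ρ))
  simp only [zero_add, mul_zero, add_zero] at h2
  refine h2.congr fun n => by ring

lemma tendsto_nat_mul_condMoment (h : Admissible p ρ) :
    Tendsto (fun n : ℕ => (n : ℝ) * condMoment p ρ 1 n) atTop (𝓝 (constC1 p ρ)⁻¹) := by
  have hc := h.constC1_pos
  obtain ⟨c₀, hc₀, -⟩ := condMoment_expansion h
  have hlog : Tendsto (fun n : ℕ => Real.log n / n) atTop (𝓝 0) :=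
    (Real.isLittleO_log_id_atTop.tendsto_div_nhds_zero).comp tendsto_natCast_atTop_atTop
  have hinv := tendsto_inv_atTop_nhds_zero_nat (𝕜 := ℝ)
  have h1 := (((hc₀.trans_tendsto hlog).add_const c₀).mul hinv).add
    ((hlog.const_mul (constC4 p ρ)).add_const (constC1 p ρ))
  simp only [zero_add, mul_zero] at h1
  have h2 : Tendsto (fun n : ℕ => (condMoment p ρ 1 n)⁻¹ * (n : ℝ)⁻¹) atTop (𝓝 (constC1 p ρ)) := by
    refine h1.congr' ?_
    filter_upwards [eventually_ge_atTop 1] with n hn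
    have : (0 : ℝ) < n := by exact_mod_cast hn
    field_simp; ring
  refine (h2.inv₀ hc.ne').congr fun n => ?_
  rw [mul_inv, inv_inv, inv_inv]; ring

/-- The second moments are `O(n⁻²)`, hence summable, so the squares are almost surely summable. -/
lemma ae_tendsto_treeCond (h : Admissible p ρ) :
    ∀ᵐ e ∂(envLaw p ρ), Tendsto (fun n => treeCond (meanOffspring p) n e) atTop (𝓝 0) := by
  have hm : ∀ n, MemLp (fun e => treeCond (meanOffspring p) (n + 4) e ^ 2) 1 (envLaw p ρ) :=
    fun n => memLp_one_iff_integrable.2 (integrable_treeCond_pow h (by norm_num) (by omega))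
  have hsum : Summable fun n =>
      lpNorm (fun e => treeCond (meanOffspring p) (n + 4) e ^ 2) 1 (envLaw p ρ) := by
    have h1 : ∀ n, lpNorm (fun e => treeCond (meanOffspring p) (n + 4) e ^ 2) 1 (envLaw p ρ)
        = condMoment p ρ 2 (n + 4) := fun n => by
      rw [lpNorm_one_eq_integral_norm (hm n).1]
      simp [condMoment]
    simp only [h1]
    refine (summable_nat_add_iff 4).2 (summable_of_isBigO_nat ?_ (isBigO_condMoment_two h))
    simp
  filter_upwards [ae_summable_of_summable_lpNorm le_rfl hm hsum] with e he
  refine (tendsto_add_atTop_iff_nat 4).1 ?_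
  have h1 := he.tendsto_atTop_zero.sqrt
  rw [Real.sqrt_zero] at h1
  refine tendsto_zero_iff_abs_tendsto_zero _ |>.2 (h1.congr fun n => ?_)
  simp [Real.sqrt_sq_eq_abs]

instance holderTriple_four_four_two : ENNReal.HolderTriple 4 4 2 where
  inv_add_inv_eq_inv := by
    rw [← ENNReal.toReal_eq_toReal_iff' (by simp) (by simp), ENNReal.toReal_add (by simp) (by simp)]
    simp only [ENNReal.toReal_inv, ENNReal.toReal_ofNat]
    norm_num

lemma memLp_two_mul {S : Type*} [MeasurableSpace S] {σ : Measure S} {f g : S → ℝ}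
    (hf : MemLp f 4 σ) (hg : MemLp g 4 σ) : MemLp (fun s => f s * g s) 2 σ :=
  hg.mul' hf

lemma lpNorm_two_mul_le {S : Type*} [MeasurableSpace S] {σ : Measure S} {f g : S → ℝ}
    (hf : MemLp f 4 σ) (hg : MemLp g 4 σ) :
    lpNorm (fun s => f s * g s) 2 σ ≤ lpNorm f 4 σ * lpNorm g 4 σ := by
  have h := eLpNorm_smul_le_mul_eLpNorm (p := 4) (q := 4) (r := 2) hg.1 hf.1
  have h2 := ENNReal.toReal_mono (by
    exact ENNReal.mul_ne_top hf.eLpNorm_ne_top hg.eLpNorm_ne_top) h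
  rw [ENNReal.toReal_mul, toReal_eLpNorm hf.1, toReal_eLpNorm hg.1,
    toReal_eLpNorm (hf.1.smul hg.1)] at h2
  exact h2

end GWNetwork

/-! ### First and second order limits of the normalized conductance. -/

namespace GWNetwork

variable {p : PMF ℕ} {ρ : Measure ℝ} [IsProbabilityMeasure ρ]

/-! ### Convergence of the normalized conductance -/

/-- The difference between the normalized conductance and the limiting generation size. -/
noncomputable def condError (p : PMF ℕ) (ρ : Measure ℝ) [IsProbabilityMeasure ρ] (n : ℕ)
    (e : Env) : ℝ :=
  treeCond (meanOffspring p) n e / condMoment p ρ 1 n - growthLimit (meanOffspring p) e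

/-- The difference between the conductance of a stem, normalized for the next generation, and the
limiting generation size. -/
noncomputable def stemError (p : PMF ℕ) (ρ : Measure ℝ) [IsProbabilityMeasure ρ] (n : ℕ)
    (e : Env) : ℝ :=
  stemCond (meanOffspring p) n e / condMoment p ρ 1 (n + 1) - growthLimit (meanOffspring p) e

/-- The ratio of consecutive mean conductances. -/
noncomputable def meanRatio (p : PMF ℕ) (ρ : Measure ℝ) [IsProbabilityMeasure ρ] (n : ℕ) : ℝ :=
  condMoment p ρ 1 n / condMoment p ρ 1 (n + 1)

/-- The damping factor `1 / (1 + ξ C_n)`. -/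
noncomputable def damping (p : PMF ℕ) (n : ℕ) (e : Env) : ℝ :=
  (1 + rootMark e * treeCond (meanOffspring p) n e)⁻¹

lemma measurable_condError (n : ℕ) : Measurable (condError p ρ n) :=
  ((measurable_treeCond n).div_const _).sub measurable_growthLimit

lemma measurable_stemError (n : ℕ) : Measurable (stemError p ρ n) :=
  ((measurable_stemCond n).div_const _).sub measurable_growthLimit

lemma measurable_damping (n : ℕ) : Measurable (damping p n) :=
  (measurable_const.add (measurable_rootMark.mul (measurable_treeCond n))).inv

lemma ae_damping (h : Admissible p ρ) (n : ℕ) :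
    ∀ᵐ e ∂(envLaw p ρ), 0 < damping p n e ∧ damping p n e ≤ 1 := by
  filter_upwards [ae_conductance_pos h n] with e ⟨h1, h2, _⟩
  have : 0 < rootMark e * treeCond (meanOffspring p) n e := mul_pos h1 h2
  exact ⟨inv_pos.2 (by linarith), inv_le_one_of_one_le₀ (by linarith)⟩

lemma ae_tendsto_damping (h : Admissible p ρ) :
    ∀ᵐ e ∂(envLaw p ρ), Tendsto (fun n => damping p n e) atTop (𝓝 1) := by
  filter_upwards [ae_tendsto_treeCond h] with e he
  have := ((he.const_mul (rootMark e)).const_add 1).inv₀ (by simp)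
  simpa [damping] using this

lemma memLp_condError (h : Admissible p ρ) {n : ℕ} (hn : 4 ≤ n) :
    MemLp (condError p ρ n) 4 (envLaw p ρ) := by
  have h1 := (memLp_four_treeCond h rfl hn).const_mul (condMoment p ρ 1 n)⁻¹
  refine (h1.sub (memLp_growthLimit h rfl)).congr_norm
    (measurable_condError n).aestronglyMeasurable (.of_forall fun e => ?_)
  simp only [condError, Pi.sub_apply]
  ring_nf

lemma memLp_stemError (h : Admissible p ρ) {n : ℕ} (hn : 4 ≤ n) :
    MemLp (stemError p ρ n) 4 (envLaw p ρ) := by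
  have h1 := (memLp_four_stemCond h rfl (by omega : 3 ≤ n)).const_mul
    (condMoment p ρ 1 (n + 1))⁻¹
  refine (h1.sub (memLp_growthLimit h rfl)).congr_norm
    (measurable_stemError n).aestronglyMeasurable (.of_forall fun e => ?_)
  simp only [stemError, Pi.sub_apply]
  ring_nf

lemma integral_stemError (h : Admissible p ρ) {n : ℕ} (hn : 4 ≤ n) :
    ∫ e, stemError p ρ n e ∂(envLaw p ρ) = 0 := by
  have hx := condMoment_one_pos h (by omega : 4 ≤ n + 1)
  have h1 := integrable_stemCond_pow h (j := 1) (by norm_num) hn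
  simp only [pow_one] at h1
  have h2 := condMoment_one_succ h hn
  simp only [stemMoment, pow_one] at h2
  simp only [stemError]
  rw [integral_sub (h1.div_const _) ((memLp_growthLimit h rfl).integrable (by norm_num)),
    integral_div, ← h2, integral_growthLimit h rfl, div_self hx.ne', sub_self]

/-- Exact because `stemError` is normalized by the mean at level `n + 1`, which also makes it
centred. -/
lemma condError_succ (h : Admissible p ρ) (n : ℕ) :
    condError p ρ (n + 1) =ᵐ[envLaw p ρ] branchAvg (meanOffspring p) (stemError p ρ n) := by
  filter_upwards [growthLimit_fixed h rfl] with e he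
  simp only [condError]
  rw [← he, treeCond_succ]
  simp only [branchAvg, stemError, Finset.sum_sub_distrib, ← Finset.sum_div]
  ring

lemma stemCond_div_eq (h : Admissible p ρ) {n : ℕ} (hn : 4 ≤ n) (e : Env) :
    stemCond (meanOffspring p) n e / condMoment p ρ 1 (n + 1)
      = meanRatio p ρ n * (damping p n e * (condError p ρ n e + growthLimit (meanOffspring p) e)) := by
  have hx := condMoment_one_pos h hn
  rw [stemCond_eq (by omega), meanRatio, damping, condError]
  field_simp
  ring

/-- The previous error, damped by a factor in `(0, 1]`, plus a multiple of the growth limit that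
vanishes as damping and mean ratio tend to 1. -/
lemma stemError_eq (h : Admissible p ρ) {n : ℕ} (hn : 4 ≤ n) (e : Env) :
    stemError p ρ n e = meanRatio p ρ n * (damping p n e * condError p ρ n e)
      + (meanRatio p ρ n * damping p n e - 1) * growthLimit (meanOffspring p) e := by
  rw [stemError, stemCond_div_eq h hn]
  ring

lemma tendsto_meanRatio (h : Admissible p ρ) : Tendsto (meanRatio p ρ) atTop (𝓝 1) :=
  (condMoment_recursion h).2.1

lemma meanRatio_pos (h : Admissible p ρ) {n : ℕ} (hn : 4 ≤ n) : 0 < meanRatio p ρ n :=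
  div_pos (condMoment_one_pos h hn) (condMoment_one_pos h (by omega))

lemma tendsto_lpNorm_damped_growthLimit (h : Admissible p ρ) {q : ℕ} (hq : q = 2 ∨ q = 4) :
    Tendsto (fun n => lpNorm (fun e => (meanRatio p ρ n * damping p n e - 1)
      * growthLimit (meanOffspring p) e) q (envLaw p ρ)) atTop (𝓝 0) := by
  have hW : MemLp (fun e => 3 * growthLimit (meanOffspring p) e) q (envLaw p ρ) :=
    ((memLp_growthLimit h rfl).mono_exponent (by rcases hq with rfl | rfl <;> norm_num)).const_mul 3
  refine tendsto_lpNorm_zero_of_dominated hq (.of_forall fun n => ?_) hW ?_ ?_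
  · exact ((((measurable_damping n).const_mul _).sub_const 1).mul
      measurable_growthLimit).aestronglyMeasurable
  · filter_upwards [(tendsto_meanRatio h).eventually_lt_const (by norm_num : (1 : ℝ) < 2),
      eventually_ge_atTop 4] with n hn hn4
    filter_upwards [ae_damping h n] with e ⟨h1, h2⟩
    have h0 := meanRatio_pos h hn4
    rw [abs_mul, abs_mul]
    refine mul_le_mul_of_nonneg_right ?_ (abs_nonneg _)
    have h3 : 0 < meanRatio p ρ n * damping p n e := mul_pos h0 h1
    have h4 : meanRatio p ρ n * damping p n e ≤ 2 := by nlinarith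
    rw [abs_of_pos (by norm_num : (0 : ℝ) < 3), abs_le]
    constructor <;> linarith
  · filter_upwards [ae_tendsto_damping h] with e he
    have := (((tendsto_meanRatio h).mul he).sub_const 1).mul_const
      (growthLimit (meanOffspring p) e)
    simpa using this

lemma lpNorm_stemError_le (h : Admissible p ρ) {q : ℝ≥0∞} (hq1 : 1 ≤ q) (hq4 : q ≤ 4) {n : ℕ}
    (hn : 4 ≤ n) : lpNorm (stemError p ρ n) q (envLaw p ρ)
      ≤ meanRatio p ρ n * lpNorm (condError p ρ n) q (envLaw p ρ)
        + lpNorm (fun e => (meanRatio p ρ n * damping p n e - 1)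
          * growthLimit (meanOffspring p) e) q (envLaw p ρ) := by
  have h0 := meanRatio_pos h hn
  have hΔ : MemLp (condError p ρ n) q (envLaw p ρ) := (memLp_condError h hn).mono_exponent hq4
  have hdom : ∀ᵐ e ∂(envLaw p ρ), |meanRatio p ρ n * (damping p n e * condError p ρ n e)|
      ≤ |meanRatio p ρ n * condError p ρ n e| := by
    filter_upwards [ae_damping h n] with e ⟨h1, h2⟩
    rw [abs_mul, abs_mul, abs_mul, abs_of_pos h1]
    gcongr
    exact mul_le_of_le_one_left (abs_nonneg _) h2
  have hm1 : MemLp (fun e => meanRatio p ρ n * (damping p n e * condError p ρ n e)) q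
      (envLaw p ρ) := (hΔ.const_mul (meanRatio p ρ n)).mono
    (((measurable_damping n).mul (measurable_condError n)).const_mul _).aestronglyMeasurable hdom
  have heq : stemError p ρ n = (fun e => meanRatio p ρ n * (damping p n e * condError p ρ n e))
      + fun e => (meanRatio p ρ n * damping p n e - 1) * growthLimit (meanOffspring p) e := by
    ext e; exact stemError_eq h hn e
  rw [heq]
  refine (lpNorm_add_le hm1 hq1).trans ?_
  gcongr
  refine (lpNorm_mono_ae (hΔ.const_mul _) hdom).trans (le_of_eq ?_)
  rw [lpNorm_const_mul, abs_of_pos h0]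

lemma tendsto_lpNorm_two_condError (h : Admissible p ρ) :
    Tendsto (fun n => lpNorm (condError p ρ n) 2 (envLaw p ρ)) atTop (𝓝 0) := by
  have hr := (tendsto_meanRatio h).const_mul (ratioTwo (meanOffspring p))
  have hv := (tendsto_lpNorm_damped_growthLimit h (Or.inl rfl)).const_mul
    (ratioTwo (meanOffspring p))
  rw [mul_one] at hr
  rw [mul_zero] at hv
  refine tendsto_zero_of_contraction (ratioTwo_lt_one h.one_lt_mean) (fun _ => lpNorm_nonneg)
    hr hv ?_
  filter_upwards [eventually_ge_atTop 4] with n hn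
  rw [lpNorm_congr (measurable_condError _).aestronglyMeasurable (condError_succ h n),
    lpNorm_two_branchAvg h rfl (measurable_stemError n)
      ((memLp_stemError h hn).mono_exponent (by norm_num)) (integral_stemError h hn)]
  have := mul_le_mul_of_nonneg_left (lpNorm_stemError_le h one_le_two (by norm_num) hn)
    (ratioTwo_nonneg (m := meanOffspring p))
  refine this.trans (le_of_eq ?_)
  push_cast; ring

/-- The `L²` convergence enters as an error term of the `L⁴` contraction. The `L⁴` statement is
needed because the second order recursion contains a product of the error with itself and with `W`,
measured in `L²`. -/
lemma tendsto_lpNorm_four_condError (h : Admissible p ρ) :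
    Tendsto (fun n => lpNorm (condError p ρ n) 4 (envLaw p ρ)) atTop (𝓝 0) := by
  obtain ⟨θ, K, hθ0, hθ1, hK0, hθK⟩ := exists_lpNorm_four_branchAvg_le h rfl
  have hr := (tendsto_meanRatio h).const_mul θ
  have hv := ((tendsto_lpNorm_damped_growthLimit h (Or.inr rfl)).const_mul θ).add
    ((((tendsto_meanRatio h).mul (tendsto_lpNorm_two_condError h)).add
      (tendsto_lpNorm_damped_growthLimit h (Or.inl rfl))).const_mul K)
  rw [mul_one] at hr
  simp only [mul_zero, add_zero] at hv
  refine tendsto_zero_of_contraction hθ1 (fun _ => lpNorm_nonneg) hr hv ?_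
  filter_upwards [eventually_ge_atTop 4] with n hn
  rw [lpNorm_congr (measurable_condError _).aestronglyMeasurable (condError_succ h n)]
  refine (hθK _ (measurable_stemError n) (memLp_stemError h hn) (integral_stemError h hn)).trans ?_
  have h4 := mul_le_mul_of_nonneg_left (lpNorm_stemError_le h (q := 4) (by norm_num) le_rfl hn) hθ0
  have h2 := mul_le_mul_of_nonneg_left
    (lpNorm_stemError_le h one_le_two (by norm_num : (2 : ℝ≥0∞) ≤ 4) hn) hK0
  refine (add_le_add h4 h2).trans (le_of_eq ?_)
  push_cast; ring

/-! ### The limit of the fluctuations -/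

/-- The contribution of the root to the fluctuations. -/
noncomputable def fluctuationTerm (p : PMF ℕ) (ρ : Measure ℝ) (e : Env) : ℝ :=
  growthLimit (meanOffspring p) e
    * (1 - rootMark e / constC1 p ρ * growthLimit (meanOffspring p) e)

/-- The sum of the contributions of all generations except the zeroth. -/
noncomputable def fluctuation (p : PMF ℕ) (ρ : Measure ℝ) (e : Env) : ℝ :=
  ∑' ℓ : ℕ, (branchAvg (meanOffspring p))^[ℓ + 1] (fluctuationTerm p ρ) e

omit [IsProbabilityMeasure ρ] in
lemma measurable_fluctuationTerm : Measurable (fluctuationTerm p ρ) :=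
  measurable_growthLimit.mul (measurable_const.sub
    ((measurable_rootMark.div_const _).mul measurable_growthLimit))

lemma memLp_rootMark_mul (h : Admissible p ρ) (n : ℕ) {ψ : ℝ × ℝ → ℝ} (hψ : Measurable ψ)
    (hL : MemLp (fun e => ψ (treeCond (meanOffspring p) n e, growthLimit (meanOffspring p) e)) 2
      (envLaw p ρ)) :
    MemLp (fun e => rootMark e
      * ψ (treeCond (meanOffspring p) n e, growthLimit (meanOffspring p) e)) 2 (envLaw p ρ) := by
  have hm : Measurable fun e =>
      rootMark e * ψ (treeCond (meanOffspring p) n e, growthLimit (meanOffspring p) e) :=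
    measurable_rootMark.mul (hψ.comp ((measurable_treeCond n).prodMk measurable_growthLimit))
  refine (memLp_two_iff_integrable_sq hm.aestronglyMeasurable).2 ?_
  have := integrable_rootMark_mul h rfl n (φ := fun t => t ^ 2) (by fun_prop)
    (h.integrable_mark_pow (by norm_num)) (ψ := fun a => ψ a ^ 2) (hψ.pow_const 2)
    ((memLp_two_iff_integrable_sq hL.1).1 hL)
  exact this.congr (.of_forall fun e => by simp only [mul_pow])

/-- Independence splits off the mark, so two moments of the mark suffice; Hölder would ask for more.
-/
lemma lpNorm_rootMark_mul (h : Admissible p ρ) (n : ℕ) {ψ : ℝ × ℝ → ℝ} (hψ : Measurable ψ)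
    (hL : MemLp (fun e => ψ (treeCond (meanOffspring p) n e, growthLimit (meanOffspring p) e)) 2
      (envLaw p ρ)) :
    lpNorm (fun e => rootMark e
      * ψ (treeCond (meanOffspring p) n e, growthLimit (meanOffspring p) e)) 2 (envLaw p ρ)
      = √(constB2 ρ) * lpNorm (fun e => ψ (treeCond (meanOffspring p) n e,
        growthLimit (meanOffspring p) e)) 2 (envLaw p ρ) := by
  rw [← sq_eq_sq₀ lpNorm_nonneg (mul_nonneg (Real.sqrt_nonneg _) lpNorm_nonneg), mul_pow,
    Real.sq_sqrt h.constB2_nonneg, lpNorm_two_sq hL, lpNorm_two_sq (memLp_rootMark_mul h n hψ hL)]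
  simp only [mul_pow]
  exact integral_rootMark_mul h rfl n (φ := fun t => t ^ 2) (by fun_prop)
    (h.integrable_mark_pow (by norm_num)) (ψ := fun a => ψ a ^ 2) (hψ.pow_const 2)

lemma memLp_growthLimit_sq (h : Admissible p ρ) :
    MemLp (fun e => growthLimit (meanOffspring p) e ^ 2) 2 (envLaw p ρ) := by
  simpa [sq] using memLp_two_mul (memLp_growthLimit h rfl) (memLp_growthLimit h rfl)

lemma memLp_mark_mul_growthLimit_sq (h : Admissible p ρ) :
    MemLp (fun e => rootMark e * growthLimit (meanOffspring p) e ^ 2) 2 (envLaw p ρ) :=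
  memLp_rootMark_mul h 1 (ψ := fun a => a.2 ^ 2) (by fun_prop) (memLp_growthLimit_sq h)

lemma memLp_fluctuationTerm (h : Admissible p ρ) :
    MemLp (fluctuationTerm p ρ) 2 (envLaw p ρ) := by
  have h1 : MemLp (growthLimit (meanOffspring p)) 2 (envLaw p ρ) :=
    (memLp_growthLimit h rfl).mono_exponent (by norm_num)
  have h2 := (memLp_mark_mul_growthLimit_sq h).const_mul (constC1 p ρ)⁻¹
  refine (h1.sub h2).congr_norm measurable_fluctuationTerm.aestronglyMeasurable
    (.of_forall fun e => ?_)
  simp only [fluctuationTerm, Pi.sub_apply]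
  ring_nf

/-- Centred since `E[W] = 1` and `E[ξ W²] = c₁`; without this the iterates would not decay and the
series would not converge. -/
lemma integral_fluctuationTerm (h : Admissible p ρ) :
    ∫ e, fluctuationTerm p ρ e ∂(envLaw p ρ) = 0 := by
  have hc := h.constC1_pos
  have h1 : Integrable (growthLimit (meanOffspring p)) (envLaw p ρ) :=
    (memLp_growthLimit h rfl).integrable (by norm_num)
  have h2 := (integrable_mark_mul_growthLimit_sq h rfl).const_mul (constC1 p ρ)⁻¹
  have h3 : ∀ e, fluctuationTerm p ρ e = growthLimit (meanOffspring p) e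
      - (constC1 p ρ)⁻¹ * (rootMark e * growthLimit (meanOffspring p) e ^ 2) := fun e => by
    simp only [fluctuationTerm]; ring
  simp only [h3]
  rw [integral_sub h1 h2, integral_const_mul, integral_mark_mul_growthLimit_sq h rfl,
    integral_growthLimit h rfl, inv_mul_cancel₀ hc.ne', sub_self]

lemma memLp_fluctuation_iterate (h : Admissible p ρ) (n : ℕ) :
    MemLp ((branchAvg (meanOffspring p))^[n] (fluctuationTerm p ρ)) 2 (envLaw p ρ) :=
  memLp_branchAvg_iterate h measurable_fluctuationTerm (j := 2) (by norm_num) (by norm_num)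
    (memLp_fluctuationTerm h) n

lemma summable_lpNorm_fluctuation (h : Admissible p ρ) :
    Summable fun n => lpNorm ((branchAvg (meanOffspring p))^[n] (fluctuationTerm p ρ)) 2
      (envLaw p ρ) :=
  summable_lpNorm_branchAvg_iterate h rfl measurable_fluctuationTerm (memLp_fluctuationTerm h)
    (integral_fluctuationTerm h)

lemma ae_summable_fluctuation (h : Admissible p ρ) : ∀ᵐ e ∂(envLaw p ρ),
    Summable fun n => (branchAvg (meanOffspring p))^[n] (fluctuationTerm p ρ) e :=
  ae_summable_of_summable_lpNorm one_le_two (memLp_fluctuation_iterate h)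
    (summable_lpNorm_fluctuation h)

lemma memLp_fluctuation (h : Admissible p ρ) : MemLp (fluctuation p ρ) 2 (envLaw p ρ) :=
  memLp_tsum one_le_two (fun n => memLp_fluctuation_iterate h (n + 1))
    ((summable_nat_add_iff 1).2 (summable_lpNorm_fluctuation h))

omit [IsProbabilityMeasure ρ] in
lemma measurable_fluctuation : Measurable (fluctuation p ρ) :=
  Measurable.tsum fun n => measurable_branchAvg_iterate measurable_fluctuationTerm (n + 1)

lemma integral_fluctuation (h : Admissible p ρ) : ∫ e, fluctuation p ρ e ∂(envLaw p ρ) = 0 := by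
  have h1 := hasSum_integral_of_summable_lpNorm one_le_two
    (fun n => memLp_fluctuation_iterate h (n + 1))
    ((summable_nat_add_iff 1).2 (summable_lpNorm_fluctuation h))
  simp only [integral_branchAvg_iterate h rfl measurable_fluctuationTerm
    ((memLp_fluctuationTerm h).mono_exponent one_le_two), integral_fluctuationTerm h] at h1
  exact h1.unique hasSum_zero

/-- Generations from 1 on, seen from the root, are generations from 0 on, seen from the children;
the generation 0 of a child is `fluctuationTerm`. -/
lemma fluctuation_fixed (h : Admissible p ρ) : fluctuation p ρ =ᵐ[envLaw p ρ]
    branchAvg (meanOffspring p) fun e => fluctuation p ρ e + fluctuationTerm p ρ e := by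
  filter_upwards [ae_forall_shift (ae_summable_fluctuation h)] with e he
  have h1 : ∀ i, HasSum (fun n => (branchAvg (meanOffspring p))^[n] (fluctuationTerm p ρ)
      (shift i e)) (fluctuation p ρ (shift i e) + fluctuationTerm p ρ (shift i e)) := fun i => by
    have h2 := (he i).hasSum
    rw [(he i).tsum_eq_zero_add, add_comm] at h2
    exact h2
  have h2 := (hasSum_sum fun i (_ : i ∈ Finset.range (e []).1) => h1 i).mul_left
    (meanOffspring p)⁻¹
  rw [fluctuation]
  simp only [Function.iterate_succ_apply']
  exact h2.tsum_eq

/-! ### Second order convergence -/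

/-- The difference between the rescaled error of the conductance and the fluctuation. -/
noncomputable def secondError (p : PMF ℕ) (ρ : Measure ℝ) [IsProbabilityMeasure ρ] (n : ℕ)
    (e : Env) : ℝ := n * condError p ρ n e - fluctuation p ρ e

/-- The quantity whose average over the children of the root is the next `secondError`. -/
noncomputable def secondStemError (p : PMF ℕ) (ρ : Measure ℝ) [IsProbabilityMeasure ρ] (n : ℕ)
    (e : Env) : ℝ :=
  (n + 1 : ℕ) * stemError p ρ n e - (fluctuation p ρ e + fluctuationTerm p ρ e)

lemma measurable_secondError (n : ℕ) : Measurable (secondError p ρ n) :=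
  ((measurable_condError n).const_mul _).sub measurable_fluctuation

lemma measurable_secondStemError (n : ℕ) : Measurable (secondStemError p ρ n) :=
  ((measurable_stemError n).const_mul _).sub
    (measurable_fluctuation.add measurable_fluctuationTerm)

lemma memLp_secondError (h : Admissible p ρ) {n : ℕ} (hn : 4 ≤ n) :
    MemLp (secondError p ρ n) 2 (envLaw p ρ) :=
  (((memLp_condError h hn).mono_exponent (by norm_num)).const_mul _).sub (memLp_fluctuation h)

lemma memLp_secondStemError (h : Admissible p ρ) {n : ℕ} (hn : 4 ≤ n) :
    MemLp (secondStemError p ρ n) 2 (envLaw p ρ) :=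
  (((memLp_stemError h hn).mono_exponent (by norm_num)).const_mul _).sub
    ((memLp_fluctuation h).add (memLp_fluctuationTerm h))

lemma integral_secondStemError (h : Admissible p ρ) {n : ℕ} (hn : 4 ≤ n) :
    ∫ e, secondStemError p ρ n e ∂(envLaw p ρ) = 0 := by
  have h1 : Integrable (stemError p ρ n) (envLaw p ρ) := (memLp_stemError h hn).integrable (by norm_num)
  have h2 := (memLp_fluctuation h).integrable one_le_two
  have h3 := (memLp_fluctuationTerm h).integrable one_le_two
  have h23 : Integrable (fun e => fluctuation p ρ e + fluctuationTerm p ρ e) (envLaw p ρ) :=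
    h2.add h3
  simp only [secondStemError]
  rw [integral_sub (h1.const_mul _) h23, integral_const_mul, integral_add h2 h3,
    integral_stemError h hn, integral_fluctuation h, integral_fluctuationTerm h]
  simp

lemma secondError_succ (h : Admissible p ρ) (n : ℕ) : secondError p ρ (n + 1)
    =ᵐ[envLaw p ρ] branchAvg (meanOffspring p) (secondStemError p ρ n) := by
  filter_upwards [condError_succ h n, fluctuation_fixed h] with e h1 h2
  rw [secondError, h1, h2]
  simp only [branchAvg, secondStemError, Finset.sum_sub_distrib, ← Finset.mul_sum]
  ring

/-- The coefficient of the linear part of the increment of `secondError`. -/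
noncomputable def linCoeff (p : PMF ℕ) (ρ : Measure ℝ) [IsProbabilityMeasure ρ] (n : ℕ) : ℝ :=
  (n + 1 : ℕ) * meanRatio p ρ n - n

/-- The coefficient of the quadratic part of the increment of `secondError`. -/
noncomputable def quadCoeff (p : PMF ℕ) (ρ : Measure ℝ) [IsProbabilityMeasure ρ] (n : ℕ) : ℝ :=
  (n + 1 : ℕ) * meanRatio p ρ n * condMoment p ρ 1 n

lemma tendsto_succ_mul_condMoment (h : Admissible p ρ) :
    Tendsto (fun n : ℕ => ((n + 1 : ℕ) : ℝ) * condMoment p ρ 1 n) atTop (𝓝 (constC1 p ρ)⁻¹) := by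
  have := (tendsto_nat_mul_condMoment h).add (tendsto_condMoment_one h)
  rw [add_zero] at this
  refine this.congr fun n => by push_cast; ring

lemma tendsto_quadCoeff (h : Admissible p ρ) :
    Tendsto (quadCoeff p ρ) atTop (𝓝 (constC1 p ρ)⁻¹) := by
  have := (tendsto_succ_mul_condMoment h).mul (tendsto_meanRatio h)
  rw [mul_one] at this
  refine this.congr fun n => by simp only [quadCoeff]; ring

/-- With `x_n` the mean conductance, the coefficient is `1 + (n + 1) x_n (1/x_{n+1} - 1/x_n)`, and
the product tends to `c₁⁻¹ c₁ = 1`. The value 2 is what makes the terms linear in `W` cancel in the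
limit. -/
lemma tendsto_linCoeff (h : Admissible p ρ) : Tendsto (linCoeff p ρ) atTop (𝓝 2) := by
  have hc := h.constC1_pos
  have h1 := ((tendsto_succ_mul_condMoment h).mul (tendsto_inv_condMoment_increment h)).const_add 1
  rw [inv_mul_cancel₀ hc.ne'] at h1
  norm_num at h1
  refine h1.congr' ?_
  filter_upwards [eventually_ge_atTop 4] with n hn
  have hx := condMoment_one_pos h hn
  have hx' := condMoment_one_pos h (by omega : 4 ≤ n + 1)
  rw [linCoeff, meanRatio]
  push_cast
  field_simp
  ring

/-- Writing the damping as `d = 1 - d ξ C_n` with `C_n = x_n (Δ + W)` separates linear from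
quadratic terms. The limits of the coefficients of `W` and `ξ W²` are exactly what `fluctuationTerm`
cancels, and all other corrections contain `Δ`. -/
lemma secondStemError_eq (h : Admissible p ρ) {n : ℕ} (hn : 4 ≤ n) {e : Env}
    (hd : 0 < damping p n e) :
    secondStemError p ρ n e = secondError p ρ n e
      + (linCoeff p ρ n * condError p ρ n e
      + ((linCoeff p ρ n - 2) * growthLimit (meanOffspring p) e
      + (-(quadCoeff p ρ n * (damping p n e * (rootMark e * (condError p ρ n e
          * (condError p ρ n e + 2 * growthLimit (meanOffspring p) e)))))
      + -((quadCoeff p ρ n * damping p n e - (constC1 p ρ)⁻¹)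
          * (rootMark e * growthLimit (meanOffspring p) e ^ 2))))) := by
  have hx := condMoment_one_pos h hn
  have h1 := stemCond_div_eq h hn e
  have hC : treeCond (meanOffspring p) n e
      = condMoment p ρ 1 n * (condError p ρ n e + growthLimit (meanOffspring p) e) := by
    rw [condError]; field_simp; ring
  have hdamp : damping p n e * (1 + rootMark e * treeCond (meanOffspring p) n e) = 1 := by
    rw [damping] at hd ⊢
    exact inv_mul_cancel₀ (inv_pos.1 hd).ne'
  rw [hC] at hdamp
  simp only [secondStemError, secondError, stemError, h1, linCoeff, quadCoeff, fluctuationTerm]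
  set Δ := condError p ρ n e
  set W := growthLimit (meanOffspring p) e
  set d := damping p n e
  set x := condMoment p ρ 1 n
  set r := meanRatio p ρ n
  set t := rootMark e
  push_cast
  linear_combination ((n : ℝ) + 1) * r * (Δ + W) * hdamp

lemma tendsto_lpNorm_two_secondError (h : Admissible p ρ) :
    Tendsto (fun n => lpNorm (secondError p ρ n) 2 (envLaw p ρ)) atTop (𝓝 0) := by
  set μ := envLaw p ρ with hμ
  set W := growthLimit (meanOffspring p) with hW
  have hW4 : MemLp W 4 μ := memLp_growthLimit h rfl
  have hW2 : MemLp W 2 μ := hW4.mono_exponent (by norm_num)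
  -- the four parts of the error
  have e1 : Tendsto (fun n => |linCoeff p ρ n| * lpNorm (condError p ρ n) 2 μ) atTop (𝓝 0) := by
    have := ((tendsto_linCoeff h).abs).mul (tendsto_lpNorm_two_condError h)
    rwa [mul_zero] at this
  have e2 : Tendsto (fun n => |linCoeff p ρ n - 2| * lpNorm W 2 μ) atTop (𝓝 0) := by
    have := (((tendsto_linCoeff h).sub_const 2).abs).mul_const (lpNorm W 2 μ)
    simpa using this
  have e3 : Tendsto (fun n => |quadCoeff p ρ n| * (√(constB2 ρ) * (lpNorm (condError p ρ n) 4 μ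
      * (lpNorm (condError p ρ n) 4 μ + 2 * lpNorm W 4 μ)))) atTop (𝓝 0) := by
    have h4 := tendsto_lpNorm_four_condError h
    have := ((tendsto_quadCoeff h).abs).mul
      ((h4.mul (h4.add_const (2 * lpNorm W 4 μ))).const_mul (√(constB2 ρ)))
    simpa using this
  have e4 : Tendsto (fun n => lpNorm (fun e => (quadCoeff p ρ n * damping p n e - (constC1 p ρ)⁻¹)
      * (rootMark e * W e ^ 2)) 2 μ) atTop (𝓝 0) := by
    have hc := h.constC1_pos
    -- Eventually the coefficient `quadCoeff` lies below its limit plus 1, and damping is at most 1;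
    -- this gives the constant in the dominating function.
    refine tendsto_lpNorm_zero_of_dominated (q := 2)
      (g := fun e => ((constC1 p ρ)⁻¹ + 1 + (constC1 p ρ)⁻¹) * (rootMark e * W e ^ 2))
      (Or.inl rfl) (.of_forall fun n => ?_) ((memLp_mark_mul_growthLimit_sq h).const_mul _) ?_ ?_
    · exact ((((measurable_damping n).const_mul _).sub_const _).mul
        (measurable_rootMark.mul (measurable_growthLimit.pow_const 2))).aestronglyMeasurable
    · filter_upwards [(tendsto_quadCoeff h).eventually_lt_const (lt_add_one _),
        eventually_ge_atTop 4] with n hn hn4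
      filter_upwards [ae_damping h n] with e ⟨h1, h2⟩
      have h0 : 0 < quadCoeff p ρ n := by
        have := meanRatio_pos h hn4
        have := condMoment_one_pos h hn4
        rw [quadCoeff]; positivity
      have hci : 0 < (constC1 p ρ)⁻¹ := inv_pos.2 hc
      rw [abs_mul _ (rootMark e * W e ^ 2), abs_mul _ (rootMark e * W e ^ 2)]
      refine mul_le_mul_of_nonneg_right ?_ (abs_nonneg _)
      have h3 : 0 < quadCoeff p ρ n * damping p n e := mul_pos h0 h1
      have h4 : quadCoeff p ρ n * damping p n e ≤ (constC1 p ρ)⁻¹ + 1 := by nlinarith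
      rw [abs_of_pos (by positivity : 0 < (constC1 p ρ)⁻¹ + 1 + (constC1 p ρ)⁻¹), abs_le]
      constructor <;> linarith
    · filter_upwards [ae_tendsto_damping h] with e he
      have := (((tendsto_quadCoeff h).mul he).sub_const (constC1 p ρ)⁻¹).mul_const
        (rootMark e * W e ^ 2)
      simpa using this
  have hv := ((e1.add (e2.add (e3.add e4))).const_mul (ratioTwo (meanOffspring p)))
  simp only [add_zero, mul_zero] at hv
  refine tendsto_zero_of_contraction (ratioTwo_lt_one h.one_lt_mean) (fun _ => lpNorm_nonneg)
    tendsto_const_nhds hv ?_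
  filter_upwards [eventually_ge_atTop 4] with n hn
  rw [lpNorm_congr (measurable_secondError _).aestronglyMeasurable (secondError_succ h n),
    lpNorm_two_branchAvg h rfl (measurable_secondStemError n)
      (memLp_secondStemError h hn) (integral_secondStemError h hn), ← mul_add]
  refine mul_le_mul_of_nonneg_left ?_ ratioTwo_nonneg
  have hΔ4 : MemLp (condError p ρ n) 4 μ := memLp_condError h hn
  have hΔ2 : MemLp (condError p ρ n) 2 μ := hΔ4.mono_exponent (by norm_num)
  have hsum4 : MemLp (fun e => condError p ρ n e + 2 * W e) 4 μ := hΔ4.add (hW4.const_mul 2)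
  have hprod : MemLp (fun e => condError p ρ n e * (condError p ρ n e + 2 * W e)) 2 μ :=
    memLp_two_mul hΔ4 hsum4
  -- The quadratic term as a function of conductance and growth limit, so that independence of the
  -- root mark applies.
  set ψ : ℝ × ℝ → ℝ := fun a => (a.1 / condMoment p ρ 1 n - a.2)
    * ((a.1 / condMoment p ρ 1 n - a.2) + 2 * a.2) with hψ
  have hψm : Measurable ψ := by fun_prop
  have hξprod := memLp_rootMark_mul h n hψm hprod
  have hξnorm := lpNorm_rootMark_mul h n hψm hprod
  have hξprod' : MemLp (fun e => rootMark e * (condError p ρ n e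
      * (condError p ρ n e + 2 * W e))) 2 μ := hξprod
  have hξnorm' : lpNorm (fun e => rootMark e * (condError p ρ n e
      * (condError p ρ n e + 2 * W e))) 2 μ = √(constB2 ρ) *
      lpNorm (fun e => condError p ρ n e * (condError p ρ n e + 2 * W e)) 2 μ := hξnorm
  set f1 : Env → ℝ := fun e => linCoeff p ρ n * condError p ρ n e with hf1
  set f2 : Env → ℝ := fun e => (linCoeff p ρ n - 2) * W e with hf2
  set f3 : Env → ℝ := fun e => -(quadCoeff p ρ n * (damping p n e * (rootMark e * (condError p ρ n e
          * (condError p ρ n e + 2 * W e))))) with hf3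
  set f4 : Env → ℝ := fun e => -((quadCoeff p ρ n * damping p n e - (constC1 p ρ)⁻¹)
          * (rootMark e * W e ^ 2)) with hf4
  have hae : secondStemError p ρ n =ᵐ[μ] secondError p ρ n + (f1 + (f2 + (f3 + f4))) := by
    filter_upwards [ae_damping h n] with e ⟨h1, _⟩
    exact secondStemError_eq h hn h1
  have hdom : ∀ᵐ e ∂μ, |f3 e| ≤ |quadCoeff p ρ n * (rootMark e * (condError p ρ n e
          * (condError p ρ n e + 2 * W e)))| := by
    filter_upwards [ae_damping h n] with e ⟨h1, h2⟩
    rw [hf3, abs_neg, abs_mul, abs_mul (quadCoeff p ρ n), abs_mul (damping p n e), abs_of_pos h1]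
    gcongr
    exact mul_le_of_le_one_left (abs_nonneg _) h2
  have hf3m : Measurable f3 := by
    have := measurable_damping (p := p) n
    have := measurable_condError (p := p) (ρ := ρ) n
    have hWm : Measurable W := measurable_growthLimit
    simp only [hf3]
    fun_prop
  have m1 : MemLp f1 2 μ := hΔ2.const_mul _
  have m2 : MemLp f2 2 μ := hW2.const_mul _
  have m3 : MemLp f3 2 μ := (hξprod'.const_mul _).mono hf3m.aestronglyMeasurable hdom
  have n1 : lpNorm f1 2 μ = |linCoeff p ρ n| * lpNorm (condError p ρ n) 2 μ :=
    lpNorm_const_mul _ _ _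
  have n2 : lpNorm f2 2 μ = |linCoeff p ρ n - 2| * lpNorm W 2 μ := lpNorm_const_mul _ _ _
  have n3 : lpNorm f3 2 μ ≤ |quadCoeff p ρ n| * (√(constB2 ρ) * (lpNorm (condError p ρ n) 4 μ
      * (lpNorm (condError p ρ n) 4 μ + 2 * lpNorm W 4 μ))) := by
    refine (lpNorm_mono_ae (hξprod'.const_mul _) hdom).trans ?_
    rw [lpNorm_const_mul, hξnorm']
    gcongr
    refine (lpNorm_two_mul_le hΔ4 hsum4).trans ?_
    gcongr
    · exact lpNorm_nonneg
    · refine (lpNorm_add_le hΔ4 (by norm_num)).trans ?_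
      rw [lpNorm_const_mul]; simp
  have n4 : lpNorm f4 2 μ = lpNorm (fun e => (quadCoeff p ρ n * damping p n e - (constC1 p ρ)⁻¹)
      * (rootMark e * W e ^ 2)) 2 μ := lpNorm_fun_neg _ _ _
  rw [lpNorm_congr (measurable_secondStemError n).aestronglyMeasurable hae]
  have t1 := lpNorm_add_le (memLp_secondError h hn) one_le_two (g := f1 + (f2 + (f3 + f4)))
  have t2 := lpNorm_add_le m1 one_le_two (g := f2 + (f3 + f4))
  have t3 := lpNorm_add_le m2 one_le_two (g := f3 + f4)
  have t4 := lpNorm_add_le m3 one_le_two (g := f4)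
  rw [n4] at t4
  linarith

end GWNetwork

/-! ### The effective resistance of a deterministic tree. -/

namespace GWNetwork

variable {m : ℝ}

/-! ### Levels of the tree of words -/

section Levels

variable {ν : List ℕ → ℕ}

lemma nil_mem_wordTree : [] ∈ wordTree ν := by
  intro y i h
  simp at h

lemma append_singleton_mem_wordTree {x : List ℕ} {i : ℕ} :
    x ++ [i] ∈ wordTree ν ↔ x ∈ wordTree ν ∧ i < ν x := by
  constructor
  · intro h
    exact ⟨fun y j hy => h y j (hy.trans (List.prefix_append _ _)), h x i (List.prefix_refl _)⟩
  · rintro ⟨h1, h2⟩ y j hy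
    rcases List.prefix_concat_iff.1 hy with h | h
    · obtain ⟨rfl, h3⟩ := List.append_inj' h rfl
      simpa [List.singleton_inj.1 h3] using h2
    · exact h1 y j h

lemma cons_mem_wordTree {x : List ℕ} {i : ℕ} :
    i :: x ∈ wordTree ν ↔ i < ν [] ∧ x ∈ wordTree (fun y => ν (i :: y)) := by
  constructor
  · intro h
    refine ⟨h [] i (by simp), fun y j hy => h (i :: y) j ?_⟩
    simpa using hy
  · rintro ⟨h1, h2⟩ y j hy
    rcases y with _ | ⟨k, y⟩
    · simp only [List.nil_append, List.cons_prefix_cons, List.nil_prefix, and_true] at hy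
      exact hy ▸ h1
    · simp only [List.cons_append, List.cons_prefix_cons] at hy
      obtain ⟨rfl, hy⟩ := hy
      exact h2 y j hy

end Levels

/-- The words at depth `n` of the tree of an environment. -/
def level : ℕ → Env → Finset (List ℕ)
  | 0, _ => {[]}
  | n + 1, e => (Finset.range (e []).1).biUnion fun i => (level n (shift i e)).image (List.cons i)

lemma mem_level {n : ℕ} {e : Env} {x : List ℕ} :
    x ∈ level n e ↔ x ∈ treeLevel (fun y => (e y).1) n := by
  induction n generalizing e x with
  | zero =>
    simp only [level, Finset.mem_singleton, treeLevel, Set.mem_ofPred_eq, List.length_eq_zero_iff]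
    exact ⟨fun h => ⟨h ▸ nil_mem_wordTree, h⟩, fun h => h.2⟩
  | succ n ih =>
    simp only [level, Finset.mem_biUnion, Finset.mem_range, Finset.mem_image, ih]
    constructor
    · rintro ⟨i, hi, y, ⟨hy, hl⟩, rfl⟩
      exact ⟨cons_mem_wordTree.2 ⟨hi, hy⟩, by simp [hl]⟩
    · rintro ⟨hx, hl⟩
      rcases x with _ | ⟨i, x⟩
      · simp at hl
      · obtain ⟨h1, h2⟩ := cons_mem_wordTree.1 hx
        exact ⟨i, h1, x, ⟨h2, by simpa using hl⟩, rfl⟩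

lemma coe_level (n : ℕ) (e : Env) : (level n e : Set (List ℕ)) = treeLevel (fun y => (e y).1) n :=
  Set.ext fun _ => mem_level

lemma sum_level_succ {M : Type*} [AddCommMonoid M] (n : ℕ) (e : Env) (f : List ℕ → M) :
    ∑ x ∈ level (n + 1) e, f x
      = ∑ i ∈ Finset.range (e []).1, ∑ x ∈ level n (shift i e), f (i :: x) := by
  rw [level, Finset.sum_biUnion]
  · exact Finset.sum_congr rfl fun i _ => Finset.sum_image fun a _ b _ h => by simpa using h
  · intro i _ j _ hij
    rw [Function.onFun, Finset.disjoint_left]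
    simp only [Finset.mem_image, not_exists, not_and]
    rintro _ ⟨a, _, rfl⟩ b _ h
    exact hij (by simpa using (List.cons.inj h).1.symm)

/-! ### Flows on the tree -/

/-- The energy of the amounts `q x` that flow into the words `x` of depth at most `n`, including
the edge above the root. -/
def stemEnergy (m : ℝ) : ℕ → Env → (List ℕ → ℝ) → ℝ
  | 0, e, q => rootMark e * q [] ^ 2
  | n + 1, e, q => rootMark e * q [] ^ 2
      + m * ∑ i ∈ Finset.range (e []).1, stemEnergy m n (shift i e) fun x => q (i :: x)

lemma stemEnergy_eq_sum (n : ℕ) (e : Env) (q : List ℕ → ℝ) :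
    stemEnergy m n e q
      = ∑ k ∈ Finset.range (n + 1), ∑ x ∈ level k e, m ^ k * (e x).2 * q x ^ 2 := by
  induction n generalizing e q with
  | zero => simp [stemEnergy, level, rootMark]
  | succ n ih =>
    rw [Finset.sum_range_succ', stemEnergy]
    simp only [ih, sum_level_succ]
    rw [Finset.sum_comm, Finset.mul_sum, add_comm]
    congr 1
    · refine Finset.sum_congr rfl fun k _ => ?_
      simp only [Finset.mul_sum]
      refine Finset.sum_congr rfl fun i _ => Finset.sum_congr rfl fun x _ => ?_
      simp only [shift]; ring
    · simp [level, rootMark]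

lemma stemEnergy_const_mul (n : ℕ) (e : Env) (c : ℝ) (q : List ℕ → ℝ) :
    stemEnergy m n e (fun x => c * q x) = c ^ 2 * stemEnergy m n e q := by
  simp only [stemEnergy_eq_sum, Finset.mul_sum]
  refine Finset.sum_congr rfl fun k _ => Finset.sum_congr rfl fun x _ => ?_
  ring

lemma inv_stemCond_succ (hm : 0 < m) (n : ℕ) {e : Env} (he : IsRegular e) :
    (stemCond m (n + 1) e)⁻¹ = rootMark e + (treeCond m (n + 1) e)⁻¹ := by
  have h1 := treeCond_pos hm (n + 1) he
  rw [stemCond_succ, inv_div]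
  field_simp
  ring

/-- Parallel law as an inequality: the cheapest way to divide a given current among the children is
bounded below by Cauchy–Schwarz. -/
lemma sq_div_treeCond_le (hm : 0 < m) (n : ℕ) {e : Env} (he : IsRegular e) (s : ℕ → ℝ) :
    (∑ i ∈ Finset.range (e []).1, s i) ^ 2 * (treeCond m (n + 1) e)⁻¹
      ≤ m * ∑ i ∈ Finset.range (e []).1, s i ^ 2 * (stemCond m n (shift i e))⁻¹ := by
  have h1 := Finset.sq_sum_div_le_sum_sq_div (Finset.range (e []).1) s
    (g := fun i => stemCond m n (shift i e)) fun i _ => stemCond_pos hm n (he.shift i)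
  rw [treeCond_succ, branchAvg, mul_inv, inv_inv]
  simp only [div_eq_mul_inv] at h1
  calc _ = m * ((∑ i ∈ Finset.range (e []).1, s i) ^ 2
        * (∑ i ∈ Finset.range (e []).1, stemCond m n (shift i e))⁻¹) := by ring
    _ ≤ _ := mul_le_mul_of_nonneg_left h1 hm.le

/-- Thomson's principle on the tree: no flow has less energy than the resistance. -/
lemma inv_stemCond_le_stemEnergy (hm : 0 < m) (n : ℕ) {e : Env} (he : IsRegular e)
    {q : List ℕ → ℝ} (hq : ∀ x ∈ wordTree (fun y => (e y).1), x.length < n →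
      ∑ i ∈ Finset.range (e x).1, q (x ++ [i]) = q x) :
    q [] ^ 2 * (stemCond m n e)⁻¹ ≤ stemEnergy m n e q := by
  induction n generalizing e q with
  | zero => simp [stemEnergy, stemCond, mul_comm]
  | succ n ih =>
    have h0 := hq [] nil_mem_wordTree (by simp)
    simp only [List.nil_append] at h0
    rw [inv_stemCond_succ hm n he, stemEnergy, mul_add, mul_comm (q [] ^ 2) (rootMark e)]
    refine add_le_add_right ?_ _
    rw [← h0]
    refine (sq_div_treeCond_le hm n he _).trans ?_
    gcongr with i hi
    refine ih (he.shift i) (q := fun x => q (i :: x)) fun x hx hl => ?_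
    exact hq (i :: x) (cons_mem_wordTree.2 ⟨Finset.mem_range.1 hi, hx⟩) (by simpa using hl)

/-- The flow of minimal energy: at every vertex it splits in proportion to the conductances. -/
noncomputable def harmonicFlow (m : ℝ) : ℕ → Env → List ℕ → ℝ
  | _, _, [] => 1
  | 0, _, _ :: _ => 0
  | n + 1, e, i :: x => if i < (e []).1 then
      m⁻¹ * stemCond m n (shift i e) / treeCond m (n + 1) e * harmonicFlow m n (shift i e) x
    else 0

lemma harmonicFlow_nil (n : ℕ) (e : Env) : harmonicFlow m n e [] = 1 := by
  cases n <;> rfl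

lemma harmonicFlow_cons {n : ℕ} {e : Env} {i : ℕ} (hi : i ∈ Finset.range (e []).1) (x : List ℕ) :
    harmonicFlow m (n + 1) e (i :: x)
      = m⁻¹ * stemCond m n (shift i e) / treeCond m (n + 1) e * harmonicFlow m n (shift i e) x :=
  if_pos (Finset.mem_range.1 hi)

lemma harmonicFlow_of_notMem {n : ℕ} {e : Env} {x : List ℕ}
    (hx : x ∉ wordTree (fun y => (e y).1)) : harmonicFlow m n e x = 0 := by
  induction n generalizing e x with
  | zero =>
    cases x with
    | nil => exact absurd nil_mem_wordTree hx
    | cons i x => rfl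
  | succ n ih =>
    cases x with
    | nil => exact absurd nil_mem_wordTree hx
    | cons i x =>
      by_cases hi : i < (e []).1
      · rw [harmonicFlow_cons (Finset.mem_range.2 hi), ih, mul_zero]
        exact fun h => hx (cons_mem_wordTree.2 ⟨hi, h⟩)
      · exact if_neg hi

lemma harmonicFlow_of_lt_length {n : ℕ} {e : Env} {x : List ℕ} (hx : n < x.length) :
    harmonicFlow m n e x = 0 := by
  induction n generalizing e x with
  | zero =>
    cases x with
    | nil => simp at hx
    | cons i x => rfl
  | succ n ih =>
    cases x with
    | nil => simp at hx
    | cons i x =>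
      by_cases hi : i < (e []).1
      · rw [harmonicFlow_cons (Finset.mem_range.2 hi), ih (by simpa using hx), mul_zero]
      · exact if_neg hi

lemma sum_split (hm : 0 < m) (n : ℕ) {e : Env} (he : IsRegular e) :
    ∑ i ∈ Finset.range (e []).1, m⁻¹ * stemCond m n (shift i e) / treeCond m (n + 1) e = 1 := by
  have h1 := treeCond_pos hm (n + 1) he
  rw [← Finset.sum_div, ← Finset.mul_sum]
  exact div_self h1.ne'

lemma sum_harmonicFlow_children (hm : 0 < m) {n : ℕ} {e : Env} (he : IsRegular e) {x : List ℕ}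
    (hl : x.length < n) :
    ∑ i ∈ Finset.range (e x).1, harmonicFlow m n e (x ++ [i]) = harmonicFlow m n e x := by
  induction n generalizing e x with
  | zero => simp at hl
  | succ n ih =>
    cases x with
    | nil =>
      simp only [List.nil_append]
      rw [harmonicFlow_nil, ← sum_split hm n he]
      exact Finset.sum_congr rfl fun i hi => by rw [harmonicFlow_cons hi, harmonicFlow_nil, mul_one]
    | cons i x =>
      by_cases hi : i < (e []).1
      · simp only [List.cons_append, harmonicFlow_cons (Finset.mem_range.2 hi)]
        rw [← Finset.mul_sum]
        exact congrArg _ (ih (he.shift i) (by simpa using hl))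
      · simp only [List.cons_append, harmonicFlow, if_neg hi, Finset.sum_const_zero]

lemma sum_level_harmonicFlow (hm : 0 < m) (n : ℕ) {e : Env} (he : IsRegular e) :
    ∑ x ∈ level n e, harmonicFlow m n e x = 1 := by
  induction n generalizing e with
  | zero => simp [level, harmonicFlow_nil]
  | succ n ih =>
    rw [sum_level_succ, ← sum_split hm n he]
    refine Finset.sum_congr rfl fun i hi => ?_
    simp only [harmonicFlow_cons hi]
    rw [← Finset.mul_sum, ih (he.shift i), mul_one]

/-- Splitting in proportion to the conductances is the equality case of Cauchy–Schwarz, so the bound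
of Thomson's principle is attained at every vertex. -/
lemma stemEnergy_harmonicFlow (hm : 0 < m) (n : ℕ) {e : Env} (he : IsRegular e) :
    stemEnergy m n e (harmonicFlow m n e) = (stemCond m n e)⁻¹ := by
  induction n generalizing e with
  | zero => simp [stemEnergy, stemCond, harmonicFlow_nil]
  | succ n ih =>
    have h1 := treeCond_pos hm (n + 1) he
    rw [inv_stemCond_succ hm n he, stemEnergy, harmonicFlow_nil, one_pow, mul_one]
    congr 1
    have h2 : ∀ i ∈ Finset.range (e []).1,
        stemEnergy m n (shift i e) (fun x => harmonicFlow m (n + 1) e (i :: x))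
          = (m * treeCond m (n + 1) e)⁻¹
            * (m⁻¹ * stemCond m n (shift i e) / treeCond m (n + 1) e) := fun i hi => by
      simp only [harmonicFlow_cons hi]
      rw [stemEnergy_const_mul, ih (he.shift i)]
      have := stemCond_pos hm n (he.shift i)
      field_simp
    rw [Finset.sum_congr rfl h2, ← Finset.mul_sum, sum_split hm n he]
    field_simp

/-! ### Flows as functions on the edges -/

section FlowOf

open Classical in
/-- The antisymmetric function on directed edges in which the amount `q y` flows into the word `y`
from its parent. -/
noncomputable def flowOf (q : List ℕ → ℝ) (x y : List ℕ) : ℝ :=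
  (if ∃ i, y = x ++ [i] then q y else 0) - (if ∃ i, x = y ++ [i] then q x else 0)

lemma not_child_and_parent {x y : List ℕ} (h1 : ∃ i, y = x ++ [i]) : ¬ ∃ i, x = y ++ [i] := by
  obtain ⟨i, rfl⟩ := h1
  rintro ⟨j, h⟩
  simpa using congrArg List.length h

lemma flowOf_child (q : List ℕ → ℝ) (x : List ℕ) (i : ℕ) : flowOf q x (x ++ [i]) = q (x ++ [i]) := by
  rw [flowOf, if_pos ⟨i, rfl⟩, if_neg (not_child_and_parent ⟨i, rfl⟩), sub_zero]

lemma flowOf_antisymm (q : List ℕ → ℝ) (x y : List ℕ) : flowOf q x y = -flowOf q y x := by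
  simp only [flowOf, neg_sub]

/-- An antisymmetric function on the edges of a tree is determined by the amounts entering each word
from its parent. The root has no parent, so the value `s` there is free. -/
lemma eq_flowOf {ν : List ℕ → ℕ} {θ : List ℕ → List ℕ → ℝ} (h1 : ∀ x y, θ x y = -θ y x)
    (h2 : ∀ x y, ¬ (wordTreeGraph ν).Adj x y → θ x y = 0) (s : ℝ) :
    θ = flowOf fun x => if x = [] then s else θ x.dropLast x := by
  have hc : ∀ x i, θ x (x ++ [i])
      = flowOf (fun x => if x = [] then s else θ x.dropLast x) x (x ++ [i]) := by
    intro x i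
    rw [flowOf_child]; simp
  ext x y
  by_cases hxy : ∃ i, y = x ++ [i]
  · obtain ⟨i, rfl⟩ := hxy
    exact hc x i
  by_cases hyx : ∃ i, x = y ++ [i]
  · obtain ⟨i, rfl⟩ := hyx
    rw [h1, flowOf_antisymm, hc]
  · rw [flowOf, if_neg hxy, if_neg hyx, sub_zero]
    exact h2 x y fun h => h.2.2.elim hxy hyx

/-- Indexing each edge by its deeper endpoint, the two orientations contribute equally and cancel
the factor `1/2`. -/
lemma flowEnergy_flowOf {ξ : List ℕ → ℝ} (q : List ℕ → ℝ) :
    flowEnergy (edgeResistance m ξ) (flowOf q)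
      = ∑' y, if y = [] then 0 else ENNReal.ofReal (m ^ y.length * ξ y * q y ^ 2) := by
  classical
  set f : List ℕ → List ℕ → ℝ≥0∞ := fun x y =>
    if ∃ i, y = x ++ [i] then ENNReal.ofReal (m ^ y.length * ξ y * q y ^ 2) else 0 with hf
  have h1 : ∀ x y, ENNReal.ofReal (edgeResistance m ξ x y * flowOf q x y ^ 2) = f x y + f y x := by
    intro x y
    by_cases hxy : ∃ i, y = x ++ [i]
    · simp only [hf, flowOf, if_pos hxy, if_neg (not_child_and_parent hxy), sub_zero, add_zero]
      obtain ⟨i, rfl⟩ := hxy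
      rw [edgeResistance, if_pos (by simp)]
    by_cases hyx : ∃ i, x = y ++ [i]
    · simp only [hf, flowOf, if_pos hyx, if_neg hxy, zero_sub, zero_add, neg_sq]
      obtain ⟨i, rfl⟩ := hyx
      rw [edgeResistance, if_neg (by simp)]
    · simp [hf, flowOf, if_neg hxy, if_neg hyx]
  have h2 : ∀ y, ∑' x, f x y
      = if y = [] then 0 else ENNReal.ofReal (m ^ y.length * ξ y * q y ^ 2) := by
    intro y
    rcases List.eq_nil_or_concat y with rfl | ⟨z, i, rfl⟩
    · simp [hf]
    · rw [tsum_eq_single z]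
      · simp [hf]
      · intro x hx
        refine if_neg ?_
        rintro ⟨j, h⟩
        rw [List.concat_eq_append] at h
        exact hx (List.append_inj' h rfl).1.symm
  rw [flowEnergy]
  simp only [h1, ENNReal.tsum_add]
  rw [ENNReal.tsum_comm, ← two_mul, ← mul_assoc, ENNReal.inv_mul_cancel (by norm_num) (by norm_num),
    one_mul]
  exact tsum_congr h2

/-- Divergence is outflow to the children minus inflow from the parent. Vanishing off the tree keeps
the supports finite, without which `finsum` would take its default value. -/
lemma finsum_flowOf {ν : List ℕ → ℕ} {q : List ℕ → ℝ} (hq : ∀ x ∉ wordTree ν, q x = 0)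
    (x : List ℕ) : ∑ᶠ y, flowOf q x y
      = ∑ i ∈ Finset.range (ν x), q (x ++ [i]) - if x = [] then 0 else q x := by
  classical
  have hs : (Function.support fun y => if ∃ i, y = x ++ [i] then q y else 0)
      ⊆ ((Finset.range (ν x)).image fun i => x ++ [i] : Finset (List ℕ)) := by
    intro y hy
    simp only [Function.mem_support, ne_eq, ite_eq_right_iff, Classical.not_imp] at hy
    obtain ⟨⟨i, rfl⟩, hy⟩ := hy
    have h1 : x ++ [i] ∈ wordTree ν := by
      by_contra hc; exact hy (hq _ hc)
    simpa using (append_singleton_mem_wordTree.1 h1).2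
  have hs' : (Function.support fun y => if ∃ i, x = y ++ [i] then q x else 0)
      ⊆ ({x.dropLast} : Finset (List ℕ)) := by
    intro y hy
    simp only [Function.mem_support, ne_eq, ite_eq_right_iff, Classical.not_imp] at hy
    obtain ⟨⟨i, rfl⟩, hy⟩ := hy
    simp
  simp only [flowOf]
  rw [finsum_sub_distrib ((Finset.finite_toSet _).subset hs) ((Finset.finite_toSet _).subset hs'),
    finsum_eq_sum_of_support_subset _ hs, finsum_eq_sum_of_support_subset _ hs', Finset.sum_image]
  · congr 1
    · exact Finset.sum_congr rfl fun i _ => if_pos ⟨i, rfl⟩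
    · rw [Finset.sum_singleton]
      rcases List.eq_nil_or_concat x with rfl | ⟨z, i, rfl⟩
      · simp
      · simp
  · intro i _ j _ h
    simpa using h

end FlowOf

/-! ### The effective resistance of the tree -/

/-- The words of depth between `1` and `n`, that is, the edges of the tree up to depth `n`. -/
def edgeWords (n : ℕ) (e : Env) : Finset (List ℕ) :=
  (Finset.range n).biUnion fun k => level (k + 1) e

lemma length_of_mem_level {n : ℕ} {e : Env} {x : List ℕ} (hx : x ∈ level n e) : x.length = n :=
  (mem_level.1 hx).2

lemma mem_edgeWords {n : ℕ} {e : Env} {x : List ℕ} :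
    x ∈ edgeWords n e ↔ x ∈ wordTree (fun y => (e y).1) ∧ x ≠ [] ∧ x.length ≤ n := by
  simp only [edgeWords, Finset.mem_biUnion, Finset.mem_range, mem_level, treeLevel,
    Set.mem_ofPred_eq]
  constructor
  · rintro ⟨k, hk, h1, h2⟩
    exact ⟨h1, by rintro rfl; simp at h2, by omega⟩
  · rintro ⟨h1, h2, h3⟩
    have := List.length_pos_iff.2 h2
    exact ⟨x.length - 1, by omega, h1, by omega⟩

lemma sum_edgeWords (n : ℕ) (e : Env) (q : List ℕ → ℝ) :
    ∑ x ∈ edgeWords n e, m ^ x.length * (e x).2 * q x ^ 2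
      = stemEnergy m n e q - rootMark e * q [] ^ 2 := by
  rw [stemEnergy_eq_sum, Finset.sum_range_succ', edgeWords, Finset.sum_biUnion]
  · have h : ∀ k, ∑ x ∈ level (k + 1) e, m ^ x.length * (e x).2 * q x ^ 2
        = ∑ x ∈ level (k + 1) e, m ^ (k + 1) * (e x).2 * q x ^ 2 := fun k =>
      Finset.sum_congr rfl fun x hx => by rw [length_of_mem_level hx]
    have h0 : level 0 e = {[]} := rfl
    simp [h, h0, rootMark]
  · intro i _ j _ hij
    rw [Function.onFun, Finset.disjoint_left]
    intro x hx hx'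
    have h1 := length_of_mem_level hx
    have h2 := length_of_mem_level hx'
    omega

lemma sum_ofReal_edgeWords (hm : 0 < m) (n : ℕ) {e : Env} (he : IsRegular e) (q : List ℕ → ℝ) :
    ∑ x ∈ edgeWords n e, (if x = [] then 0 else ENNReal.ofReal (m ^ x.length * (e x).2 * q x ^ 2))
      = ENNReal.ofReal (stemEnergy m n e q - rootMark e * q [] ^ 2) := by
  rw [← sum_edgeWords, ENNReal.ofReal_sum_of_nonneg]
  · exact Finset.sum_congr rfl fun x hx => if_neg (mem_edgeWords.1 hx).2.1
  · intro x _
    have := (he x).2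
    positivity

lemma isUnitFlow_harmonicFlow (hm : 0 < m) (n : ℕ) {e : Env} (he : IsRegular e) :
    IsUnitFlow (wordTreeGraph fun x => (e x).1) {[]} (treeLevel (fun x => (e x).1) (n + 1))
      (flowOf (harmonicFlow m (n + 1) e)) := by
  have hq : ∀ x ∉ wordTree fun x => (e x).1, harmonicFlow m (n + 1) e x = 0 :=
    fun x hx => harmonicFlow_of_notMem hx
  have hself : ∀ (q : List ℕ → ℝ) x, flowOf q x x = 0 := fun q x => by
    have := flowOf_antisymm q x x
    linarith
  have hout : ∀ x ∉ wordTree (fun x => (e x).1),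
      ∑ i ∈ Finset.range (e x).1, harmonicFlow m (n + 1) e (x ++ [i]) = 0 := fun x hx =>
    Finset.sum_eq_zero fun i _ => hq _ fun h => hx (append_singleton_mem_wordTree.1 h).1
  have hlong : ∀ x : List ℕ, n + 1 ≤ x.length →
      ∑ i ∈ Finset.range (e x).1, harmonicFlow m (n + 1) e (x ++ [i]) = 0 := fun x hx =>
    Finset.sum_eq_zero fun i _ => harmonicFlow_of_lt_length (by simp; omega)
  refine ⟨flowOf_antisymm _, fun x y hxy => ?_, fun x hx => ?_, ?_, ?_⟩
  · have key : ∀ (x : List ℕ) (i : ℕ), ¬ (wordTreeGraph fun x => (e x).1).Adj x (x ++ [i]) →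
        harmonicFlow m (n + 1) e (x ++ [i]) = 0 := fun x i h => hq _ fun hx =>
      h ⟨(append_singleton_mem_wordTree.1 hx).1, hx, Or.inl ⟨i, rfl⟩⟩
    by_cases h1 : ∃ i, y = x ++ [i]
    · obtain ⟨i, rfl⟩ := h1
      rw [flowOf_child, key x i hxy]
    by_cases h2 : ∃ i, x = y ++ [i]
    · obtain ⟨i, rfl⟩ := h2
      rw [flowOf_antisymm, flowOf_child, key y i fun h => hxy h.symm, neg_zero]
    · rw [flowOf, if_neg h1, if_neg h2, sub_zero]
  · rw [finsum_flowOf hq]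
    -- Words off the tree or below the target level also need the node law; there both outflow and
    -- inflow are zero.
    simp only [Set.mem_union, Set.mem_singleton_iff, treeLevel, Set.mem_ofPred_eq, not_or,
      not_and] at hx
    rw [if_neg hx.1]
    by_cases hx1 : x ∈ wordTree fun x => (e x).1
    · rcases lt_or_ge x.length (n + 1) with hl | hl
      · rw [sum_harmonicFlow_children hm he hl, sub_self]
      · rw [hlong x hl, harmonicFlow_of_lt_length (lt_of_le_of_ne hl (Ne.symm (hx.2 hx1))),
          sub_zero]
    · rw [hout x hx1, hq x hx1, sub_zero]
  · rw [finsum_mem_singleton]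
    have h1 : ∀ y, ∑ᶠ _ : y ∈ ({[]} : Set (List ℕ))ᶜ, flowOf (harmonicFlow m (n + 1) e) [] y
        = flowOf (harmonicFlow m (n + 1) e) [] y := fun y => by
      by_cases hy : y = []
      · subst hy; simp [hself]
      · simp [hy]
    rw [finsum_congr h1, finsum_flowOf hq, if_pos rfl, sub_zero,
      sum_harmonicFlow_children hm he (by simp), harmonicFlow_nil]
  · have h1 : ∀ z ∈ treeLevel (fun x => (e x).1) (n + 1),
        ∑ᶠ y ∈ (treeLevel (fun x => (e x).1) (n + 1))ᶜ, flowOf (harmonicFlow m (n + 1) e) y z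
          = harmonicFlow m (n + 1) e z := by
      intro z hz
      have h2 : ∀ y, ∑ᶠ _ : y ∈ (treeLevel (fun x => (e x).1) (n + 1))ᶜ,
          flowOf (harmonicFlow m (n + 1) e) y z = -flowOf (harmonicFlow m (n + 1) e) z y := by
        intro y
        rw [← flowOf_antisymm]
        by_cases hy : y ∈ treeLevel (fun x => (e x).1) (n + 1)
        · have hl : y.length = z.length := hy.2.trans hz.2.symm
          have h3 : flowOf (harmonicFlow m (n + 1) e) y z = 0 := by
            rw [flowOf, if_neg, if_neg, sub_zero]
            · rintro ⟨i, rfl⟩; simp at hl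
            · rintro ⟨i, rfl⟩; simp at hl
          simp [h3]
        · simp [hy]
      have hz0 : z ≠ [] := by
        rintro rfl
        have := hz.2
        simp at this
      rw [finsum_congr h2, finsum_neg_distrib, finsum_flowOf hq, if_neg hz0, hlong z hz.2.ge]
      ring
    rw [finsum_mem_congr rfl h1, ← coe_level, finsum_mem_coe_finset,
      sum_level_harmonicFlow hm _ he]

/-- The harmonic flow gives the upper bound and Thomson's principle the lower one. Both are energies
including the edge above the root, whose contribution `rootMark e` is subtracted on both sides. -/
lemma effResistance_eq (hm : 0 < m) (n : ℕ) {e : Env} (he : IsRegular e) :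
    effResistance (wordTreeGraph fun x => (e x).1) (edgeResistance m fun x => (e x).2) {[]}
      (treeLevel (fun x => (e x).1) (n + 1)) = ENNReal.ofReal (treeCond m (n + 1) e)⁻¹ := by
  refine le_antisymm ?_ (le_iInf₂ fun θ hθ => ?_)
  · refine iInf₂_le_of_le _ (isUnitFlow_harmonicFlow hm n he) ?_
    rw [flowEnergy_flowOf, tsum_eq_sum (s := edgeWords (n + 1) e), sum_ofReal_edgeWords hm _ he,
      stemEnergy_harmonicFlow hm _ he, inv_stemCond_succ hm n he, harmonicFlow_nil]
    · simp
    · intro x hx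
      split_ifs with hx0
      · rfl
      by_cases hx1 : x ∈ wordTree fun y => (e y).1
      · rw [harmonicFlow_of_lt_length]
        · simp
        · by_contra hl
          exact hx (mem_edgeWords.2 ⟨hx1, hx0, not_lt.1 hl⟩)
      · simp [harmonicFlow_of_notMem hx1]
  -- The free value at the root is set to the strength 1, so that the source condition becomes the
  -- node law at the root.
  · set q : List ℕ → ℝ := fun x => if x = [] then 1 else θ x.dropLast x with hq
    have hθq : θ = flowOf q := eq_flowOf hθ.antisymm hθ.support 1
    have hq0 : q [] = 1 := if_pos rfl
    have hqc : ∀ x i, q (x ++ [i]) = θ x (x ++ [i]) := fun x i => by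
      rw [hθq, flowOf_child]
    have hqt : ∀ x ∉ wordTree (fun y => (e y).1), q x = 0 := by
      intro x hx
      rcases List.eq_nil_or_concat x with rfl | ⟨y, i, rfl⟩
      · exact absurd nil_mem_wordTree hx
      · rw [List.concat_eq_append] at hx ⊢
        rw [hqc]
        exact hθ.support _ _ fun h => hx h.2.1
    have hnode : ∀ x ∈ wordTree (fun y => (e y).1), x.length < n + 1 →
        ∑ i ∈ Finset.range (e x).1, q (x ++ [i]) = q x := by
      intro x hx hl
      by_cases hx0 : x = []
      · subst hx0
        have h1 := hθ.source
        rw [finsum_mem_singleton] at h1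
        have h2 : ∀ y, ∑ᶠ _ : y ∈ ({[]} : Set (List ℕ))ᶜ, θ [] y = θ [] y := fun y => by
          by_cases hy : y = []
          · have h3 := hθ.antisymm [] []
            have h4 : θ [] [] = 0 := by linarith
            subst hy; simp [h4]
          · simp [hy]
        rw [finsum_congr h2, hθq, finsum_flowOf hqt, if_pos rfl, sub_zero] at h1
        rw [h1, hq0]
      · have h1 := hθ.node_law x (by
          simp only [Set.mem_union, Set.mem_singleton_iff, hx0, false_or]
          intro h
          exact hl.ne h.2)
        rw [hθq, finsum_flowOf hqt, if_neg hx0] at h1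
        linarith
    have hlow := inv_stemCond_le_stemEnergy hm (n + 1) he hnode
    rw [hq0, inv_stemCond_succ hm n he] at hlow
    rw [hθq, flowEnergy_flowOf]
    -- A competing flow may use edges below the target level; dropping them only lowers its energy.
    refine le_trans ?_ (ENNReal.sum_le_tsum (edgeWords (n + 1) e))
    rw [sum_ofReal_edgeWords hm _ he, hq0]
    exact ENNReal.ofReal_le_ofReal (by linarith)

lemma resistanceToLevel_eq (hm : 0 < m) {n : ℕ} (hn : n ≠ 0) {e : Env} (he : IsRegular e) :
    resistanceToLevel m (fun x => (e x).1) (fun x => (e x).2) n = (treeCond m n e)⁻¹ := by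
  obtain ⟨k, rfl⟩ := Nat.exists_eq_succ_of_ne_zero hn
  rw [resistanceToLevel, effResistance_eq hm k he,
    ENNReal.toReal_ofReal (inv_pos.2 (treeCond_pos hm _ he)).le]

lemma conductanceToLevel_eq (hm : 0 < m) {n : ℕ} (hn : n ≠ 0) {e : Env} (he : IsRegular e) :
    conductanceToLevel m (fun x => (e x).1) (fun x => (e x).2) n = treeCond m n e := by
  rw [conductanceToLevel, resistanceToLevel_eq hm hn he, inv_inv]

end GWNetwork

/-! ### Transfer to the network, and convergence in probability. -/

namespace GWNetwork

/-! ### The environment seen from a word -/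

/-- The environment seen from the word `x`. -/
def shiftWord (x : List ℕ) (e : Env) : Env := fun y => e (x ++ y)

section Words

variable {m : ℝ}

lemma shiftWord_cons (i : ℕ) (x : List ℕ) (e : Env) :
    shiftWord (i :: x) e = shiftWord x (shift i e) := rfl

lemma rootMark_shiftWord (x : List ℕ) (e : Env) : rootMark (shiftWord x e) = (e x).2 := by
  simp [rootMark, shiftWord]

lemma append_mem_wordTree {ν : List ℕ → ℕ} {x y : List ℕ} :
    x ++ y ∈ wordTree ν ↔ x ∈ wordTree ν ∧ y ∈ wordTree fun z => ν (x ++ z) := by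
  induction x generalizing ν with
  | nil => simp [nil_mem_wordTree]
  | cons i x ih =>
    rw [List.cons_append, cons_mem_wordTree, cons_mem_wordTree, ih, and_assoc]
    rfl

/-- Turns iterates of the operator into the weighted level sums in which the series `S` and the
generation sizes are stated. -/
lemma branchAvg_iterate_eq_sum (n : ℕ) (G : Env → ℝ) (e : Env) :
    (branchAvg m)^[n] G e = (m ^ n)⁻¹ * ∑ x ∈ level n e, G (shiftWord x e) := by
  induction n generalizing e with
  | zero =>
    have h : shiftWord [] e = e := rfl
    simp [level, h]
  | succ n ih =>
    rw [Function.iterate_succ_apply', branchAvg, sum_level_succ]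
    simp only [ih, shiftWord_cons]
    rw [← Finset.mul_sum, ← mul_assoc, ← mul_inv, pow_succ']

lemma branchAvg_iterate_eq_finsum (n : ℕ) (G : Env → ℝ) (e : Env) : (branchAvg m)^[n] G e
    = (m ^ n)⁻¹ * ∑ᶠ x ∈ treeLevel (fun y => (e y).1) n, G (shiftWord x e) := by
  rw [branchAvg_iterate_eq_sum, ← coe_level, finsum_mem_coe_finset]

lemma treeLevelBelow_eq {e : Env} {x : List ℕ} (hx : x ∈ wordTree fun y => (e y).1) (k : ℕ) :
    treeLevelBelow (fun y => (e y).1) x (k + x.length)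
      = (fun y => x ++ y) '' (level k (shiftWord x e) : Set (List ℕ)) := by
  ext z
  simp only [treeLevelBelow, Set.mem_ofPred_eq, Set.mem_image, coe_level, treeLevel]
  constructor
  · rintro ⟨⟨h1, h2⟩, y, rfl⟩
    refine ⟨y, ⟨(append_mem_wordTree.1 h1).2, ?_⟩, rfl⟩
    rw [List.length_append] at h2
    omega
  · rintro ⟨y, ⟨h1, h2⟩, rfl⟩
    refine ⟨⟨append_mem_wordTree.2 ⟨hx, h1⟩, ?_⟩, List.prefix_append _ _⟩
    rw [List.length_append]
    omega

lemma normalizedCount_eq {e : Env} {x : List ℕ}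
    (hx : x ∈ wordTree fun y => (e y).1) (k : ℕ) :
    normalizedCount m (fun y => (e y).1) x (k + x.length) = genSize m k (shiftWord x e) := by
  rw [normalizedCount, treeLevelBelow_eq hx, Set.ncard_image_of_injective _
    fun a b h => List.append_cancel_left h, Set.ncard_coe_finset, genSize,
    branchAvg_iterate_eq_sum]
  simp only [Finset.sum_const, nsmul_eq_mul, mul_one]
  congr 1
  rw [← zpow_natCast, ← zpow_neg]
  congr 1
  push_cast
  ring

lemma tendsto_normalizedCount_iff {e : Env} {x : List ℕ}
    (hx : x ∈ wordTree fun y => (e y).1) {w : ℝ} :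
    Tendsto (normalizedCount m (fun y => (e y).1) x) atTop (𝓝 w)
      ↔ Tendsto (fun n => genSize m n (shiftWord x e)) atTop (𝓝 w) := by
  rw [← tendsto_add_atTop_iff_nat x.length]
  simp only [normalizedCount_eq hx]

/-- The two sequences agree up to an index shift by the depth of `x`, so they have the same image
filter and the equality holds even where no limit exists. -/
lemma branchLimit_eq {e : Env} {x : List ℕ} (hx : x ∈ wordTree fun y => (e y).1) :
    branchLimit m (fun y => (e y).1) x = growthLimit m (shiftWord x e) := by
  have h : map (normalizedCount m (fun y => (e y).1) x) atTop
      = map (fun n => genSize m n (shiftWord x e)) atTop := by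
    rw [← map_add_atTop_eq_nat x.length, map_map, map_add_atTop_eq_nat]
    simp only [Function.comp_def, normalizedCount_eq hx]
  rw [branchLimit, growthLimit, limUnder, limUnder, h]

end Words

/-! ### The law of the network -/

/-- Rectangles form a generating π-system. On them, independence of the two families separates the
`X` part from the `Y` part, and independence within each family factorizes the rest. -/
lemma iIndepFun_prodMk {ι Ω α β : Type*} [MeasurableSpace Ω] [MeasurableSpace α]
    [MeasurableSpace β] {P : Measure Ω} {X : ι → Ω → α} {Y : ι → Ω → β}
    (hX : ∀ i, Measurable (X i)) (hY : ∀ i, Measurable (Y i)) (iX : iIndepFun X P)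
    (iY : iIndepFun Y P) (iXY : IndepFun (fun ω i => X i ω) (fun ω i => Y i ω) P) :
    iIndepFun (fun i ω => (X i ω, Y i ω)) P := by
  rw [iIndepFun_iff_iIndep]
  refine iIndepSets.iIndep (fun i => ((hX i).prodMk (hY i)).comap_le)
    (fun i => {s | ∃ t ∈ Set.image2 (· ×ˢ ·) {A : Set α | MeasurableSet A}
      {B : Set β | MeasurableSet B}, (fun ω => (X i ω, Y i ω)) ⁻¹' t = s})
    (fun i => isPiSystem_prod.comap _) (fun i => ?_) ?_
  · rw [← generateFrom_prod, MeasurableSpace.comap_generateFrom]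
    rfl
  · rw [iIndepSets_iff]
    intro s f H
    have h1 : ∀ i, ∃ A B, MeasurableSet A ∧ MeasurableSet B ∧
        (i ∈ s → f i = X i ⁻¹' A ∩ Y i ⁻¹' B) := fun i => by
      by_cases hi : i ∈ s
      · obtain ⟨_, ⟨A, hA, B, hB, rfl⟩, h⟩ := H i hi
        exact ⟨A, B, hA, hB, fun _ => h.symm⟩
      -- Dummy sets outside `s`, so that the choice is a total function of the index.
      · exact ⟨∅, ∅, .empty, .empty, fun h => absurd h hi⟩
    choose A B hA hB hf using h1
    have h2 : ⋂ i ∈ s, f i = (fun ω i => X i ω) ⁻¹' (Set.pi s A)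
        ∩ (fun ω i => Y i ω) ⁻¹' (Set.pi s B) := by
      ext ω
      simp only [Set.mem_iInter, Set.mem_inter_iff, Set.mem_preimage, Set.mem_pi, Finset.mem_coe,
        ← forall_and]
      refine forall_congr' fun i => forall_congr' fun hi => ?_
      rw [hf i hi]; rfl
    have h3 : (fun ω i => X i ω) ⁻¹' (Set.pi s A) = ⋂ i ∈ s, X i ⁻¹' A i := by
      ext ω; simp
    have h4 : (fun ω i => Y i ω) ⁻¹' (Set.pi s B) = ⋂ i ∈ s, Y i ⁻¹' B i := by
      ext ω; simp
    rw [h2, iXY.measure_inter_preimage_eq_mul _ _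
      (MeasurableSet.pi s.countable_toSet fun i _ => hA i)
      (MeasurableSet.pi s.countable_toSet fun i _ => hB i), h3, h4,
      iX.measure_inter_preimage_eq_mul s fun i _ => hA i,
      iY.measure_inter_preimage_eq_mul s fun i _ => hB i, ← Finset.prod_mul_distrib]
    refine Finset.prod_congr rfl fun i hi => ?_
    rw [hf i hi]
    exact ((iXY.comp (measurable_pi_apply i) (measurable_pi_apply i)).measure_inter_preimage_eq_mul
      _ _ (hA i) (hB i)).symm

section Transfer

variable {Ω : Type*} [MeasurableSpace Ω] {P : Measure Ω}
  {p : PMF ℕ} {ρ : Measure ℝ} {ν : List ℕ → Ω → ℕ} {ξ : List ℕ → Ω → ℝ}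

/-- The environment given by the offspring numbers and the marks of a network. -/
def environment (ν : List ℕ → Ω → ℕ) (ξ : List ℕ → Ω → ℝ) (ω : Ω) : Env := fun x => (ν x ω, ξ x ω)

lemma _root_.IsBranchingNetwork.isProbabilityMeasure_mark [IsProbabilityMeasure P]
    (h : IsBranchingNetwork P p ρ ν ξ) :
    IsProbabilityMeasure ρ :=
  h.law_mark [] ▸ Measure.isProbabilityMeasure_map (h.measurable_mark []).aemeasurable

lemma _root_.IsBranchingNetwork.measurePreserving [IsProbabilityMeasure P] [IsProbabilityMeasure ρ]
    (h : IsBranchingNetwork P p ρ ν ξ) :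
    MeasurePreserving (environment ν ξ) P (envLaw p ρ) := by
  have hm : ∀ x, Measurable fun ω => (ν x ω, ξ x ω) := fun x =>
    (h.measurable_offspring x).prodMk (h.measurable_mark x)
  refine ⟨measurable_pi_lambda _ hm, ?_⟩
  have hi := iIndepFun_prodMk h.measurable_offspring h.measurable_mark h.indep_offspring
    h.indep_mark h.indep
  have h1 := (iIndepFun_iff_map_fun_eq_infinitePi_map hm).1 hi
  have h2 : ∀ x, P.map (fun ω => (ν x ω, ξ x ω)) = p.toMeasure.prod ρ := fun x => by
    rw [← h.law_offspring x, ← h.law_mark x]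
    exact (indepFun_iff_map_prod_eq_prod_map_map (h.measurable_offspring x).aemeasurable
      (h.measurable_mark x).aemeasurable).1
      (h.indep.comp (measurable_pi_apply x) (measurable_pi_apply x))
  simp only [h2] at h1
  exact h1

/-- Only the inequality between the measure of a preimage and the image measure is used, so the
deviation events need not be measurable. -/
lemma tendstoInMeasure_comp_measurePreserving {Ω' E : Type*} [MeasurableSpace Ω']
    {μ : Measure Ω'} [PseudoEMetricSpace E] {Φ : Ω → Ω'} (hΦ : MeasurePreserving Φ P μ)
    {f : ℕ → Ω' → E} {g : Ω' → E} (h : TendstoInMeasure μ f atTop g) :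
    TendstoInMeasure P (fun n ω => f n (Φ ω)) atTop fun ω => g (Φ ω) := by
  intro ε hε
  refine tendsto_of_tendsto_of_tendsto_of_le_of_le tendsto_const_nhds (h ε hε)
    (fun _ => zero_le) fun n => ?_
  have := Measure.le_map_apply (μ := P) hΦ.measurable.aemeasurable {x | ε ≤ edist (f n x) (g x)}
  rwa [hΦ.map_eq] at this

end Transfer

/-! ### Almost sure statements for all words -/

section Words

variable {p : PMF ℕ} {ρ : Measure ℝ} [IsProbabilityMeasure ρ]

lemma ae_forall_shiftWord {q : Env → Prop} (hq : ∀ᵐ e ∂(envLaw p ρ), q e) :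
    ∀ᵐ e ∂(envLaw p ρ), ∀ x, q (shiftWord x e) := by
  refine ae_all_iff.2 fun x => ?_
  induction x with
  | nil => exact hq
  | cons i x ih => exact (measurePreserving_shift i).quasiMeasurePreserving.ae ih

end Words

/-! ### Convergence in probability -/

/-- From `1 / (W + ε) = 1 / W - ε / (W * (W + ε))` with `ε = s k / k`: the first part carries the
expansion of `1 / x k`, and the second, multiplied by `1 / x k`, tends to `c₁ * S / W ^ 2`. The
general filter `l` admits subsequences. -/
lemma tendsto_resistance_expansion {l : Filter ℕ} (hl : l ≤ atTop) {x s : ℕ → ℝ}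
    {W S c₁ c₄ c₀ : ℝ} (hW : W ≠ 0) (hc₁ : c₁ ≠ 0) (hs : Tendsto s l (𝓝 S))
    (hx : Tendsto (fun k : ℕ => (k : ℝ) * x k) l (𝓝 c₁⁻¹))
    (hinv : Tendsto (fun k : ℕ => (x k)⁻¹ - c₁ * k - c₄ * Real.log k - c₀) l (𝓝 0)) :
    Tendsto (fun k : ℕ => (x k * (W + s k / k))⁻¹
      - (c₁ / W * k + c₄ / W * Real.log k + 1 / W * (c₀ - 1 / W * (c₁ * S)))) l (𝓝 0) := by
  have hk : Tendsto (fun k : ℕ => (k : ℝ)) l atTop := tendsto_natCast_atTop_atTop.mono_left hl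
  have h1 : Tendsto (fun k : ℕ => W + s k / k) l (𝓝 W) := by
    simpa using (hs.div_atTop hk).const_add W
  have h2 := (hinv.const_mul W⁻¹).add ((((hx.inv₀ (inv_ne_zero hc₁)).mul hs).div
    (h1.const_mul W) (mul_ne_zero hW hW)).const_sub (c₁ * S / (W * W)))
  rw [inv_inv, mul_zero, sub_self, add_zero] at h2
  refine h2.congr' ?_
  filter_upwards [h1.eventually_ne hW, hk.eventually_ne_atTop 0,
    hx.eventually_ne (inv_ne_zero hc₁)] with k h3 h4 h5
  have h6 : x k ≠ 0 := right_ne_zero_of_mul h5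
  have h7 : W * k + s k ≠ 0 := by
    have : W * k + s k = (W + s k / k) * k := by field_simp
    rw [this]; exact mul_ne_zero h3 h4
  have h8 : W + s k / k = (W * k + s k) / k := by field_simp
  simp only [Pi.div_apply]
  rw [h8]
  field_simp
  ring

section Env

variable {p : PMF ℕ} {ρ : Measure ℝ} [IsProbabilityMeasure ρ]

lemma tendstoInMeasure_condError (h : Admissible p ρ) :
    TendstoInMeasure (envLaw p ρ) (fun (n : ℕ) e => (n : ℝ) * condError p ρ n e) atTop
      (fluctuation p ρ) := by
  refine tendstoInMeasure_of_tendsto_eLpNorm (p := 2) two_ne_zero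
    (fun n => ((measurable_condError n).const_mul _).aestronglyMeasurable)
    measurable_fluctuation.aestronglyMeasurable ?_
  have h1 := ENNReal.tendsto_ofReal (tendsto_lpNorm_two_secondError h)
  rw [ENNReal.ofReal_zero] at h1
  refine h1.congr' ?_
  filter_upwards [eventually_ge_atTop 4] with n hn
  rw [ofReal_lpNorm (memLp_secondError h hn)]
  rfl

lemma tendsto_log_div_atTop : Tendsto (fun n : ℕ => Real.log n / (n : ℝ)) atTop (𝓝 0) :=
  (Real.isLittleO_log_id_atTop.tendsto_div_nhds_zero).comp tendsto_natCast_atTop_atTop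

/-- Convergence in probability is almost sure convergence along a further subsequence of every
subsequence; there the deterministic expansion applies pointwise, as `W > 0` almost surely. -/
lemma tendstoInMeasure_inv_treeCond (h : Admissible p ρ) {c₀ : ℝ}
    (hc₀ : (fun n : ℕ => (condMoment p ρ 1 n)⁻¹ - constC1 p ρ * n - constC4 p ρ * Real.log n - c₀)
      =O[atTop] (fun n : ℕ => Real.log n / (n : ℝ))) :
    TendstoInMeasure (envLaw p ρ) (fun (n : ℕ) e => (treeCond (meanOffspring p) n e)⁻¹
      - (constC1 p ρ / growthLimit (meanOffspring p) e * n
        + constC4 p ρ / growthLimit (meanOffspring p) e * Real.log n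
        + 1 / growthLimit (meanOffspring p) e * (c₀ - 1 / growthLimit (meanOffspring p) e
          * (constC1 p ρ * fluctuation p ρ e)))) atTop fun _ => 0 := by
  have hW : Measurable (growthLimit (meanOffspring p)) := measurable_growthLimit
  have hS : Measurable (fluctuation p ρ) := measurable_fluctuation
  refine (exists_seq_tendstoInMeasure_atTop_iff fun n => ?_).2 fun ns hns => ?_
  · have hT : Measurable (treeCond (meanOffspring p) n) := measurable_treeCond n
    exact Measurable.aestronglyMeasurable (by fun_prop)
  obtain ⟨ns', hns', hlim⟩ :=
    ((tendstoInMeasure_condError h).comp hns.tendsto_atTop).exists_seq_tendsto_ae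
  refine ⟨ns', hns', ?_⟩
  have hl : Tendsto (fun i => ns (ns' i)) atTop atTop :=
    hns.tendsto_atTop.comp hns'.tendsto_atTop
  filter_upwards [hlim, growthLimit_pos h rfl] with e he hWe
  have h1 := tendsto_resistance_expansion (l := map (fun i => ns (ns' i)) atTop) hl hWe.ne'
    h.constC1_pos.ne' (s := fun n => (n : ℝ) * condError p ρ n e) (tendsto_map'_iff.2 he)
    ((tendsto_nat_mul_condMoment h).mono_left hl)
    ((hc₀.trans_tendsto tendsto_log_div_atTop).mono_left hl)
  refine (tendsto_map'_iff.1 h1).congr' ?_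
  filter_upwards [hl.eventually_ge_atTop 4] with i hi
  have hx := (condMoment_one_pos h hi).ne'
  have hn : (ns (ns' i) : ℝ) ≠ 0 := by
    exact_mod_cast (by omega : ns (ns' i) ≠ 0)
  simp only [Function.comp_apply]
  congr 2
  rw [mul_div_cancel_left₀ _ hn, condError, add_sub_cancel, mul_div_cancel₀ _ hx]

end Env

section Network

variable {Ω : Type*} [MeasurableSpace Ω] {P : Measure Ω} [IsProbabilityMeasure P]
  {p : PMF ℕ} {ρ : Measure ℝ} [IsProbabilityMeasure ρ] {ν : List ℕ → Ω → ℕ} {ξ : List ℕ → Ω → ℝ}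

lemma _root_.IsBranchingNetwork.ae_environment (hnet : IsBranchingNetwork P p ρ ν ξ) {q : Env → Prop}
    (hq : ∀ᵐ e ∂(envLaw p ρ), q e) : ∀ᵐ ω ∂P, q (environment ν ξ ω) :=
  hnet.measurePreserving.quasiMeasurePreserving.ae hq

lemma _root_.IsBranchingNetwork.conductanceToLevel_ae_eq (hnet : IsBranchingNetwork P p ρ ν ξ)
    (h : Admissible p ρ) {n : ℕ} (hn : n ≠ 0) :
    (fun ω => conductanceToLevel (meanOffspring p) (fun x => ν x ω) (fun x => ξ x ω) n)
      =ᵐ[P] fun ω => treeCond (meanOffspring p) n (environment ν ξ ω) := by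
  filter_upwards [hnet.ae_environment (ae_isRegular h)] with ω hω
  exact conductanceToLevel_eq (e := environment ν ξ ω) (zero_lt_one.trans h.one_lt_mean) hn hω

lemma _root_.IsBranchingNetwork.resistanceToLevel_ae_eq (hnet : IsBranchingNetwork P p ρ ν ξ)
    (h : Admissible p ρ) {n : ℕ} (hn : n ≠ 0) :
    (fun ω => resistanceToLevel (meanOffspring p) (fun x => ν x ω) (fun x => ξ x ω) n)
      =ᵐ[P] fun ω => (treeCond (meanOffspring p) n (environment ν ξ ω))⁻¹ := by
  filter_upwards [hnet.ae_environment (ae_isRegular h)] with ω hω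
  exact resistanceToLevel_eq (e := environment ν ξ ω) (zero_lt_one.trans h.one_lt_mean) hn hω

lemma _root_.IsBranchingNetwork.integral_conductanceToLevel (hnet : IsBranchingNetwork P p ρ ν ξ)
    (h : Admissible p ρ) {n : ℕ} (hn : n ≠ 0) :
    ∫ ω, conductanceToLevel (meanOffspring p) (fun x => ν x ω) (fun x => ξ x ω) n ∂P
      = condMoment p ρ 1 n := by
  rw [integral_congr_ae (hnet.conductanceToLevel_ae_eq h hn), condMoment,
    ← hnet.measurePreserving.map_eq, integral_map hnet.measurePreserving.measurable.aemeasurable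
      ((measurable_treeCond n).pow_const 1).aestronglyMeasurable]
  simp only [pow_one]

end Network

end GWNetwork

/-! ### Assembly on the original probability space. -/

open GWNetwork

theorem theorem4 {Ω : Type*} [MeasurableSpace Ω] (P : Measure Ω) [IsProbabilityMeasure P]
    (p : PMF ℕ) (ρ : Measure ℝ) (ν : List ℕ → Ω → ℕ) (ξ : List ℕ → Ω → ℝ)
    (hnet : IsBranchingNetwork P p ρ ν ξ)
    (hp0 : p 0 = 0)
    (hmean : 1 < meanOffspring p)
    (hpos : ∀ᵐ t ∂ρ, 0 < t)
    (hξ3 : Integrable (fun t : ℝ => t ^ 3) ρ)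
    (hξinv : Integrable (fun t : ℝ => t⁻¹) ρ)
    (hν4 : Integrable (fun k : ℕ => (k : ℝ) ^ 4) p.toMeasure)
    (m c₁ c₄ : ℝ) (hm : m = meanOffspring p) (hc₁ : c₁ = constC1 p ρ) (hc₄ : c₄ = constC4 p ρ)
    (T : ℕ → Ω → Set (List ℕ)) (hT : T = fun n ω => treeLevel (fun x => ν x ω) n)
    (W : List ℕ → Ω → ℝ) (hW : W = fun x ω => branchLimit m (fun y => ν y ω) x)
    (R C : ℕ → Ω → ℝ)
    (hR : R = fun n ω => resistanceToLevel m (fun x => ν x ω) (fun x => ξ x ω) n)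
    (hC : C = fun n ω => conductanceToLevel m (fun x => ν x ω) (fun x => ξ x ω) n)
    (D : ℕ → Ω → ℝ)
    (hD : D = fun ℓ ω => (m ^ ℓ)⁻¹ * ∑ᶠ x ∈ T ℓ ω, W x ω * (1 - ξ x ω / c₁ * W x ω)) :
    -- the limits `W^(x)` exist and `W = W^(root)` is positive, almost surely
    (∀ᵐ ω ∂P,
      (∀ x ∈ wordTree (fun y => ν y ω),
        Tendsto (normalizedCount m (fun y => ν y ω) x) atTop (𝓝 (W x ω))) ∧
      0 < W [] ω) ∧
    -- the series `∑_{ℓ ≥ 1} D_ℓ` converges almost surely and in `L²`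
    (∀ᵐ ω ∂P, Summable (fun ℓ : ℕ => D (ℓ + 1) ω)) ∧
    Tendsto (fun K : ℕ =>
      eLpNorm (fun ω => (∑ ℓ ∈ Finset.range K, D (ℓ + 1) ω) - ∑' ℓ : ℕ, D (ℓ + 1) ω) 2 P)
      atTop (𝓝 0) ∧
    -- the rate of convergence of the normalized conductance
    TendstoInMeasure P
      (fun (n : ℕ) ω => (n : ℝ) * (C n ω / (∫ ω', C n ω' ∂P) - W [] ω)) atTop
      (fun ω => ∑' ℓ : ℕ, D (ℓ + 1) ω) ∧
    -- the expansion of the resistance, with the constant `c₀` of the expansion of `E[C_n]`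
    ∃ c₀ : ℝ,
      ((fun n : ℕ => (∫ ω, C n ω ∂P)
          - (1 / (c₁ * n) - c₄ / c₁ ^ 2 * (Real.log n / (n : ℝ) ^ 2)
              - c₀ / c₁ ^ 2 * (1 / (n : ℝ) ^ 2)))
        =O[atTop] fun n : ℕ => Real.log n ^ 2 / (n : ℝ) ^ 3) ∧
      TendstoInMeasure P
        (fun (n : ℕ) ω => R n ω
          - (c₁ / W [] ω * n + c₄ / W [] ω * Real.log n
              + 1 / W [] ω * (c₀ - 1 / W [] ω *
                  ∑' ℓ : ℕ, (m ^ (ℓ + 1))⁻¹ *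
                    ∑ᶠ x ∈ T (ℓ + 1) ω, W x ω * (c₁ - ξ x ω * W x ω)))) atTop
        (fun _ => 0) := by
  have : IsProbabilityMeasure ρ := hnet.isProbabilityMeasure_mark
  have h : Admissible p ρ := ⟨hp0, hmean, hpos, hξ3, hξinv, hν4⟩
  subst hm hc₁ hc₄
  have hΦ := hnet.measurePreserving
  have hWx : ∀ ω, ∀ x ∈ wordTree (fun y => ν y ω),
      W x ω = growthLimit (meanOffspring p) (shiftWord x (environment ν ξ ω)) := fun ω x hx => by
    rw [hW]; exact branchLimit_eq (e := environment ν ξ ω) hx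
  have hW0 : ∀ ω, W [] ω = growthLimit (meanOffspring p) (environment ν ξ ω) := fun ω =>
    hWx ω [] nil_mem_wordTree
  -- The level sums of the theorem are the iterates of `branchAvg` on the centred function, since
  -- the mark and the limit at a word are those of the environment seen from it.
  have hDℓ : ∀ ℓ ω, D ℓ ω
      = (branchAvg (meanOffspring p))^[ℓ] (fluctuationTerm p ρ) (environment ν ξ ω) := by
    intro ℓ ω
    rw [hD, hT, branchAvg_iterate_eq_finsum]
    refine congrArg _ (finsum_mem_congr rfl fun x hx => ?_)
    rw [hWx ω x hx.1, fluctuationTerm, rootMark_shiftWord]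
    rfl
  have hS : ∀ ω, ∑' ℓ : ℕ, D (ℓ + 1) ω = fluctuation p ρ (environment ν ξ ω) := fun ω =>
    tsum_congr fun ℓ => hDℓ (ℓ + 1) ω
  have hS' : ∀ ω, ∑' ℓ : ℕ, (meanOffspring p ^ (ℓ + 1))⁻¹ *
      ∑ᶠ x ∈ T (ℓ + 1) ω, W x ω * (constC1 p ρ - ξ x ω * W x ω)
        = constC1 p ρ * fluctuation p ρ (environment ν ξ ω) := by
    intro ω
    rw [← hS, ← tsum_mul_left]
    refine tsum_congr fun ℓ => ?_
    rw [hD, ← mul_assoc, mul_comm (constC1 p ρ), mul_assoc]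
    refine congrArg _ ?_
    rw [mul_finsum_mem]
    refine finsum_mem_congr rfl fun x _ => ?_
    have := h.constC1_pos.ne'
    field_simp
  -- Level 0 is excluded: there `treeCond` has only a default value, by truncated subtraction. The
  -- limits ignore it.
  have hCn : ∀ n, n ≠ 0 → C n =ᵐ[P] fun ω => treeCond (meanOffspring p) n (environment ν ξ ω) :=
    fun n hn => by rw [hC]; exact hnet.conductanceToLevel_ae_eq h hn
  have hEC : ∀ n, n ≠ 0 → ∫ ω, C n ω ∂P = condMoment p ρ 1 n := fun n hn => by
    rw [hC]; exact hnet.integral_conductanceToLevel h hn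
  obtain ⟨c₀, hc₀, hexp⟩ := condMoment_expansion h
  refine ⟨?_, ?_, ?_, ?_, c₀, ?_, ?_⟩
  · filter_upwards [hnet.ae_environment (ae_forall_shiftWord (ae_tendsto_genSize h rfl)),
      hnet.ae_environment (growthLimit_pos h rfl)] with ω h1 h2
    refine ⟨fun x hx => ?_, (hW0 ω).symm ▸ h2⟩
    rw [hWx ω x hx]
    exact (tendsto_normalizedCount_iff (e := environment ν ξ ω) hx).2 (h1 x)
  · filter_upwards [hnet.ae_environment (ae_summable_fluctuation h)] with ω hω
    simp only [hDℓ]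
    exact (summable_nat_add_iff (f := fun n =>
      (branchAvg (meanOffspring p))^[n] (fluctuationTerm p ρ) (environment ν ξ ω)) 1).2 hω
  · have h0 : Summable fun n => lpNorm
        ((branchAvg (meanOffspring p))^[n + 1] (fluctuationTerm p ρ)) 2 (envLaw p ρ) :=
      (summable_nat_add_iff (f := fun n => lpNorm
        ((branchAvg (meanOffspring p))^[n] (fluctuationTerm p ρ)) 2 (envLaw p ρ)) 1).2
        (summable_lpNorm_fluctuation h)
    refine (tendsto_eLpNorm_sum_sub_tsum one_le_two
      (fun n => memLp_fluctuation_iterate h (n + 1)) h0).congr fun K => ?_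
    have h2 : Measurable fun e => (∑ ℓ ∈ Finset.range K,
        (branchAvg (meanOffspring p))^[ℓ + 1] (fluctuationTerm p ρ) e)
          - ∑' ℓ : ℕ, (branchAvg (meanOffspring p))^[ℓ + 1] (fluctuationTerm p ρ) e :=
      (Finset.measurable_fun_sum _ fun k _ =>
        measurable_branchAvg_iterate measurable_fluctuationTerm (k + 1)).sub
          measurable_fluctuation
    refine (eLpNorm_comp_measurePreserving h2.aestronglyMeasurable hΦ).symm.trans ?_
    simp only [Function.comp_def, hDℓ]
  · refine (tendstoInMeasure_comp_measurePreserving hΦ (tendstoInMeasure_condError h)).congr'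
      ?_ (.of_forall fun ω => (hS ω).symm)
    filter_upwards [eventually_ne_atTop 0] with n hn
    filter_upwards [hCn n hn] with ω hω
    rw [hω, hEC n hn, hW0]
    rfl
  · refine hexp.congr' ?_ .rfl
    filter_upwards [eventually_ne_atTop 0] with n hn
    rw [hEC n hn]
  · refine (tendstoInMeasure_comp_measurePreserving hΦ (tendstoInMeasure_inv_treeCond h hc₀)).congr'
      ?_ .rfl
    filter_upwards [eventually_ne_atTop 0] with n hn
    filter_upwards [hnet.resistanceToLevel_ae_eq h hn] with ω hω
    rw [hR, hS', hW0]
    simp only [hω]
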